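/- Work with finitary type theories in the style of Haselwarter and Bauer: raw rules $\Xi \Longrightarrow \mathcal{B}[e]$ over a signature generate a deductive system for judgements $\Theta;\Gamma \vdash \mathsf{BB}[e]$ and boundaries $\Theta;\Gamma\vdash\mathsf{BB}$, where $\Theta$ is a metavariable context, $\Gamma$ a variable context, $\mathsf{BB}$ an abstracted boundary $\{x_1{:}A_1\}\cdots\{x_m{:}A_m\}\,\mathcal{B}$ filled with a head $e$. The boundary thesis $\mathcal{B}$ is one of $\Box\ \mathsf{type}$, $\Box : A$ (the object boundaries), $A\equiv B$ by $\Box$, and $s\equiv t:A$ by $\Box$. A theory is *finitary* if every specific rule has a derivably well-formed premise context and conclusion boundary; it is *standard* if moreover its specific object rules are symbol rules (their head is a symbol $\mathsf{S}$ applied generically to the premises) and each symbol has exactly one. A raw rule $\Xi \Longrightarrow \mathcal{J}$ is *deterministic* if every judgement $\Theta;\Gamma\vdash\mathcal{J}'$ admits at most one instantiation $I$ of $\Xi$ over $\Theta;\Gamma$ with $I_*\mathcal{J}=\mathcal{J}'$. A derivable raw rule is *object-invertible* if for every derivably well-formed $\Theta$ and every instantiation $I$ of $\Xi$ over $\Theta;[\,]$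 for which $\Theta;[\,]\vdash I_*\mathcal{J}$ is derivable, the instantiation that agrees with $I$ on the object metavariables of $\Xi$ and is generic on the equational ones is derivable over $\Theta$ extended by the $I$-instances of the equational premises of $\Xi$. A *type computation rule* is a derivable finitary rule $\Xi\Longrightarrow P\equiv B$ with $\Xi\Longrightarrow P\ \mathsf{type}$ deterministic and object-invertible. A *term computation rule* is a derivable finitary rule $\Xi\Longrightarrow p\equiv v:B$ with $p$ a term symbol application and $\Xi\Longrightarrow p:\tau(p)$ deterministic and object-invertible, where $\tau(p)$ is the natural type of $p$, read off from its symbol rule. An *extensionality rule* is a derivable finitary rule $\Xi,\ s{:}(\Box{:}P),\ t{:}(\Box{:}P),\ \Phi \Longrightarrow s\equiv t:P$ with $\Phi$ consisting of equational premises and $\Xi\Longrightarrow P\ \mathsf{type}$ deterministic and object-invertible. Fix a standard type theory, a family $\mathcal{C}$ of computation rules, a family $\mathcal{E}$ of extensionality rules, and for each symbol (and each object metavariable of $\Theta$, treated as a symbol with term arguments) a set of principal arguments. Let the following relations be defined inductively, together with equality checking $\Theta;\Gamma\vdash\mathsf{BB}[e\sim e']$. Equality checking normalizes types and compares them. It compares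 terms by first normalizing their type; if that type matches the type $P$ of a rule in $\mathcal{E}$, by checking the equational premises of such a rule, and otherwise by normalizing both terms and comparing the results. Comparison of normalized expressions is structural, with principal arguments again compared as normalized expressions and the other arguments by $\sim$. All relations pass under abstractions. * $\Theta;\Gamma\vdash\mathcal{B}[s \triangleright_c e']$: some rule $\Xi\Longrightarrow\mathcal{B}'[p\equiv v]$ in $\mathcal{C}$ and some instantiation $I$ of $\Xi$ over $\Theta;\Gamma$ satisfy $I_*p=s$, $e'=I_*v$, and $\Theta;\Gamma\vdash I_*(\mathsf{BB}[d\sim d'])$ for each equational premise $\mathsf{BB}[d\equiv d']$ of $\Xi$. * $\Theta;\Gamma\vdash\mathcal{B}[\mathsf{S}(\vec e)\triangleright_p\mathsf{S}(\vec e')]$: each principal $e_i$ normalizes to $e'_i$ at the boundary which the rule for $\mathsf{S}$ assigns to it (instantiated by $\vec e$), and $e_i=e'_i$ for every other $i$; analogously for metavariable applications. * $\Theta;\Gamma\vdash\mathsf{BB}[e\triangleright e']$ (full normalization): free variables and dummy arguments normalize to themselves; $\{x\}e\triangleright\{x\}e'$ if $e\triangleright e'$ in the context extended by $x$; for an application $e$,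 if $e\triangleright_p e_1$, then $e\triangleright e'$ holds if $e_1\triangleright_c e_2$ and $e_2\triangleright e'$ for some $e_2$, and $e\triangleright e_1$ holds if the left-hand side of no rule in $\mathcal{C}$ matches $e_1$. **Theorem (Soundness of normalization).** Let $\Gamma$ be a derivably well-formed variable context over a derivably well-formed metavariable context $\Theta$, and let $\mathsf{BB}$ be an object boundary (abstracted or not) and $\mathcal{B}$ a non-abstracted object boundary. 1. If $\Theta;\Gamma\vdash\mathsf{BB}[e]$ is derivable and $\Theta;\Gamma\vdash\mathsf{BB}[e\triangleright e']$, then $\Theta;\Gamma\vdash\mathsf{BB}[e\equiv e']$ and $\Theta;\Gamma\vdash\mathsf{BB}[e']$ are derivable. 2. If $\Theta;\Gamma\vdash\mathcal{B}[e]$ is derivable and $\Theta;\Gamma\vdash\mathcal{B}[e\triangleright_p e']$, then $\Theta;\Gamma\vdash\mathcal{B}[e\equiv e']$ and $\Theta;\Gamma\vdash\mathcal{B}[e']$ are derivable. 3. If $\Theta;\Gamma\vdash\mathcal{B}[e]$ is derivable and $\Theta;\Gamma\vdash\mathcal{B}[e\triangleright_c e']$, then $\Theta;\Gamma\vdash\mathcal{B}[e\equiv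 e']$ and $\Theta;\Gamma\vdash\mathcal{B}[e']$ are derivable. -/

import Mathlib

/-!
Finitary type theories in well-scoped form.

Names are replaced by positions.  A variable context with `n` entries declares the variables
`Fin n` (the most recently declared one is `0`); the same de Bruijn indices serve for bound
variables.  A metavariable context with arities `μ` declares the positions `MVar μ` (the most
recently declared one is the head of the list `μ`).  Every expression below is syntactically valid
by construction: symbols and metavariables respect arities, and variables are in scope.
-/

universe u v w x

namespace FTT

/-! ### Syntactic classes, arities, signatures -/

/-- The four syntactic classes: types, terms, type equations, term equations. -/
inductive Cls : Type
  | ty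
  | tm
  | eqTy
  | eqTm

/-- The object classes are those of types and of terms. -/
def Cls.IsObj (c : Cls) : Prop := c = Cls.ty ∨ c = Cls.tm

/-- The class of equations between entities of a given object class
(an equality class is sent to itself; this value is never used). -/
def Cls.eqn : Cls → Cls
  | .ty => .eqTy
  | .tm => .eqTm
  | .eqTy => .eqTy
  | .eqTm => .eqTm

/-- A metavariable arity: a syntactic class and a number of bound variables. -/
structure MArity : Type where
  cls : Cls
  bind : ℕ

/-- `MVar μ α` is the type of positions in the list `μ` which carry the arity `α`. -/
inductive MVar : List MArity → MArity → Type
  | here {α : MArity} {μ : List MArity} : MVar (α :: μ) α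
  | there {α β : MArity} {μ : List MArity} : MVar μ α → MVar (β :: μ) α

/-- A signature: type symbols and term symbols, each with the list of arities of its arguments
(the last argument is the head of the list). -/
structure Signature : Type (u + 1) where
  Sym : Cls → Type u
  isObj : ∀ {c : Cls}, Sym c → c.IsObj
  arity : ∀ {c : Cls}, Sym c → List MArity

/-! ### Expressions -/

/-- `Arg S μ c m n` is the type of arguments of arity `(c, m)`, over metavariables of arities `μ`
and over `n` variables.  For `m = 0` these are the expressions of class `c`. -/
inductive Arg (S : Signature.{u}) (μ : List MArity) : Cls → ℕ → ℕ → Type u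
  | var {n : ℕ} (i : Fin n) : Arg S μ .tm 0 n
  | sym {c : Cls} {n : ℕ} (f : S.Sym c)
      (es : ∀ α : MArity, MVar (S.arity f) α → Arg S μ α.cls α.bind n) : Arg S μ c 0 n
  | mvar {c : Cls} {k n : ℕ} (hc : c.IsObj) (M : MVar μ ⟨c, k⟩)
      (ts : Fin k → Arg S μ .tm 0 n) : Arg S μ c 0 n
  | starTy {n : ℕ} : Arg S μ .eqTy 0 n
  | starTm {n : ℕ} : Arg S μ .eqTm 0 n
  | abs {c : Cls} {m n : ℕ} (e : Arg S μ c m (n + 1)) : Arg S μ c (m + 1) n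

/-- Type expressions. -/
abbrev Ty (S : Signature.{u}) (μ : List MArity) (n : ℕ) : Type u := Arg S μ .ty 0 n

/-- Term expressions. -/
abbrev Tm (S : Signature.{u}) (μ : List MArity) (n : ℕ) : Type u := Arg S μ .tm 0 n

/-- An instantiation of metavariables of arities `ν` by arguments over `μ` and `n` variables. -/
abbrev Inst (S : Signature.{u}) (ν μ : List MArity) (n : ℕ) : Type u :=
  ∀ α : MArity, MVar ν α → Arg S μ α.cls α.bind n

/-- Extension of a renaming of variables under a binder. -/
def liftRen {n k : ℕ} (ρ : Fin n → Fin k) : Fin (n + 1) → Fin (k + 1) :=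
  Fin.cases 0 (fun i => (ρ i).succ)

/-- Renaming of variables. -/
def Arg.rename {S : Signature.{u}} {μ : List MArity} :
    {c : Cls} → {m n k : ℕ} → (Fin n → Fin k) → Arg S μ c m n → Arg S μ c m k
  | _, _, _, _, ρ, .var i => .var (ρ i)
  | _, _, _, _, ρ, .sym f es => .sym f (fun α M => (es α M).rename ρ)
  | _, _, _, _, ρ, .mvar hc M ts => .mvar hc M (fun j => (ts j).rename ρ)
  | _, _, _, _, _, .starTy => .starTy
  | _, _, _, _, _, .starTm => .starTm
  | _, _, _, _, ρ, .abs e => .abs (e.rename (liftRen ρ))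

/-- Extension of a substitution under a binder. -/
def liftSub {S : Signature.{u}} {μ : List MArity} {n k : ℕ} (σ : Fin n → Tm S μ k) :
    Fin (n + 1) → Tm S μ (k + 1) :=
  Fin.cases (.var 0) (fun i => (σ i).rename Fin.succ)

/-- Simultaneous capture-avoiding substitution of terms for variables. -/
def Arg.subst {S : Signature.{u}} {μ : List MArity} :
    {c : Cls} → {m n k : ℕ} → (Fin n → Tm S μ k) → Arg S μ c m n → Arg S μ c m k
  | _, _, _, _, σ, .var i => σ i
  | _, _, _, _, σ, .sym f es => .sym f (fun α M => (es α M).subst σ)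
  | _, _, _, _, σ, .mvar hc M ts => .mvar hc M (fun j => (ts j).subst σ)
  | _, _, _, _, _, .starTy => .starTy
  | _, _, _, _, _, .starTm => .starTm
  | _, _, _, _, σ, .abs e => .abs (e.subst (liftSub σ))

/-- Renaming of metavariables. -/
def Arg.mrename {S : Signature.{u}} {μ ν : List MArity} (ρ : ∀ α : MArity, MVar μ α → MVar ν α) :
    {c : Cls} → {m n : ℕ} → Arg S μ c m n → Arg S ν c m n
  | _, _, _, .var i => .var i
  | _, _, _, .sym f es => .sym f (fun α M => (es α M).mrename ρ)
  | _, _, _, .mvar hc M ts => .mvar hc (ρ _ M) (fun j => (ts j).mrename ρ)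
  | _, _, _, .starTy => .starTy
  | _, _, _, .starTm => .starTm
  | _, _, _, .abs e => .abs (e.mrename ρ)

/-- The body of an abstraction. -/
def Arg.body {S : Signature.{u}} {μ : List MArity} {c : Cls} {m n : ℕ} :
    Arg S μ c (m + 1) n → Arg S μ c m (n + 1)
  | .abs e => e

/-- `e.instAux σ ts` strips the abstractions of `e = {x₁} ⋯ {xₘ} b`, substitutes `ts` for
`x₁, …, xₘ`, and applies `σ` to the remaining variables. -/
def Arg.instAux {S : Signature.{u}} {μ : List MArity} {c : Cls} {k : ℕ} :
    {m n : ℕ} → Arg S μ c m n → (Fin n → Tm S μ k) → (Fin m → Tm S μ k) → Arg S μ c 0 k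
  | 0, _, e, σ, _ => e.subst σ
  | _ + 1, _, e, σ, ts => e.body.instAux (Fin.cases (ts 0) σ) (fun j => ts j.succ)

/-- `b[ts/xs]` for `e = {x₁} ⋯ {xₘ} b`. -/
def Arg.inst {S : Signature.{u}} {μ : List MArity} {c : Cls} {m n : ℕ} (e : Arg S μ c m n)
    (ts : Fin m → Tm S μ n) : Arg S μ c 0 n :=
  e.instAux Arg.var ts

/-- Weakening of an instantiation by one variable. -/
def Inst.wk {S : Signature.{u}} {ν μ : List MArity} {n : ℕ} (I : Inst S ν μ n) :
    Inst S ν μ (n + 1) :=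
  fun α M => (I α M).rename Fin.succ

/-- The action of an instantiation on arguments. -/
def Arg.act {S : Signature.{u}} {ν μ : List MArity} :
    {c : Cls} → {m n : ℕ} → Inst S ν μ n → Arg S ν c m n → Arg S μ c m n
  | _, _, _, _, .var i => .var i
  | _, _, _, I, .sym f es => .sym f (fun α M => (es α M).act I)
  | _, _, _, I, .mvar _ M ts => (I _ M).inst (fun j => (ts j).act I)
  | _, _, _, _, .starTy => .starTy
  | _, _, _, _, .starTm => .starTm
  | _, _, _, I, .abs e => .abs (e.act I.wk)

/-- The action of an instantiation over `n` variables on an argument without free variables. -/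
def Arg.actC {S : Signature.{u}} {ν μ : List MArity} {c : Cls} {m n : ℕ} (I : Inst S ν μ n)
    (e : Arg S ν c m 0) : Arg S μ c m n :=
  (e.rename Fin.elim0).act I

/-- The dummy argument `{x₁} ⋯ {xₘ} ⋆` of the class of equations between entities of class `c`. -/
def Arg.dummy {S : Signature.{u}} {μ : List MArity} (c : Cls) :
    (m : ℕ) → {n : ℕ} → Arg S μ c.eqn m n
  | 0, _ => match c with
    | .ty => .starTy
    | .tm => .starTm
    | .eqTy => .starTy
    | .eqTm => .starTm
  | m + 1, _ => .abs (Arg.dummy c m)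

/-- The head `M(t₁, …, tₖ)`; it is a dummy when `M` is an equality metavariable. -/
def Arg.mapp {S : Signature.{u}} {μ : List MArity} {n k : ℕ} :
    {c : Cls} → MVar μ ⟨c, k⟩ → (Fin k → Tm S μ n) → Arg S μ c 0 n
  | .ty, M, ts => .mvar (Or.inl rfl) M ts
  | .tm, M, ts => .mvar (Or.inr rfl) M ts
  | .eqTy, _, _ => .starTy
  | .eqTm, _, _ => .starTm

/-- Iterated abstraction, given as a function of the abstracted variables and of the renaming
which weakens the outer variables. -/
def Arg.abstract {S : Signature.{u}} {μ : List MArity} {c : Cls} :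
    (m : ℕ) → {n : ℕ} → (∀ k : ℕ, (Fin m → Tm S μ k) → (Fin n → Fin k) → Arg S μ c 0 k) →
      Arg S μ c m n
  | 0, n, F => F n Fin.elim0 id
  | m + 1, _, F => .abs (Arg.abstract m
      (fun k ts ρ => F k (Fin.cases (.var (ρ 0)) ts) (fun i => ρ i.succ)))

/-- The generic application `{x₁} ⋯ {xₖ} M(x₁, …, xₖ)`, respectively `{x₁} ⋯ {xₖ} ⋆` when `M` is an
equality metavariable. -/
def genApp (S : Signature.{u}) {μ : List MArity} {n : ℕ} (α : MArity) (M : MVar μ α) :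
    Arg S μ α.cls α.bind n :=
  Arg.abstract α.bind (fun _ ts _ => Arg.mapp M ts)

/-! ### Boundaries -/

/-- Abstracted boundaries of arity `(c, m)`; those with `m = 0` are the boundary theses. -/
inductive Bdry (S : Signature.{u}) (μ : List MArity) : Cls → ℕ → ℕ → Type u
  | ty {n : ℕ} : Bdry S μ .ty 0 n
  | tm {n : ℕ} (A : Ty S μ n) : Bdry S μ .tm 0 n
  | eqTy {n : ℕ} (A B : Ty S μ n) : Bdry S μ .eqTy 0 n
  | eqTm {n : ℕ} (s t : Tm S μ n) (A : Ty S μ n) : Bdry S μ .eqTm 0 n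
  | abs {c : Cls} {m n : ℕ} (A : Ty S μ n) (BB : Bdry S μ c m (n + 1)) : Bdry S μ c (m + 1) n

/-- Renaming of variables in a boundary. -/
def Bdry.rename {S : Signature.{u}} {μ : List MArity} :
    {c : Cls} → {m n k : ℕ} → (Fin n → Fin k) → Bdry S μ c m n → Bdry S μ c m k
  | _, _, _, _, _, .ty => .ty
  | _, _, _, _, ρ, .tm A => .tm (A.rename ρ)
  | _, _, _, _, ρ, .eqTy A B => .eqTy (A.rename ρ) (B.rename ρ)
  | _, _, _, _, ρ, .eqTm s t A => .eqTm (s.rename ρ) (t.rename ρ) (A.rename ρ)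
  | _, _, _, _, ρ, .abs A BB => .abs (A.rename ρ) (BB.rename (liftRen ρ))

/-- Renaming of metavariables in a boundary. -/
def Bdry.mrename {S : Signature.{u}} {μ ν : List MArity}
    (ρ : ∀ α : MArity, MVar μ α → MVar ν α) :
    {c : Cls} → {m n : ℕ} → Bdry S μ c m n → Bdry S ν c m n
  | _, _, _, .ty => .ty
  | _, _, _, .tm A => .tm (A.mrename ρ)
  | _, _, _, .eqTy A B => .eqTy (A.mrename ρ) (B.mrename ρ)
  | _, _, _, .eqTm s t A => .eqTm (s.mrename ρ) (t.mrename ρ) (A.mrename ρ)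
  | _, _, _, .abs A BB => .abs (A.mrename ρ) (BB.mrename ρ)

/-- The action of an instantiation on boundaries. -/
def Bdry.act {S : Signature.{u}} {ν μ : List MArity} :
    {c : Cls} → {m n : ℕ} → Inst S ν μ n → Bdry S ν c m n → Bdry S μ c m n
  | _, _, _, _, .ty => .ty
  | _, _, _, I, .tm A => .tm (A.act I)
  | _, _, _, I, .eqTy A B => .eqTy (A.act I) (B.act I)
  | _, _, _, I, .eqTm s t A => .eqTm (s.act I) (t.act I) (A.act I)
  | _, _, _, I, .abs A BB => .abs (A.act I) (BB.act I.wk)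

/-- The action of an instantiation over `n` variables on a boundary without free variables. -/
def Bdry.actC {S : Signature.{u}} {ν μ : List MArity} {c : Cls} {m n : ℕ} (I : Inst S ν μ n)
    (BB : Bdry S ν c m 0) : Bdry S μ c m n :=
  (BB.rename Fin.elim0).act I

/-- For `BB = {x₁ : A₁} ⋯ {xₘ : Aₘ} B`, the boundary thesis `B[ts/xs]`, where `σ` is applied to the
remaining variables. -/
def Bdry.instAux {S : Signature.{u}} {μ : List MArity} {k : ℕ} :
    {c : Cls} → {m n : ℕ} → Bdry S μ c m n → (Fin n → Tm S μ k) → (Fin m → Tm S μ k) →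
      Bdry S μ c 0 k
  | _, _, _, .ty, _, _ => .ty
  | _, _, _, .tm A, σ, _ => .tm (A.subst σ)
  | _, _, _, .eqTy A B, σ, _ => .eqTy (A.subst σ) (B.subst σ)
  | _, _, _, .eqTm s t A, σ, _ => .eqTm (s.subst σ) (t.subst σ) (A.subst σ)
  | _, _, _, .abs _ BB, σ, ts => BB.instAux (Fin.cases (ts 0) σ) (fun j => ts j.succ)

/-- For `BB = {x₁ : A₁} ⋯ {xₘ : Aₘ} B`, the types `Aⱼ[t₁/x₁, …, tⱼ₋₁/xⱼ₋₁]`, where `σ` is applied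
to the remaining variables. -/
def Bdry.argTyAux {S : Signature.{u}} {μ : List MArity} {k : ℕ} :
    {c : Cls} → {m n : ℕ} → Bdry S μ c m n → (Fin n → Tm S μ k) → (Fin m → Tm S μ k) →
      Fin m → Ty S μ k
  | _, 0, _, _, _, _ => Fin.elim0
  | _, _ + 1, _, .abs A BB, σ, ts =>
      Fin.cases (A.subst σ) (BB.argTyAux (Fin.cases (ts 0) σ) (fun j => ts j.succ))

/-- `B[ts/xs]` for a boundary `{x₁ : A₁} ⋯ {xₘ : Aₘ} B` without free variables. -/
def Bdry.inst {S : Signature.{u}} {μ : List MArity} {c : Cls} {m n : ℕ} (BB : Bdry S μ c m 0)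
    (ts : Fin m → Tm S μ n) : Bdry S μ c 0 n :=
  BB.instAux Fin.elim0 ts

/-- `Aⱼ[t₁/x₁, …, tⱼ₋₁/xⱼ₋₁]` for a boundary `{x₁ : A₁} ⋯ {xₘ : Aₘ} B` without free variables. -/
def Bdry.argTy {S : Signature.{u}} {μ : List MArity} {c : Cls} {m n : ℕ} (BB : Bdry S μ c m 0)
    (ts : Fin m → Tm S μ n) (j : Fin m) : Ty S μ n :=
  BB.argTyAux Fin.elim0 ts j

/-- The type `A` of a term boundary `□ : A`. -/
def Bdry.type {S : Signature.{u}} {μ : List MArity} {n : ℕ} : Bdry S μ .tm 0 n → Ty S μ n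
  | .tm A => A

/-- The equation boundary `BB[e₁ ≡ e₂ by □]` obtained from an object boundary `BB`
(an equality boundary is returned unchanged; this value is never used). -/
def Bdry.eqn {S : Signature.{u}} {μ : List MArity} :
    {c : Cls} → {m n : ℕ} → Bdry S μ c m n → Arg S μ c m n → Arg S μ c m n → Bdry S μ c.eqn m n
  | _, _, _, .ty, A, B => .eqTy A B
  | _, _, _, .tm A, s, t => .eqTm s t A
  | _, _, _, .eqTy A B, _, _ => .eqTy A B
  | _, _, _, .eqTm s t A, _, _ => .eqTm s t A
  | _, _, _, .abs A BB, e₁, e₂ => .abs A (BB.eqn e₁.body e₂.body)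

/-! ### Contexts -/

/-- Variable contexts. -/
inductive Ctx (S : Signature.{u}) (μ : List MArity) : ℕ → Type u
  | nil : Ctx S μ 0
  | snoc {n : ℕ} (Γ : Ctx S μ n) (A : Ty S μ n) : Ctx S μ (n + 1)

/-- The type of a variable in a variable context. -/
def Ctx.get {S : Signature.{u}} {μ : List MArity} : {n : ℕ} → Ctx S μ n → Fin n → Ty S μ n
  | 0, _ => Fin.elim0
  | _ + 1, .snoc Γ A => Fin.cases (A.rename Fin.succ) (fun i => (Γ.get i).rename Fin.succ)

/-- Metavariable contexts: each boundary is without free variables and refers only to the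
metavariables before it. -/
inductive MCtx (S : Signature.{u}) : List MArity → Type u
  | nil : MCtx S []
  | snoc {μ : List MArity} {α : MArity} (Θ : MCtx S μ) (BB : Bdry S μ α.cls α.bind 0) :
      MCtx S (α :: μ)

/-- The boundary of a metavariable, weakened to the whole metavariable context. -/
def MCtx.get {S : Signature.{u}} : {μ : List MArity} → MCtx S μ → {α : MArity} → MVar μ α →
    Bdry S μ α.cls α.bind 0
  | _, .snoc _ BB, _, .here => BB.mrename (fun _ => MVar.there)
  | _, .snoc Θ _, _, .there M => (Θ.get M).mrename (fun _ => MVar.there)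

/-! ### Judgements, rules, raw type theories -/

/-- Abstracted judgements and abstracted boundaries.  A judgement is a boundary together with
the head which fills it: `judg BB e` is `BB[e]`. -/
inductive Stmt (S : Signature.{u}) (μ : List MArity) (c : Cls) (m n : ℕ) : Type u
  | judg (BB : Bdry S μ c m n) (e : Arg S μ c m n) : Stmt S μ c m n
  | bdry (BB : Bdry S μ c m n) : Stmt S μ c m n

/-- The judgement `BB[e₁ ≡ e₂]`, for an object boundary `BB`. -/
def Stmt.eqn {S : Signature.{u}} {μ : List MArity} {c : Cls} {m n : ℕ} (BB : Bdry S μ c m n)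
    (e₁ e₂ : Arg S μ c m n) : Stmt S μ c.eqn m n :=
  .judg (BB.eqn e₁ e₂) (Arg.dummy c m)

/-- A raw rule `Ξ ⟹ B[e]` whose conclusion is of class `c`. -/
structure RawRule (S : Signature.{u}) (c : Cls) : Type u where
  ar : List MArity
  prem : MCtx S ar
  bdry : Bdry S ar c 0 0
  head : Arg S ar c 0 0

/-- A raw type theory: a family of raw rules, sorted by the class of the conclusion. -/
structure RawTheory (S : Signature.{u}) : Type (max u (v + 1)) where
  Idx : Cls → Type v
  rule : ∀ {c : Cls}, Idx c → RawRule S c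

/-- The deductive system associated with a raw type theory: `T.Derives Θ Γ J` says that `Θ; Γ ⊢ J`
is derivable.  In the rules `I` instantiates all premises `Ξ = [M₁ : BB₁, …]` of a raw rule; since
`BBᵢ` only mentions metavariables before `Mᵢ`, acting on it by `I` and by the initial segment of
`I` before `Mᵢ` is the same. -/
inductive RawTheory.Derives {S : Signature.{u}} (T : RawTheory.{u, v} S) {μ : List MArity}
    (Θ : MCtx S μ) : {n : ℕ} → Ctx S μ n → {c : Cls} → {m : ℕ} → Stmt S μ c m n → Prop
  -- variables, metavariables, abstraction
  | var {n : ℕ} {Γ : Ctx S μ n} (a : Fin n) :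
      T.Derives Θ Γ (.judg (.tm (Γ.get a)) (.var a))
  | mvar {n : ℕ} {Γ : Ctx S μ n} {c : Cls} {k : ℕ} (M : MVar μ ⟨c, k⟩) (ts : Fin k → Tm S μ n) :
      (∀ j, T.Derives Θ Γ (.judg (.tm ((Θ.get M).argTy ts j)) (ts j))) →
      T.Derives Θ Γ (.bdry ((Θ.get M).inst ts)) →
      T.Derives Θ Γ (.judg ((Θ.get M).inst ts) (Arg.mapp M ts))
  | mvarCongrTy {n : ℕ} {Γ : Ctx S μ n} {k : ℕ} (M : MVar μ ⟨.ty, k⟩) (ss ts : Fin k → Tm S μ n) :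
      (∀ j, T.Derives Θ Γ (.judg (.tm ((Θ.get M).argTy ss j)) (ss j))) →
      (∀ j, T.Derives Θ Γ (.judg (.tm ((Θ.get M).argTy ts j)) (ts j))) →
      (∀ j, T.Derives Θ Γ (.judg (.eqTm (ss j) (ts j) ((Θ.get M).argTy ss j)) .starTm)) →
      T.Derives Θ Γ (.judg (.eqTy (Arg.mapp M ss) (Arg.mapp M ts)) .starTy)
  | mvarCongrTm {n : ℕ} {Γ : Ctx S μ n} {k : ℕ} (M : MVar μ ⟨.tm, k⟩) (ss ts : Fin k → Tm S μ n) :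
      (∀ j, T.Derives Θ Γ (.judg (.tm ((Θ.get M).argTy ss j)) (ss j))) →
      (∀ j, T.Derives Θ Γ (.judg (.tm ((Θ.get M).argTy ts j)) (ts j))) →
      (∀ j, T.Derives Θ Γ (.judg (.eqTm (ss j) (ts j) ((Θ.get M).argTy ss j)) .starTm)) →
      T.Derives Θ Γ
        (.judg (.eqTy ((Θ.get M).inst ss).type ((Θ.get M).inst ts).type) .starTy) →
      T.Derives Θ Γ
        (.judg (.eqTm (Arg.mapp M ss) (Arg.mapp M ts) ((Θ.get M).inst ss).type) .starTm)
  | abs {n : ℕ} {Γ : Ctx S μ n} {c : Cls} {m : ℕ} {A : Ty S μ n} {BB : Bdry S μ c m (n + 1)}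
      {e : Arg S μ c m (n + 1)} :
      T.Derives Θ Γ (.judg .ty A) →
      T.Derives Θ (Γ.snoc A) (.judg BB e) →
      T.Derives Θ Γ (.judg (.abs A BB) (.abs e))
  -- equality rules
  | tyRefl {n : ℕ} {Γ : Ctx S μ n} {A : Ty S μ n} :
      T.Derives Θ Γ (.judg .ty A) →
      T.Derives Θ Γ (.judg (.eqTy A A) .starTy)
  | tySym {n : ℕ} {Γ : Ctx S μ n} {A B : Ty S μ n} :
      T.Derives Θ Γ (.judg (.eqTy A B) .starTy) →
      T.Derives Θ Γ (.judg (.eqTy B A) .starTy)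
  | tyTran {n : ℕ} {Γ : Ctx S μ n} {A B C : Ty S μ n} :
      T.Derives Θ Γ (.judg (.eqTy A B) .starTy) →
      T.Derives Θ Γ (.judg (.eqTy B C) .starTy) →
      T.Derives Θ Γ (.judg (.eqTy A C) .starTy)
  | tmRefl {n : ℕ} {Γ : Ctx S μ n} {t : Tm S μ n} {A : Ty S μ n} :
      T.Derives Θ Γ (.judg (.tm A) t) →
      T.Derives Θ Γ (.judg (.eqTm t t A) .starTm)
  | tmSym {n : ℕ} {Γ : Ctx S μ n} {s t : Tm S μ n} {A : Ty S μ n} :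
      T.Derives Θ Γ (.judg (.eqTm s t A) .starTm) →
      T.Derives Θ Γ (.judg (.eqTm t s A) .starTm)
  | tmTran {n : ℕ} {Γ : Ctx S μ n} {s t r : Tm S μ n} {A : Ty S μ n} :
      T.Derives Θ Γ (.judg (.eqTm s t A) .starTm) →
      T.Derives Θ Γ (.judg (.eqTm t r A) .starTm) →
      T.Derives Θ Γ (.judg (.eqTm s r A) .starTm)
  | convTm {n : ℕ} {Γ : Ctx S μ n} {t : Tm S μ n} {A B : Ty S μ n} :
      T.Derives Θ Γ (.judg (.tm A) t) →
      T.Derives Θ Γ (.judg (.eqTy A B) .starTy) →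
      T.Derives Θ Γ (.judg (.tm B) t)
  | convEq {n : ℕ} {Γ : Ctx S μ n} {s t : Tm S μ n} {A B : Ty S μ n} :
      T.Derives Θ Γ (.judg (.eqTm s t A) .starTm) →
      T.Derives Θ Γ (.judg (.eqTy A B) .starTy) →
      T.Derives Θ Γ (.judg (.eqTm s t B) .starTm)
  -- well-formed boundaries
  | bdryTy {n : ℕ} {Γ : Ctx S μ n} :
      T.Derives Θ Γ (.bdry .ty)
  | bdryTm {n : ℕ} {Γ : Ctx S μ n} {A : Ty S μ n} :
      T.Derives Θ Γ (.judg .ty A) →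
      T.Derives Θ Γ (.bdry (.tm A))
  | bdryEqTy {n : ℕ} {Γ : Ctx S μ n} {A B : Ty S μ n} :
      T.Derives Θ Γ (.judg .ty A) →
      T.Derives Θ Γ (.judg .ty B) →
      T.Derives Θ Γ (.bdry (.eqTy A B))
  | bdryEqTm {n : ℕ} {Γ : Ctx S μ n} {s t : Tm S μ n} {A : Ty S μ n} :
      T.Derives Θ Γ (.judg .ty A) →
      T.Derives Θ Γ (.judg (.tm A) s) →
      T.Derives Θ Γ (.judg (.tm A) t) →
      T.Derives Θ Γ (.bdry (.eqTm s t A))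
  | bdryAbs {n : ℕ} {Γ : Ctx S μ n} {c : Cls} {m : ℕ} {A : Ty S μ n}
      {BB : Bdry S μ c m (n + 1)} :
      T.Derives Θ Γ (.judg .ty A) →
      T.Derives Θ (Γ.snoc A) (.bdry BB) →
      T.Derives Θ Γ (.bdry (.abs A BB))
  -- instantiations of the specific rules
  | rule {n : ℕ} {Γ : Ctx S μ n} {c : Cls} (i : T.Idx c) (I : Inst S (T.rule i).ar μ n) :
      (∀ (α : MArity) (M : MVar (T.rule i).ar α),
        T.Derives Θ Γ (.judg (((T.rule i).prem.get M).actC I) (I α M))) →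
      T.Derives Θ Γ (.bdry ((T.rule i).bdry.actC I)) →
      T.Derives Θ Γ (.judg ((T.rule i).bdry.actC I) ((T.rule i).head.actC I))
  -- congruence rules of the specific object rules
  | congrTy {n : ℕ} {Γ : Ctx S μ n} (i : T.Idx .ty) (I J : Inst S (T.rule i).ar μ n) :
      (∀ (α : MArity) (M : MVar (T.rule i).ar α),
        T.Derives Θ Γ (.judg (((T.rule i).prem.get M).actC I) (I α M))) →
      (∀ (α : MArity) (M : MVar (T.rule i).ar α),
        T.Derives Θ Γ (.judg (((T.rule i).prem.get M).actC J) (J α M))) →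
      (∀ (α : MArity) (M : MVar (T.rule i).ar α), α.cls.IsObj →
        T.Derives Θ Γ (.eqn (((T.rule i).prem.get M).actC I) (I α M) (J α M))) →
      T.Derives Θ Γ
        (.judg (.eqTy ((T.rule i).head.actC I) ((T.rule i).head.actC J)) .starTy)
  | congrTm {n : ℕ} {Γ : Ctx S μ n} (i : T.Idx .tm) (I J : Inst S (T.rule i).ar μ n) :
      (∀ (α : MArity) (M : MVar (T.rule i).ar α),
        T.Derives Θ Γ (.judg (((T.rule i).prem.get M).actC I) (I α M))) →
      (∀ (α : MArity) (M : MVar (T.rule i).ar α),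
        T.Derives Θ Γ (.judg (((T.rule i).prem.get M).actC J) (J α M))) →
      (∀ (α : MArity) (M : MVar (T.rule i).ar α), α.cls.IsObj →
        T.Derives Θ Γ (.eqn (((T.rule i).prem.get M).actC I) (I α M) (J α M))) →
      T.Derives Θ Γ
        (.judg (.eqTy ((T.rule i).bdry.actC I).type ((T.rule i).bdry.actC J).type) .starTy) →
      T.Derives Θ Γ
        (.judg (.eqTm ((T.rule i).head.actC I) ((T.rule i).head.actC J)
          ((T.rule i).bdry.actC I).type) .starTm)

/-- Well-formed metavariable contexts: `⊢ Θ mctx`. -/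
inductive RawTheory.WfMCtx {S : Signature.{u}} (T : RawTheory.{u, v} S) :
    {μ : List MArity} → MCtx S μ → Prop
  | nil : T.WfMCtx MCtx.nil
  | snoc {μ : List MArity} {α : MArity} {Θ : MCtx S μ} {BB : Bdry S μ α.cls α.bind 0} :
      T.WfMCtx Θ → T.Derives Θ Ctx.nil (.bdry BB) → T.WfMCtx (Θ.snoc BB)

/-- Well-formed variable contexts over a well-formed metavariable context: `Θ ⊢ Γ vctx`. -/
inductive RawTheory.WfCtx {S : Signature.{u}} (T : RawTheory.{u, v} S) {μ : List MArity}
    (Θ : MCtx S μ) : {n : ℕ} → Ctx S μ n → Prop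
  | nil : T.WfMCtx Θ → T.WfCtx Θ Ctx.nil
  | snoc {n : ℕ} {Γ : Ctx S μ n} {A : Ty S μ n} :
      T.WfCtx Θ Γ → T.Derives Θ Γ (.judg .ty A) → T.WfCtx Θ (Γ.snoc A)

/-- A derivable instantiation of `Ξ` over `Θ; Γ`. -/
def RawTheory.DerivableInst {S : Signature.{u}} (T : RawTheory.{u, v} S) {ν μ : List MArity}
    {n : ℕ} (Ξ : MCtx S ν) (Θ : MCtx S μ) (Γ : Ctx S μ n) (I : Inst S ν μ n) : Prop :=
  ∀ (α : MArity) (M : MVar ν α), T.Derives Θ Γ (.judg ((Ξ.get M).actC I) (I α M))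

/-- A derivable raw rule. -/
def RawTheory.DerivableRule {S : Signature.{u}} (T : RawTheory.{u, v} S) {c : Cls}
    (R : RawRule S c) : Prop :=
  T.Derives R.prem Ctx.nil (.judg R.bdry R.head)

/-- A finitary rule: its premises and the boundary of its conclusion are well-formed. -/
def RawTheory.FinitaryRule {S : Signature.{u}} (T : RawTheory.{u, v} S) {c : Cls}
    (R : RawRule S c) : Prop :=
  T.WfMCtx R.prem ∧ T.Derives R.prem Ctx.nil (.bdry R.bdry)

/-- A finitary type theory. -/
def RawTheory.IsFinitary {S : Signature.{u}} (T : RawTheory.{u, v} S) : Prop :=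
  ∀ (c : Cls) (i : T.Idx c), T.FinitaryRule (T.rule i)

/-- The symbol rule `Ξ ⟹ B[f(M̂₁, …, M̂ₙ)]` of a symbol `f`. -/
def symbolRule {S : Signature.{u}} {c : Cls} (f : S.Sym c) (Ξ : MCtx S (S.arity f))
    (B : Bdry S (S.arity f) c 0 0) : RawRule S c where
  ar := S.arity f
  prem := Ξ
  bdry := B
  head := .sym f (genApp S)

/-- `Ξ ⟹ B[f(M̂₁, …, M̂ₙ)]` is a specific rule of the theory, associated with `f`. -/
def RawTheory.IsRuleFor {S : Signature.{u}} (T : RawTheory.{u, v} S) {c : Cls} (f : S.Sym c)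
    (Ξ : MCtx S (S.arity f)) (B : Bdry S (S.arity f) c 0 0) : Prop :=
  ∃ i : T.Idx c, T.rule i = symbolRule f Ξ B

/-- A standard type theory: a finitary type theory whose specific object rules are symbol rules,
such that each symbol has precisely one associated rule. -/
structure RawTheory.IsStandard {S : Signature.{u}} (T : RawTheory.{u, v} S) : Prop where
  finitary : T.IsFinitary
  isSymbolRule : ∀ (c : Cls) (i : T.Idx c), c.IsObj →
    ∃ (f : S.Sym c) (Ξ : MCtx S (S.arity f)) (B : Bdry S (S.arity f) c 0 0),
      T.rule i = symbolRule f Ξ B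
  existsUnique : ∀ (c : Cls) (f : S.Sym c), ∃! i : T.Idx c,
    ∃ (Ξ : MCtx S (S.arity f)) (B : Bdry S (S.arity f) c 0 0), T.rule i = symbolRule f Ξ B

/-- `A` is the natural type of a term with respect to `Θ; Γ`.  In a standard type theory every term
has precisely one. -/
inductive RawTheory.NaturalType {S : Signature.{u}} (T : RawTheory.{u, v} S) {μ : List MArity}
    (Θ : MCtx S μ) {n : ℕ} (Γ : Ctx S μ n) : Tm S μ n → Ty S μ n → Prop
  | var (a : Fin n) : T.NaturalType Θ Γ (.var a) (Γ.get a)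
  | mvar {k : ℕ} (hc : Cls.tm.IsObj) (M : MVar μ ⟨.tm, k⟩) (ts : Fin k → Tm S μ n) :
      T.NaturalType Θ Γ (.mvar hc M ts) ((Θ.get M).inst ts).type
  | sym (f : S.Sym .tm) (es : Inst S (S.arity f) μ n) (Ξ : MCtx S (S.arity f))
      (B : Bdry S (S.arity f) .tm 0 0) (h : T.IsRuleFor f Ξ B) :
      T.NaturalType Θ Γ (.sym f es) (B.actC es).type

/-! ### Deterministic and object-invertible rules -/

/-- A deterministic rule: every judgement has at most one matching instantiation. -/
def RawRule.Deterministic {S : Signature.{u}} {c : Cls} (R : RawRule S c) : Prop :=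
  ∀ (μ : List MArity) (_ : MCtx S μ) (n : ℕ) (_ : Ctx S μ n)
    (BB : Bdry S μ c 0 n) (e : Arg S μ c 0 n) (I J : Inst S R.ar μ n),
    (R.bdry.actC I = BB ∧ R.head.actC I = e) →
    (R.bdry.actC J = BB ∧ R.head.actC J = e) → I = J

/-- The arities of the equational residue: `μ` extended by the equality arities in `ν`. -/
def resAr (μ : List MArity) : List MArity → List MArity
  | [] => μ
  | ⟨.ty, _⟩ :: ν => resAr μ ν
  | ⟨.tm, _⟩ :: ν => resAr μ ν
  | ⟨.eqTy, k⟩ :: ν => ⟨.eqTy, k⟩ :: resAr μ ν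
  | ⟨.eqTm, k⟩ :: ν => ⟨.eqTm, k⟩ :: resAr μ ν

/-- The inclusion of the metavariables of `μ` in those of the residue. -/
def resIncl {μ : List MArity} : (ν : List MArity) → (α : MArity) → MVar μ α → MVar (resAr μ ν) α
  | [], _, M => M
  | ⟨.ty, _⟩ :: ν, α, M => resIncl ν α M
  | ⟨.tm, _⟩ :: ν, α, M => resIncl ν α M
  | ⟨.eqTy, _⟩ :: ν, α, M => .there (resIncl ν α M)
  | ⟨.eqTm, _⟩ :: ν, α, M => .there (resIncl ν α M)

/-- The equational residue: `Θ` extended by the instantiated equational premises of `Ξ`. -/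
def residue {S : Signature.{u}} {μ : List MArity} (Θ : MCtx S μ) :
    {ν : List MArity} → MCtx S ν → Inst S ν μ 0 → MCtx S (resAr μ ν)
  | _, .nil, _ => Θ
  | ⟨.ty, _⟩ :: ν, .snoc Ξ _, I => residue (ν := ν) Θ Ξ (fun α M => I α M.there)
  | ⟨.tm, _⟩ :: ν, .snoc Ξ _, I => residue (ν := ν) Θ Ξ (fun α M => I α M.there)
  | ⟨.eqTy, k⟩ :: ν, .snoc Ξ BB, I =>
      .snoc (α := ⟨.eqTy, k⟩) (residue (ν := ν) Θ Ξ (fun α M => I α M.there))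
        ((BB.actC (fun α M => I α M.there)).mrename (resIncl ν))
  | ⟨.eqTm, k⟩ :: ν, .snoc Ξ BB, I =>
      .snoc (α := ⟨.eqTm, k⟩) (residue (ν := ν) Θ Ξ (fun α M => I α M.there))
        ((BB.actC (fun α M => I α M.there)).mrename (resIncl ν))

/-- The residual instantiation: `I` on object metavariables, and the generic application on equality
metavariables, which is the dummy argument. -/
def residualInst {S : Signature.{u}} {ν μ : List MArity} (I : Inst S ν μ 0) :
    Inst S ν (resAr μ ν) 0
  | ⟨.ty, k⟩, M => (I ⟨.ty, k⟩ M).mrename (resIncl ν)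
  | ⟨.tm, k⟩, M => (I ⟨.tm, k⟩ M).mrename (resIncl ν)
  | ⟨.eqTy, k⟩, _ => Arg.dummy .ty k
  | ⟨.eqTm, k⟩, _ => Arg.dummy .tm k

/-- An object-invertible rule. -/
def RawTheory.ObjectInvertible {S : Signature.{u}} (T : RawTheory.{u, v} S) {c : Cls}
    (R : RawRule S c) : Prop :=
  T.DerivableRule R ∧
  ∀ (μ : List MArity) (Θ : MCtx S μ) (I : Inst S R.ar μ 0), T.WfMCtx Θ →
    T.Derives Θ Ctx.nil (.judg (R.bdry.actC I) (R.head.actC I)) →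
    T.DerivableInst R.prem (residue Θ R.prem I) Ctx.nil (residualInst I)

/-! ### Computation rules and extensionality rules -/

/-- The data of an equation `Ξ ⟹ B[p ≡ v]`, oriented from left to right. -/
structure Rewrite (S : Signature.{u}) (c : Cls) : Type u where
  ar : List MArity
  prem : MCtx S ar
  bdry : Bdry S ar c 0 0
  lhs : Arg S ar c 0 0
  rhs : Arg S ar c 0 0

/-- The raw rule `Ξ ⟹ B[p ≡ v]`. -/
def Rewrite.rule {S : Signature.{u}} {c : Cls} (R : Rewrite S c) : RawRule S c.eqn where
  ar := R.ar
  prem := R.prem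
  bdry := R.bdry.eqn R.lhs R.rhs
  head := Arg.dummy c 0

/-- Type computation rules and term computation rules. -/
def RawTheory.IsComputationRule {S : Signature.{u}} (T : RawTheory.{u, v} S) :
    {c : Cls} → Rewrite S c → Prop
  | .ty, R =>
      T.DerivableRule R.rule ∧ T.FinitaryRule R.rule ∧
      (RawRule.mk R.ar R.prem .ty R.lhs).Deterministic ∧
      T.ObjectInvertible (RawRule.mk R.ar R.prem .ty R.lhs)
  | .tm, R =>
      T.DerivableRule R.rule ∧ T.FinitaryRule R.rule ∧
      (∃ (f : S.Sym .tm) (es : Inst S (S.arity f) R.ar 0), R.lhs = .sym f es) ∧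
      ∃ A : Ty S R.ar 0, T.NaturalType R.prem Ctx.nil R.lhs A ∧
        (RawRule.mk R.ar R.prem (.tm A) R.lhs).Deterministic ∧
        T.ObjectInvertible (RawRule.mk R.ar R.prem (.tm A) R.lhs)
  | _, _ => False

/-- A sequence of equational premises which extends metavariables of arities `ν` to `ξ`. -/
inductive EqPrem (S : Signature.{u}) (ν : List MArity) : List MArity → Type u
  | nil : EqPrem S ν ν
  | snoc {ξ : List MArity} {α : MArity} (Φ : EqPrem S ν ξ) (hα : ¬ α.cls.IsObj)
      (BB : Bdry S ξ α.cls α.bind 0) : EqPrem S ν (α :: ξ)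

/-- The metavariable context `Ξ, Φ`. -/
def EqPrem.append {S : Signature.{u}} {ν : List MArity} (Ξ : MCtx S ν) :
    {ξ : List MArity} → EqPrem S ν ξ → MCtx S ξ
  | _, .nil => Ξ
  | _, .snoc Φ _ BB => (Φ.append Ξ).snoc BB

/-- The inclusion of the metavariables of `Ξ` in those of `Ξ, Φ`. -/
def EqPrem.incl {S : Signature.{u}} {ν : List MArity} :
    {ξ : List MArity} → EqPrem S ν ξ → (α : MArity) → MVar ν α → MVar ξ α
  | _, .nil, _, M => M
  | _, .snoc Φ _ _, α, M => .there (Φ.incl α M)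

/-- The dummy argument of an equality arity. -/
def dummyArg {S : Signature.{u}} {μ : List MArity} {n : ℕ} :
    (α : MArity) → ¬ α.cls.IsObj → Arg S μ α.cls α.bind n
  | ⟨.ty, _⟩, h => absurd (Or.inl rfl) h
  | ⟨.tm, _⟩, h => absurd (Or.inr rfl) h
  | ⟨.eqTy, k⟩, _ => Arg.dummy .ty k
  | ⟨.eqTm, k⟩, _ => Arg.dummy .tm k

/-- Extension of an instantiation of `Ξ` to `Ξ, Φ` by dummy arguments. -/
def EqPrem.extend {S : Signature.{u}} {ν μ : List MArity} {n : ℕ} (I : Inst S ν μ n) :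
    {ξ : List MArity} → EqPrem S ν ξ → Inst S ξ μ n
  | _, .nil, β, M => I β M
  | _, .snoc (α := α) _ hα _, _, .here => dummyArg α hα
  | _, .snoc Φ _ _, β, .there M => Φ.extend I β M

/-- Extension of an instantiation by a term for one more metavariable of arity `(Tm, 0)`. -/
def Inst.cons {S : Signature.{u}} {ν μ : List MArity} {n : ℕ} (I : Inst S ν μ n) (t : Tm S μ n) :
    Inst S (⟨.tm, 0⟩ :: ν) μ n
  | _, .here => t
  | α, .there M => I α M

/-- The data of a rule `Ξ, s : (□ : P), t : (□ : P), Φ ⟹ s ≡ t : P`, where `Φ` consists of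
equational premises. -/
structure ExtRule (S : Signature.{u}) : Type u where
  ar : List MArity
  prem : MCtx S ar
  type : Ty S ar 0
  arAll : List MArity
  eqs : EqPrem S (⟨.tm, 0⟩ :: ⟨.tm, 0⟩ :: ar) arAll

/-- The metavariable context `Ξ, s : (□ : P), t : (□ : P), Φ`. -/
def ExtRule.premAll {S : Signature.{u}} (R : ExtRule S) : MCtx S R.arAll :=
  R.eqs.append
    (.snoc (α := ⟨.tm, 0⟩) (.snoc (α := ⟨.tm, 0⟩) R.prem (.tm R.type))
      (.tm (R.type.mrename (fun _ => MVar.there))))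

/-- The raw rule `Ξ, s : (□ : P), t : (□ : P), Φ ⟹ s ≡ t : P`. -/
def ExtRule.rule {S : Signature.{u}} (R : ExtRule S) : RawRule S .eqTm where
  ar := R.arAll
  prem := R.premAll
  bdry := .eqTm
    (Arg.mapp (R.eqs.incl ⟨.tm, 0⟩ (.there .here)) Fin.elim0)
    (Arg.mapp (R.eqs.incl ⟨.tm, 0⟩ .here) Fin.elim0)
    (R.type.mrename (fun α M => R.eqs.incl α (.there (.there M))))
  head := .starTm

/-- Extensionality rules. -/
def RawTheory.IsExtensionalityRule {S : Signature.{u}} (T : RawTheory.{u, v} S)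
    (R : ExtRule S) : Prop :=
  T.DerivableRule R.rule ∧ T.FinitaryRule R.rule ∧
  (RawRule.mk R.ar R.prem .ty R.type).Deterministic ∧
  T.ObjectInvertible (RawRule.mk R.ar R.prem .ty R.type)

/-! ### Normalization and equality checking -/

/-- A specification of principal arguments, of symbols and (since these are treated as symbols
taking term arguments) of the metavariables at hand. -/
structure Principal (S : Signature.{u}) (μ : List MArity) : Type u where
  sym : ∀ {c : Cls} (f : S.Sym c) (α : MArity), MVar (S.arity f) α → Prop
  mvar : ∀ {c : Cls} {k : ℕ}, MVar μ ⟨c, k⟩ → Fin k → Prop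

/-- The interdependent phases: normalization `▷`, normalization of principal arguments `▷ₚ`, one use
of a computation rule `▷c`, comparison `∼` of arguments, the type-directed phase `∼ₑ`, and
comparison `∼ₙ` of normalized expressions. -/
inductive Phase : Type
  | norm
  | normP
  | normC
  | check
  | checkE
  | checkN

/-- The relations defined by the normalization and equality checking algorithm, for computation
rules `C`, extensionality rules `E`, and principal arguments `P`.  For instance,
`T.Algo C E P Θ .norm Γ BB e₁ e₂` is `Θ; Γ ⊢ BB[e₁ ▷ e₂]`. -/
inductive RawTheory.Algo {S : Signature.{u}} (T : RawTheory.{u, v} S)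
    {ι : Cls → Type w} (C : ∀ c : Cls, ι c → Rewrite S c)
    {κ : Type x} (E : κ → ExtRule S)
    {μ : List MArity} (P : Principal S μ) (Θ : MCtx S μ) :
    Phase → {n : ℕ} → Ctx S μ n → {c : Cls} → {m : ℕ} → Bdry S μ c m n →
      Arg S μ c m n → Arg S μ c m n → Prop
  -- use of a computation rule
  | compute {n : ℕ} {Γ : Ctx S μ n} {c : Cls} (B : Bdry S μ c 0 n) (i : ι c)
      (I : Inst S (C c i).ar μ n) (s : Arg S μ c 0 n) :
      (C c i).lhs.actC I = s →
      (∀ (d : Cls) (m : ℕ) (M : MVar (C c i).ar ⟨d.eqn, m⟩) (BB : Bdry S (C c i).ar d m 0)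
        (e₁ e₂ : Arg S (C c i).ar d m 0), d.IsObj → (C c i).prem.get M = BB.eqn e₁ e₂ →
        T.Algo C E P Θ .check Γ (BB.actC I) (e₁.actC I) (e₂.actC I)) →
      T.Algo C E P Θ .normC Γ B s ((C c i).rhs.actC I)
  -- normalization of principal arguments
  | principalSym {n : ℕ} {Γ : Ctx S μ n} {c : Cls} (B : Bdry S μ c 0 n) (f : S.Sym c)
      (Ξ : MCtx S (S.arity f)) (B₀ : Bdry S (S.arity f) c 0 0) (es ds : Inst S (S.arity f) μ n) :
      T.IsRuleFor f Ξ B₀ →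
      (∀ (α : MArity) (M : MVar (S.arity f) α), P.sym f α M →
        T.Algo C E P Θ .norm Γ ((Ξ.get M).actC es) (es α M) (ds α M)) →
      (∀ (α : MArity) (M : MVar (S.arity f) α), ¬ P.sym f α M → es α M = ds α M) →
      T.Algo C E P Θ .normP Γ B (.sym f es) (.sym f ds)
  | principalMVar {n : ℕ} {Γ : Ctx S μ n} {c : Cls} (B : Bdry S μ c 0 n) {k : ℕ} (hc : c.IsObj)
      (M : MVar μ ⟨c, k⟩) (ss ts : Fin k → Tm S μ n) :
      (∀ j, P.mvar M j →
        T.Algo C E P Θ .norm Γ (.tm ((Θ.get M).argTy ss j)) (ss j) (ts j)) →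
      (∀ j, ¬ P.mvar M j → ss j = ts j) →
      T.Algo C E P Θ .normP Γ B (.mvar hc M ss) (.mvar hc M ts)
  -- normalization; only symbol and metavariable applications are related by `▷ₚ`
  | normStep {n : ℕ} {Γ : Ctx S μ n} {c : Cls} (B : Bdry S μ c 0 n) (e e₁ e₂ e₃ : Arg S μ c 0 n) :
      T.Algo C E P Θ .normP Γ B e e₁ →
      T.Algo C E P Θ .normC Γ B e₁ e₂ →
      T.Algo C E P Θ .norm Γ B e₂ e₃ →
      T.Algo C E P Θ .norm Γ B e e₃
  | normDone {n : ℕ} {Γ : Ctx S μ n} {c : Cls} (B : Bdry S μ c 0 n) (e e₁ : Arg S μ c 0 n) :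
      T.Algo C E P Θ .normP Γ B e e₁ →
      (∀ (i : ι c) (I : Inst S (C c i).ar μ n), (C c i).lhs.actC I ≠ e₁) →
      T.Algo C E P Θ .norm Γ B e e₁
  | normAbs {n : ℕ} {Γ : Ctx S μ n} {c : Cls} {m : ℕ} (A : Ty S μ n) (BB : Bdry S μ c m (n + 1))
      (e₁ e₂ : Arg S μ c m (n + 1)) :
      T.Algo C E P Θ .norm (Γ.snoc A) BB e₁ e₂ →
      T.Algo C E P Θ .norm Γ (.abs A BB) (.abs e₁) (.abs e₂)
  | normVar {n : ℕ} {Γ : Ctx S μ n} (a : Fin n) (A : Ty S μ n) :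
      T.Algo C E P Θ .norm Γ (.tm A) (.var a) (.var a)
  | normStarTy {n : ℕ} {Γ : Ctx S μ n} (B : Bdry S μ .eqTy 0 n) :
      T.Algo C E P Θ .norm Γ B .starTy .starTy
  | normStarTm {n : ℕ} {Γ : Ctx S μ n} (B : Bdry S μ .eqTm 0 n) :
      T.Algo C E P Θ .norm Γ B .starTm .starTm
  -- comparison of arguments
  | checkTm {n : ℕ} {Γ : Ctx S μ n} (A A₁ : Ty S μ n) (s t : Tm S μ n) :
      T.Algo C E P Θ .norm Γ .ty A A₁ →
      T.Algo C E P Θ .checkE Γ (.tm A₁) s t →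
      T.Algo C E P Θ .check Γ (.tm A) s t
  | checkTy {n : ℕ} {Γ : Ctx S μ n} (A A₁ B B₁ : Ty S μ n) :
      T.Algo C E P Θ .norm Γ .ty A A₁ →
      T.Algo C E P Θ .norm Γ .ty B B₁ →
      T.Algo C E P Θ .checkN Γ .ty A₁ B₁ →
      T.Algo C E P Θ .check Γ .ty A B
  | checkAbs {n : ℕ} {Γ : Ctx S μ n} {c : Cls} {m : ℕ} (A : Ty S μ n) (BB : Bdry S μ c m (n + 1))
      (e₁ e₂ : Arg S μ c m (n + 1)) :
      T.Algo C E P Θ .check (Γ.snoc A) BB e₁ e₂ →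
      T.Algo C E P Θ .check Γ (.abs A BB) (.abs e₁) (.abs e₂)
  -- the type-directed phase; the equational premises of both `Ξ` and `Φ` are compared, after
  -- instantiation by `I` extended by `s` and `t`
  | extApply {n : ℕ} {Γ : Ctx S μ n} (i : κ) (I : Inst S (E i).ar μ n) (A : Ty S μ n)
      (s t : Tm S μ n) :
      (E i).type.actC I = A →
      (∀ (d : Cls) (m : ℕ) (M : MVar (E i).arAll ⟨d.eqn, m⟩) (BB : Bdry S (E i).arAll d m 0)
        (e₁ e₂ : Arg S (E i).arAll d m 0), d.IsObj → (E i).premAll.get M = BB.eqn e₁ e₂ →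
        T.Algo C E P Θ .check Γ (BB.actC ((E i).eqs.extend ((I.cons s).cons t)))
          (e₁.actC ((E i).eqs.extend ((I.cons s).cons t)))
          (e₂.actC ((E i).eqs.extend ((I.cons s).cons t)))) →
      T.Algo C E P Θ .checkE Γ (.tm A) s t
  | extNone {n : ℕ} {Γ : Ctx S μ n} (A : Ty S μ n) (s s₁ t t₁ : Tm S μ n) :
      (∀ (i : κ) (I : Inst S (E i).ar μ n), (E i).type.actC I ≠ A) →
      T.Algo C E P Θ .norm Γ (.tm A) s s₁ →
      T.Algo C E P Θ .norm Γ (.tm A) t t₁ →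
      T.Algo C E P Θ .checkN Γ (.tm A) s₁ t₁ →
      T.Algo C E P Θ .checkE Γ (.tm A) s t
  -- comparison of normalized expressions
  | neutVar {n : ℕ} {Γ : Ctx S μ n} (a : Fin n) (A : Ty S μ n) :
      T.Algo C E P Θ .checkN Γ (.tm A) (.var a) (.var a)
  | neutSym {n : ℕ} {Γ : Ctx S μ n} {c : Cls} (B : Bdry S μ c 0 n) (f : S.Sym c)
      (Ξ : MCtx S (S.arity f)) (B₀ : Bdry S (S.arity f) c 0 0) (es ds : Inst S (S.arity f) μ n) :
      T.IsRuleFor f Ξ B₀ →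
      (∀ (α : MArity) (M : MVar (S.arity f) α), α.cls.IsObj → P.sym f α M →
        T.Algo C E P Θ .checkN Γ ((Ξ.get M).actC es) (es α M) (ds α M)) →
      (∀ (α : MArity) (M : MVar (S.arity f) α), α.cls.IsObj → ¬ P.sym f α M →
        T.Algo C E P Θ .check Γ ((Ξ.get M).actC es) (es α M) (ds α M)) →
      T.Algo C E P Θ .checkN Γ B (.sym f es) (.sym f ds)
  | neutMVar {n : ℕ} {Γ : Ctx S μ n} {c : Cls} (B : Bdry S μ c 0 n) {k : ℕ} (hc : c.IsObj)
      (M : MVar μ ⟨c, k⟩) (ss ts : Fin k → Tm S μ n) :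
      (∀ j, P.mvar M j →
        T.Algo C E P Θ .checkN Γ (.tm ((Θ.get M).argTy ss j)) (ss j) (ts j)) →
      (∀ j, ¬ P.mvar M j →
        T.Algo C E P Θ .check Γ (.tm ((Θ.get M).argTy ss j)) (ss j) (ts j)) →
      T.Algo C E P Θ .checkN Γ B (.mvar hc M ss) (.mvar hc M ts)
  | neutAbs {n : ℕ} {Γ : Ctx S μ n} {c : Cls} {m : ℕ} (A : Ty S μ n) (BB : Bdry S μ c m (n + 1))
      (e₁ e₂ : Arg S μ c m (n + 1)) :
      T.Algo C E P Θ .checkN (Γ.snoc A) BB e₁ e₂ →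
      T.Algo C E P Θ .checkN Γ (.abs A BB) (.abs e₁) (.abs e₂)

end FTT
/-!
Soundness of all six phases is proved by one induction, for the stronger claim that every
well-typed instance of the compared expressions, over any variable context and any substitution,
is derivably equal. Under this claim the checked equational premises of a rule hold stably under
substitution.

The delicate step is a computation rule whose instance `I` is found by matching.
Object-invertibility only speaks of the empty variable context, so the variables are first
promoted to metavariables. It then makes `I` derivable over an extension of the metavariable
context by the equational premises; since these hold, the extra metavariables can be
instantiated away, and the rule applies. That the matched expression is derivable at the type
which the rule expects follows from inversion: each symbol has a single rule, so an application
determines its natural type and the derivability of its arguments.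

Argument normalization reduces to congruence rules. Rewriting earlier arguments changes the
boundaries of later ones, which stay convertible because derivably equal instantiations act
equally on derivable boundaries.
-/

namespace FTT

/-! ### Renaming and substitution -/

section Expr

variable {S : Signature.{u}} {μ ν ξ : List MArity} {c : Cls} {m n k l : ℕ}

@[simp] theorem liftRen_zero (ρ : Fin n → Fin k) : liftRen ρ 0 = 0 := rfl

@[simp] theorem liftRen_succ (ρ : Fin n → Fin k) (i : Fin n) :
    liftRen ρ i.succ = (ρ i).succ := rfl

@[simp] theorem liftSub_zero (σ : Fin n → Tm S μ k) : liftSub σ 0 = .var 0 := rfl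

@[simp] theorem liftSub_succ (σ : Fin n → Tm S μ k) (i : Fin n) :
    liftSub σ i.succ = (σ i).rename Fin.succ := rfl

theorem liftRen_comp (ρ : Fin n → Fin k) (θ : Fin k → Fin l) :
    liftRen (fun i => θ (ρ i)) = fun i => liftRen θ (liftRen ρ i) := by
  funext i
  cases i using Fin.cases <;> simp

theorem liftRen_id : liftRen (fun i : Fin n => i) = fun i => i := by
  funext i
  cases i using Fin.cases <;> simp

theorem liftSub_var : liftSub (Arg.var : Fin n → Tm S μ n) = Arg.var := by
  funext i
  cases i using Fin.cases <;> simp [Arg.rename]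

theorem liftSub_comp_liftRen (ρ : Fin n → Fin k) (σ : Fin k → Tm S μ l) :
    (fun i => liftSub σ (liftRen ρ i)) = liftSub (fun i => σ (ρ i)) := by
  funext i
  cases i using Fin.cases <;> simp

theorem Arg.rename_rename (e : Arg S μ c m n) (ρ : Fin n → Fin k) (θ : Fin k → Fin l) :
    (e.rename ρ).rename θ = e.rename (fun i => θ (ρ i)) := by
  induction e generalizing k l <;> simp [Arg.rename, liftRen_comp, *]

theorem Arg.rename_id (e : Arg S μ c m n) : e.rename (fun i => i) = e := by
  induction e <;> simp [Arg.rename, liftRen_id, *]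

theorem Arg.subst_rename (e : Arg S μ c m n) (ρ : Fin n → Fin k) (σ : Fin k → Tm S μ l) :
    (e.rename ρ).subst σ = e.subst (fun i => σ (ρ i)) := by
  induction e generalizing k l <;> simp [Arg.rename, Arg.subst, liftSub_comp_liftRen, *]

theorem rename_liftSub (σ : Fin n → Tm S μ k) (ρ : Fin k → Fin l) :
    (fun i => (liftSub σ i).rename (liftRen ρ)) = liftSub (fun i => (σ i).rename ρ) := by
  funext i
  cases i using Fin.cases <;> simp [Arg.rename, Arg.rename_rename]

theorem Arg.rename_subst (e : Arg S μ c m n) (σ : Fin n → Tm S μ k) (ρ : Fin k → Fin l) :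
    (e.subst σ).rename ρ = e.subst (fun i => (σ i).rename ρ) := by
  induction e generalizing k l <;> simp [Arg.rename, Arg.subst, rename_liftSub, *]

theorem subst_liftSub (σ : Fin n → Tm S μ k) (τ : Fin k → Tm S μ l) :
    (fun i => (liftSub σ i).subst (liftSub τ)) = liftSub (fun i => (σ i).subst τ) := by
  funext i
  cases i using Fin.cases <;>
    simp [Arg.subst, Arg.subst_rename, Arg.rename_subst]

theorem Arg.subst_subst (e : Arg S μ c m n) (σ : Fin n → Tm S μ k) (τ : Fin k → Tm S μ l) :
    (e.subst σ).subst τ = e.subst (fun i => (σ i).subst τ) := by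
  induction e generalizing k l <;> simp [Arg.subst, subst_liftSub, *]

theorem Arg.subst_var (e : Arg S μ c m n) : e.subst Arg.var = e := by
  induction e <;> simp [Arg.subst, liftSub_var, *]

theorem liftSub_ren (ρ : Fin n → Fin k) :
    liftSub (fun i => (Arg.var (ρ i) : Tm S μ k)) = fun i => Arg.var (liftRen ρ i) := by
  funext i
  cases i using Fin.cases <;> simp [Arg.rename]

theorem Arg.rename_eq_subst (e : Arg S μ c m n) (ρ : Fin n → Fin k) :
    e.rename ρ = e.subst (fun i => .var (ρ i)) := by
  induction e generalizing k <;> simp [Arg.rename, Arg.subst, liftSub_ren, *]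

theorem Cls.not_isObj_eqn (c : Cls) : ¬ c.eqn.IsObj := by
  cases c <;> rintro (h | h) <;> cases h

theorem Cls.not_isObj_eqTy : ¬ Cls.eqTy.IsObj := Cls.not_isObj_eqn .ty

theorem Cls.not_isObj_eqTm : ¬ Cls.eqTm.IsObj := Cls.not_isObj_eqn .tm

theorem Arg.eq_of_not_isObj (hc : ¬ c.IsObj) (e e' : Arg S μ c m n) : e = e' := by
  induction e with
  | var => exact absurd (Or.inr rfl) hc
  | sym f => exact absurd (S.isObj f) hc
  | mvar h => exact absurd h hc
  | starTy =>
    cases e' with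
    | sym f => exact absurd (S.isObj f) hc
    | mvar h => exact absurd h hc
    | starTy => rfl
  | starTm =>
    cases e' with
    | sym f => exact absurd (S.isObj f) hc
    | mvar h => exact absurd h hc
    | starTm => rfl
  | abs e ih =>
    cases e' with
    | abs e' => rw [ih hc e']

theorem Arg.abs_body (e : Arg S μ c (m + 1) n) : Arg.abs e.body = e := by
  cases e; rfl

/-! ### Substitution for abstracted variables -/

theorem comp_finCases {α β : Type*} (f : α → β) (a : α) (σ : Fin n → α) :
    (fun i => f ((Fin.cases a σ : Fin (n + 1) → α) i)) = Fin.cases (f a) (fun i => f (σ i)) := by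
  funext i
  cases i using Fin.cases <;> simp

theorem finCases_eta {α : Type*} (σ : Fin (n + 1) → α) :
    (Fin.cases (σ 0) (fun i => σ i.succ) : Fin (n + 1) → α) = σ :=
  Fin.cons_self_tail σ

theorem subst_finCases_liftSub (t : Tm S μ l) (τ : Fin k → Tm S μ l) (σ : Fin n → Tm S μ k) :
    (fun i => (liftSub σ i).subst (Fin.cases t τ)) =
      (Fin.cases t (fun i => (σ i).subst τ) : Fin (n + 1) → Tm S μ l) := by
  funext i
  cases i using Fin.cases <;> simp [Arg.subst, Arg.subst_rename]

theorem Arg.subst_instAux (e : Arg S μ c m n) (σ : Fin n → Tm S μ k) (ts : Fin m → Tm S μ k)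
    (τ : Fin k → Tm S μ l) :
    (e.instAux σ ts).subst τ = e.instAux (fun i => (σ i).subst τ) (fun j => (ts j).subst τ) := by
  induction m generalizing n with
  | zero => simp [Arg.instAux, Arg.subst_subst]
  | succ m ih => simp [Arg.instAux, ih, comp_finCases (Arg.subst τ)]

theorem Arg.instAux_subst (e : Arg S μ c m n) (σ : Fin n → Tm S μ k) (τ : Fin k → Tm S μ l)
    (ts : Fin m → Tm S μ l) :
    (e.subst σ).instAux τ ts = e.instAux (fun i => (σ i).subst τ) ts := by
  induction m generalizing n k with
  | zero => simp [Arg.instAux, Arg.subst_subst]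
  | succ m ih =>
    cases e
    simp [Arg.instAux, Arg.subst, Arg.body, ih, subst_finCases_liftSub]

theorem Arg.ext_instAux {e e' : Arg S μ c m n}
    (h : ∀ (k : ℕ) (σ : Fin n → Tm S μ k) (ts : Fin m → Tm S μ k),
      e.instAux σ ts = e'.instAux σ ts) : e = e' := by
  induction m generalizing n with
  | zero => simpa [Arg.instAux, Arg.subst_var] using h n Arg.var Fin.elim0
  | succ m ih =>
    rw [← e.abs_body, ← e'.abs_body]
    refine congrArg _ (ih fun k σ ts => ?_)
    simpa [Arg.instAux, finCases_eta] using h k (fun i => σ i.succ) (Fin.cases (σ 0) ts)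

theorem Arg.instAux_abstract
    (F : ∀ k : ℕ, (Fin m → Tm S μ k) → (Fin n → Fin k) → Arg S μ c 0 k)
    (G : ∀ k : ℕ, (Fin m → Tm S μ k) → (Fin n → Tm S μ k) → Arg S μ c 0 k)
    (hFG : ∀ k us ρ, F k us ρ = G k us (fun i => .var (ρ i)))
    (hG : ∀ k l us σ (τ : Fin k → Tm S μ l),
      (G k us σ).subst τ = G l (fun j => (us j).subst τ) (fun i => (σ i).subst τ))
    (σ : Fin n → Tm S μ k) (ts : Fin m → Tm S μ k) :
    (Arg.abstract m F).instAux σ ts = G k ts σ := by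
  induction m generalizing n with
  | zero =>
    simp only [Arg.abstract, Arg.instAux, hFG, hG]
    congr 1
    exact Subsingleton.elim _ _
  | succ m ih =>
    simp only [Arg.abstract, Arg.instAux, Arg.body]
    rw [ih _ (fun k us σ => G k (Fin.cases (σ 0) us) (fun i => σ i.succ))]
    · congr 1
      exact finCases_eta ts
    · intro k us ρ
      rw [hFG]
    · intro k l us σ τ
      rw [hG, comp_finCases (Arg.subst τ)]

theorem Arg.subst_mapp (M : MVar μ ⟨c, m⟩) (ts : Fin m → Tm S μ k) (τ : Fin k → Tm S μ l) :
    (Arg.mapp M ts).subst τ = Arg.mapp M (fun j => (ts j).subst τ) := by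
  cases c <;> simp [Arg.mapp, Arg.subst]

theorem instAux_genApp {α : MArity} (M : MVar μ α) (σ : Fin n → Tm S μ k)
    (ts : Fin α.bind → Tm S μ k) : (genApp S α M).instAux σ ts = Arg.mapp M ts :=
  Arg.instAux_abstract _ (fun _ ts _ => Arg.mapp M ts) (fun _ _ _ => rfl)
    (fun _ _ _ _ _ => Arg.subst_mapp _ _ _) σ ts

/-! ### Simultaneous instantiation and substitution -/

/-- Renamings of metavariables. -/
abbrev MRen (ν μ : List MArity) : Type := ∀ α : MArity, MVar ν α → MVar μ α

/-- Renaming of variables in an instantiation. -/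
def Inst.rename (I : Inst S ν μ n) (ρ : Fin n → Fin k) : Inst S ν μ k :=
  fun α M => (I α M).rename ρ

/-- Substitution in an instantiation. -/
def Inst.subst (I : Inst S ν μ n) (σ : Fin n → Tm S μ k) : Inst S ν μ k :=
  fun α M => (I α M).subst σ

/-- Simultaneous action of an instantiation on metavariables and of a substitution on variables. -/
def Arg.msubst {ν μ : List MArity} :
    {c : Cls} → {m n k : ℕ} → Inst S ν μ k → (Fin n → Tm S μ k) → Arg S ν c m n → Arg S μ c m k
  | _, _, _, _, _, σ, .var i => σ i
  | _, _, _, _, I, σ, .sym f es => .sym f (fun α M => (es α M).msubst I σ)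
  | _, _, _, _, I, σ, .mvar _ M ts => (I _ M).inst (fun j => (ts j).msubst I σ)
  | _, _, _, _, _, _, .starTy => .starTy
  | _, _, _, _, _, _, .starTm => .starTm
  | _, _, _, _, I, σ, .abs e => .abs (e.msubst I.wk (liftSub σ))

theorem Inst.wk_eq_rename (I : Inst S ν μ n) : I.wk = I.rename Fin.succ := rfl

theorem Inst.subst_liftSub_wk (I : Inst S ν μ n) (σ : Fin n → Tm S μ k) :
    I.wk.subst (liftSub σ) = (I.subst σ).wk := by
  funext α M
  simp [Inst.wk, Inst.subst, Arg.subst_rename, Arg.rename_subst]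

theorem Inst.subst_var (I : Inst S ν μ n) : I.subst Arg.var = I := by
  funext α M
  exact Arg.subst_var _

theorem Inst.rename_eq_subst (I : Inst S ν μ n) (ρ : Fin n → Fin k) :
    I.rename ρ = I.subst (fun i => .var (ρ i)) := by
  funext α M
  exact Arg.rename_eq_subst _ _

theorem Inst.subst_finCases_wk (I : Inst S ν μ n) (t : Tm S μ k) (σ : Fin n → Tm S μ k) :
    I.wk.subst (Fin.cases t σ) = I.subst σ := by
  funext α M
  simp [Inst.wk, Inst.subst, Arg.subst_rename]

theorem Arg.msubst_rename (e : Arg S ν c m n) (ρ : Fin n → Fin k) (I : Inst S ν μ l)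
    (σ : Fin k → Tm S μ l) : (e.rename ρ).msubst I σ = e.msubst I (fun i => σ (ρ i)) := by
  induction e generalizing k l <;> simp [Arg.rename, Arg.msubst, liftSub_comp_liftRen, *]

theorem Arg.subst_inst (e : Arg S μ c m n) (ts : Fin m → Tm S μ n) (τ : Fin n → Tm S μ k) :
    (e.inst ts).subst τ = (e.subst τ).inst (fun j => (ts j).subst τ) := by
  simp [Arg.inst, Arg.subst_instAux, Arg.instAux_subst, Arg.subst, Arg.subst_var]

theorem Arg.subst_msubst (e : Arg S ν c m n) (I : Inst S ν μ k) (σ : Fin n → Tm S μ k)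
    (τ : Fin k → Tm S μ l) :
    (e.msubst I σ).subst τ = e.msubst (I.subst τ) (fun i => (σ i).subst τ) := by
  induction e generalizing k l with
  | mvar hc M ts ih => simp [Arg.msubst, Arg.subst_inst, ih, Inst.subst]
  | _ => simp [Arg.subst, Arg.msubst, subst_liftSub, Inst.subst_liftSub_wk, *]

theorem Arg.rename_msubst (e : Arg S ν c m n) (I : Inst S ν μ k) (σ : Fin n → Tm S μ k)
    (ρ : Fin k → Fin l) :
    (e.msubst I σ).rename ρ = e.msubst (I.rename ρ) (fun i => (σ i).rename ρ) := by
  simp [Arg.rename_eq_subst, Arg.subst_msubst, Inst.rename_eq_subst]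

theorem msubst_liftSub (τ : Fin n → Tm S ν k) (I : Inst S ν μ l) (σ : Fin k → Tm S μ l) :
    (fun i => (liftSub τ i).msubst I.wk (liftSub σ)) = liftSub (fun i => (τ i).msubst I σ) := by
  funext i
  cases i using Fin.cases <;>
    simp [Arg.msubst, Arg.msubst_rename, Arg.rename_msubst, Inst.wk_eq_rename]

theorem Arg.msubst_subst (e : Arg S ν c m n) (τ : Fin n → Tm S ν k) (I : Inst S ν μ l)
    (σ : Fin k → Tm S μ l) : (e.subst τ).msubst I σ = e.msubst I (fun i => (τ i).msubst I σ) := by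
  induction e generalizing k l <;> simp [Arg.subst, Arg.msubst, msubst_liftSub, *]

/-- Simultaneous instantiation and substitution in the body of an abstraction. -/
def Arg.msubstInst {ν μ : List MArity} {c : Cls} {k : ℕ} : {m n : ℕ} → Inst S ν μ k →
    (Fin n → Tm S μ k) → (Fin m → Tm S μ k) → Arg S ν c m n → Arg S μ c 0 k
  | 0, _, I, σ, _, e => e.msubst I σ
  | _ + 1, _, I, σ, ts, e => e.body.msubstInst I (Fin.cases (ts 0) σ) (fun j => ts j.succ)

theorem Arg.msubst_instAux (e : Arg S ν c m n) (σ : Fin n → Tm S ν k) (ts : Fin m → Tm S ν k)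
    (I : Inst S ν μ l) (τ : Fin k → Tm S μ l) :
    (e.instAux σ ts).msubst I τ =
      e.msubstInst I (fun i => (σ i).msubst I τ) (fun j => (ts j).msubst I τ) := by
  induction m generalizing n with
  | zero => simp [Arg.instAux, Arg.msubstInst, Arg.msubst_subst]
  | succ m ih => simp [Arg.instAux, Arg.msubstInst, ih, comp_finCases (Arg.msubst I τ)]

theorem Arg.instAux_msubst (e : Arg S ν c m n) (I : Inst S ν μ k) (σ : Fin n → Tm S μ k)
    (τ : Fin k → Tm S μ l) (ts : Fin m → Tm S μ l) :
    (e.msubst I σ).instAux τ ts = e.msubstInst (I.subst τ) (fun i => (σ i).subst τ) ts := by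
  induction m generalizing n k with
  | zero => simp [Arg.instAux, Arg.msubstInst, Arg.subst_msubst]
  | succ m ih =>
    cases e
    simp [Arg.instAux, Arg.msubst, Arg.msubstInst, Arg.body, ih, subst_finCases_liftSub,
      Inst.subst_finCases_wk]

theorem Arg.msubstInst_eq (e : Arg S ν c m n) (I : Inst S ν μ k) (σ : Fin n → Tm S μ k)
    (ts : Fin m → Tm S μ k) :
    e.msubstInst I σ ts =
      (e.instAux (fun i => .var (Fin.natAdd m i)) (fun j => .var (Fin.castAdd n j))).msubst I
        (Fin.addCases ts σ) := by
  simp [Arg.msubst_instAux, Arg.msubst]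

/-- Composition of instantiations. -/
def Inst.msubst (J : Inst S ξ ν n) (I : Inst S ν μ k) (σ : Fin n → Tm S μ k) : Inst S ξ μ k :=
  fun α M => (J α M).msubst I σ

theorem Inst.msubst_wk (J : Inst S ξ ν n) (I : Inst S ν μ k) (σ : Fin n → Tm S μ k) :
    J.wk.msubst I.wk (liftSub σ) = (J.msubst I σ).wk := by
  funext α M
  simp [Inst.wk, Inst.msubst, Arg.msubst_rename, Arg.rename_msubst, Inst.wk_eq_rename]

theorem Arg.msubst_msubst (e : Arg S ξ c m n) (J : Inst S ξ ν k) (τ : Fin n → Tm S ν k)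
    (I : Inst S ν μ l) (σ : Fin k → Tm S μ l) :
    (e.msubst J τ).msubst I σ = e.msubst (J.msubst I σ) (fun i => (τ i).msubst I σ) := by
  induction e generalizing k l with
  | mvar hc M ts ih =>
    simp [Arg.msubst, Arg.inst, Arg.msubst_instAux, Arg.instAux_msubst, ih, Inst.msubst,
      Inst.subst_var, Arg.subst_var]
  | _ => simp [Arg.msubst, msubst_liftSub, Inst.msubst_wk, *]

/-- The generic instantiation along a renaming of metavariables. -/
def Inst.gen (ρ : MRen ν μ) : Inst S ν μ n :=
  fun α M => genApp S α (ρ α M)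

/-- The identity instantiation. -/
abbrev Inst.idn : Inst S μ μ n := Inst.gen fun _ M => M

theorem subst_genApp {α : MArity} (M : MVar μ α) (σ : Fin n → Tm S μ k) :
    (genApp S α M : Arg S μ _ _ n).subst σ = genApp S α M :=
  Arg.ext_instAux fun _ _ _ => by rw [Arg.instAux_subst, instAux_genApp, instAux_genApp]

theorem Inst.subst_gen (ρ : MRen ν μ) (σ : Fin n → Tm S μ k) :
    (Inst.gen ρ : Inst S ν μ n).subst σ = Inst.gen ρ := by
  funext α M
  exact subst_genApp _ _

theorem Inst.rename_gen (ρ : MRen ν μ) (θ : Fin n → Fin k) :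
    (Inst.gen ρ : Inst S ν μ n).rename θ = Inst.gen ρ := by
  rw [Inst.rename_eq_subst, Inst.subst_gen]

theorem Inst.wk_gen (ρ : MRen ν μ) :
    (Inst.gen ρ : Inst S ν μ n).wk = Inst.gen ρ :=
  Inst.rename_gen ρ _

theorem Arg.msubst_mapp (M : MVar ν ⟨c, m⟩) (ts : Fin m → Tm S ν n) (I : Inst S ν μ k)
    (σ : Fin n → Tm S μ k) :
    (Arg.mapp M ts).msubst I σ = (I _ M).inst (fun j => (ts j).msubst I σ) := by
  cases c with
  | ty => rfl
  | tm => rfl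
  | eqTy => exact Arg.eq_of_not_isObj Cls.not_isObj_eqTy _ _
  | eqTm => exact Arg.eq_of_not_isObj Cls.not_isObj_eqTm _ _

theorem inst_genApp {α : MArity} (M : MVar μ α) (ts : Fin α.bind → Tm S μ n) :
    (genApp S α M).inst ts = Arg.mapp M ts :=
  instAux_genApp _ _ _

theorem msubst_genApp {α : MArity} (M : MVar ν α) (I : Inst S ν μ k) (σ : Fin n → Tm S μ k) :
    (genApp S α M).msubst I σ = I α M := by
  refine Arg.ext_instAux fun l τ ts => ?_
  rw [Arg.instAux_msubst, Arg.msubstInst_eq, instAux_genApp, Arg.msubst_mapp]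
  simp [Arg.msubst, Inst.subst, Arg.inst, Arg.instAux_subst, Arg.subst_var]

theorem Inst.msubst_gen (ρ : MRen ξ ν) (I : Inst S ν μ k)
    (σ : Fin n → Tm S μ k) :
    (Inst.gen ρ : Inst S ξ ν n).msubst I σ = fun α M => I α (ρ α M) := by
  funext α M
  exact msubst_genApp _ _ _

theorem Arg.subst_eq_msubst (e : Arg S μ c m n) (σ : Fin n → Tm S μ k) :
    e.subst σ = e.msubst Inst.idn σ := by
  induction e generalizing k with
  | mvar hc M ts ih =>
    simp only [Arg.msubst, Inst.gen, inst_genApp, Arg.subst, ih]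
    rcases hc with rfl | rfl <;> rfl
  | _ => simp [Arg.msubst, Arg.subst, Inst.wk_gen, *]

theorem Arg.mrename_eq_msubst (e : Arg S ν c m n) (ρ : MRen ν μ) :
    e.mrename ρ = e.msubst (Inst.gen ρ) Arg.var := by
  induction e with
  | mvar hc M ts ih =>
    simp only [Arg.msubst, Inst.gen, inst_genApp, Arg.mrename, ih]
    rcases hc with rfl | rfl <;> rfl
  | _ => simp [Arg.msubst, Arg.mrename, Inst.wk_gen, liftSub_var, *]

theorem Arg.msubst_idn_var (e : Arg S μ c m n) : e.msubst Inst.idn Arg.var = e := by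
  rw [← Arg.subst_eq_msubst, Arg.subst_var]

theorem Arg.act_eq_msubst (e : Arg S ν c m n) (I : Inst S ν μ n) :
    e.act I = e.msubst I Arg.var := by
  induction e <;> simp [Arg.msubst, Arg.act, liftSub_var, *]

theorem Arg.actC_eq_msubst (e : Arg S ν c m 0) (I : Inst S ν μ n) :
    e.actC I = e.msubst I Fin.elim0 := by
  rw [Arg.actC, Arg.act_eq_msubst, Arg.msubst_rename]
  congr 1
  exact Subsingleton.elim _ _

/-! ### Boundaries -/

/-- Simultaneous action of an instantiation and of a substitution on boundaries. -/
def Bdry.msubst {ν μ : List MArity} :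
    {c : Cls} → {m n k : ℕ} → Inst S ν μ k → (Fin n → Tm S μ k) → Bdry S ν c m n → Bdry S μ c m k
  | _, _, _, _, _, _, .ty => .ty
  | _, _, _, _, I, σ, .tm A => .tm (A.msubst I σ)
  | _, _, _, _, I, σ, .eqTy A B => .eqTy (A.msubst I σ) (B.msubst I σ)
  | _, _, _, _, I, σ, .eqTm s t A => .eqTm (s.msubst I σ) (t.msubst I σ) (A.msubst I σ)
  | _, _, _, _, I, σ, .abs A BB => .abs (A.msubst I σ) (BB.msubst I.wk (liftSub σ))

/-- Simultaneous instantiation and substitution in the body of an abstracted boundary. -/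
def Bdry.msubstInst {ν μ : List MArity} {k : ℕ} : {c : Cls} → {m n : ℕ} → Inst S ν μ k →
    (Fin n → Tm S μ k) → (Fin m → Tm S μ k) → Bdry S ν c m n → Bdry S μ c 0 k
  | _, _, _, I, σ, ts, .abs _ BB => BB.msubstInst I (Fin.cases (ts 0) σ) (fun j => ts j.succ)
  | _, _, _, I, σ, _, .ty => Bdry.msubst I σ .ty
  | _, _, _, I, σ, _, .tm A => Bdry.msubst I σ (.tm A)
  | _, _, _, I, σ, _, .eqTy A B => Bdry.msubst I σ (.eqTy A B)
  | _, _, _, I, σ, _, .eqTm s t A => Bdry.msubst I σ (.eqTm s t A)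

/-- Simultaneous instantiation and substitution in the types of the abstracted variables. -/
def Bdry.msubstArgTy {ν μ : List MArity} {k : ℕ} : {c : Cls} → {m n : ℕ} → Inst S ν μ k →
    (Fin n → Tm S μ k) → (Fin m → Tm S μ k) → Bdry S ν c m n → Fin m → Ty S μ k
  | _, 0, _, _, _, _, _ => Fin.elim0
  | _, _ + 1, _, I, σ, ts, .abs A BB =>
      Fin.cases (A.msubst I σ) (BB.msubstArgTy I (Fin.cases (ts 0) σ) (fun j => ts j.succ))

theorem Bdry.msubst_instAux (BB : Bdry S ν c m n) (σ : Fin n → Tm S ν k) (ts : Fin m → Tm S ν k)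
    (I : Inst S ν μ l) (τ : Fin k → Tm S μ l) :
    (BB.instAux σ ts).msubst I τ =
      BB.msubstInst I (fun i => (σ i).msubst I τ) (fun j => (ts j).msubst I τ) := by
  induction BB <;>
    simp [Bdry.instAux, Bdry.msubstInst, Bdry.msubst, Arg.msubst_subst,
      comp_finCases (Arg.msubst I τ), *]

theorem Bdry.instAux_msubst (BB : Bdry S ν c m n) (I : Inst S ν μ k) (σ : Fin n → Tm S μ k)
    (τ : Fin k → Tm S μ l) (ts : Fin m → Tm S μ l) :
    (BB.msubst I σ).instAux τ ts = BB.msubstInst (I.subst τ) (fun i => (σ i).subst τ) ts := by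
  induction BB generalizing k <;>
    simp [Bdry.instAux, Bdry.msubstInst, Bdry.msubst, Arg.subst_msubst, subst_finCases_liftSub,
      Inst.subst_finCases_wk, *]

theorem Bdry.msubst_argTyAux (BB : Bdry S ν c m n) (σ : Fin n → Tm S ν k) (ts : Fin m → Tm S ν k)
    (I : Inst S ν μ l) (τ : Fin k → Tm S μ l) (j : Fin m) :
    (BB.argTyAux σ ts j).msubst I τ =
      BB.msubstArgTy I (fun i => (σ i).msubst I τ) (fun j => (ts j).msubst I τ) j := by
  induction BB with
  | abs A BB ih =>
    cases j using Fin.cases <;>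
      simp [Bdry.argTyAux, Bdry.msubstArgTy, Arg.msubst_subst, comp_finCases (Arg.msubst I τ), ih]
  | _ => exact j.elim0

theorem Bdry.argTyAux_msubst (BB : Bdry S ν c m n) (I : Inst S ν μ k) (σ : Fin n → Tm S μ k)
    (τ : Fin k → Tm S μ l) (ts : Fin m → Tm S μ l) (j : Fin m) :
    (BB.msubst I σ).argTyAux τ ts j =
      BB.msubstArgTy (I.subst τ) (fun i => (σ i).subst τ) ts j := by
  induction BB generalizing k with
  | abs A BB ih =>
    cases j using Fin.cases <;>
      simp [Bdry.argTyAux, Bdry.msubstArgTy, Bdry.msubst, Arg.subst_msubst, subst_finCases_liftSub,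
        Inst.subst_finCases_wk, ih]
  | _ => exact j.elim0

end Expr

section BoundarySyntax

variable {S : Signature.{u}} {μ ν ξ : List MArity} {c : Cls} {m n k l : ℕ}

theorem Bdry.rename_eq_msubst (BB : Bdry S μ c m n) (ρ : Fin n → Fin k) :
    BB.rename ρ = BB.msubst Inst.idn (fun i => .var (ρ i)) := by
  induction BB generalizing k <;>
    simp [Bdry.rename, Bdry.msubst, Arg.rename_eq_subst, Arg.subst_eq_msubst, Inst.wk_gen,
      liftSub_ren, *]

theorem Bdry.mrename_eq_msubst (BB : Bdry S ν c m n) (ρ : MRen ν μ) :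
    BB.mrename ρ = BB.msubst (Inst.gen ρ) Arg.var := by
  induction BB <;>
    simp [Bdry.mrename, Bdry.msubst, Arg.mrename_eq_msubst, Inst.wk_gen, liftSub_var, *]

theorem Bdry.act_eq_msubst (BB : Bdry S ν c m n) (I : Inst S ν μ n) :
    BB.act I = BB.msubst I Arg.var := by
  induction BB <;> simp [Bdry.msubst, Bdry.act, Arg.act_eq_msubst, liftSub_var, *]

theorem Bdry.msubst_msubst (BB : Bdry S ν c m n) (J : Inst S ν μ k) (τ : Fin n → Tm S μ k)
    (I : Inst S μ ξ l) (σ : Fin k → Tm S ξ l) :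
    (BB.msubst J τ).msubst I σ = BB.msubst (J.msubst I σ) (fun i => (τ i).msubst I σ) := by
  induction BB generalizing k l <;>
    simp [Bdry.msubst, Arg.msubst_msubst, msubst_liftSub, Inst.msubst_wk, *]

theorem Bdry.msubst_idn_var (BB : Bdry S μ c m n) :
    BB.msubst Inst.idn Arg.var = BB := by
  induction BB <;> simp [Bdry.msubst, Arg.msubst_idn_var, Inst.wk_gen, liftSub_var, *]

theorem Bdry.actC_eq_msubst (BB : Bdry S ν c m 0) (I : Inst S ν μ n) :
    BB.actC I = BB.msubst I Fin.elim0 := by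
  rw [Bdry.actC, Bdry.act_eq_msubst, Bdry.rename_eq_msubst, Bdry.msubst_msubst, Inst.msubst_gen]
  congr 1
  exact Subsingleton.elim _ _

theorem Bdry.msubst_actC (BB : Bdry S ξ c m 0) (J : Inst S ξ ν n) (I : Inst S ν μ k)
    (σ : Fin n → Tm S μ k) : (BB.actC J).msubst I σ = BB.actC (J.msubst I σ) := by
  rw [Bdry.actC_eq_msubst, Bdry.actC_eq_msubst, Bdry.msubst_msubst]
  congr 1
  exact Subsingleton.elim _ _

theorem Arg.msubst_actC (e : Arg S ξ c m 0) (J : Inst S ξ ν n) (I : Inst S ν μ k)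
    (σ : Fin n → Tm S μ k) : (e.actC J).msubst I σ = e.actC (J.msubst I σ) := by
  rw [Arg.actC_eq_msubst, Arg.actC_eq_msubst, Arg.msubst_msubst]
  congr 1
  exact Subsingleton.elim _ _

theorem Bdry.msubst_inst (BB : Bdry S ν c m 0) (ts : Fin m → Tm S ν n) (I : Inst S ν μ k)
    (σ : Fin n → Tm S μ k) :
    (BB.inst ts).msubst I σ = BB.msubstInst I Fin.elim0 (fun j => (ts j).msubst I σ) := by
  rw [Bdry.inst, Bdry.msubst_instAux]
  congr 1
  exact Subsingleton.elim _ _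

theorem Bdry.msubst_argTy (BB : Bdry S ν c m 0) (ts : Fin m → Tm S ν n) (I : Inst S ν μ k)
    (σ : Fin n → Tm S μ k) (j : Fin m) :
    (BB.argTy ts j).msubst I σ = BB.msubstArgTy I Fin.elim0 (fun j => (ts j).msubst I σ) j := by
  rw [Bdry.argTy, Bdry.msubst_argTyAux]
  congr 1
  exact Subsingleton.elim _ _

theorem Bdry.inst_mrename (BB : Bdry S ν c m 0) (ρ : MRen ν μ)
    (ts : Fin m → Tm S μ n) : (BB.mrename ρ).inst ts = BB.msubstInst (Inst.gen ρ) Fin.elim0 ts := by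
  rw [Bdry.mrename_eq_msubst, Bdry.inst, Bdry.instAux_msubst, Inst.subst_gen]
  congr 1

theorem Bdry.argTy_mrename (BB : Bdry S ν c m 0) (ρ : MRen ν μ)
    (ts : Fin m → Tm S μ n) (j : Fin m) :
    (BB.mrename ρ).argTy ts j = BB.msubstArgTy (Inst.gen ρ) Fin.elim0 ts j := by
  rw [Bdry.mrename_eq_msubst, Bdry.argTy, Bdry.argTyAux_msubst, Inst.subst_gen]
  congr 1

theorem Bdry.instAux_actC (BB : Bdry S ν c m 0) (I : Inst S ν μ n) (τ : Fin n → Tm S μ k)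
    (ts : Fin m → Tm S μ k) :
    (BB.actC I).instAux τ ts = BB.msubstInst (I.subst τ) Fin.elim0 ts := by
  rw [Bdry.actC_eq_msubst, Bdry.instAux_msubst]
  congr 1
  exact Subsingleton.elim _ _

theorem Bdry.argTyAux_actC (BB : Bdry S ν c m 0) (I : Inst S ν μ n) (τ : Fin n → Tm S μ k)
    (ts : Fin m → Tm S μ k) (j : Fin m) :
    (BB.actC I).argTyAux τ ts j = BB.msubstArgTy (I.subst τ) Fin.elim0 ts j := by
  rw [Bdry.actC_eq_msubst, Bdry.argTyAux_msubst]
  congr 1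
  exact Subsingleton.elim _ _

theorem Bdry.msubst_type (B : Bdry S ν .tm 0 n) (I : Inst S ν μ k) (σ : Fin n → Tm S μ k) :
    (B.msubst I σ).type = B.type.msubst I σ := by
  cases B; rfl

theorem Arg.msubst_body (e : Arg S ν c (m + 1) n) (I : Inst S ν μ k) (σ : Fin n → Tm S μ k) :
    (e.msubst I σ).body = e.body.msubst I.wk (liftSub σ) := by
  cases e; rfl

theorem Bdry.msubst_eqn (BB : Bdry S ν c m n) (e₁ e₂ : Arg S ν c m n) (I : Inst S ν μ k)
    (σ : Fin n → Tm S μ k) :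
    (BB.eqn e₁ e₂).msubst I σ = (BB.msubst I σ).eqn (e₁.msubst I σ) (e₂.msubst I σ) := by
  induction BB generalizing k <;> simp [Bdry.eqn, Bdry.msubst, Arg.msubst_body, *] <;> rfl

theorem Bdry.instAux_eqn (BB : Bdry S μ c m n) (e₁ e₂ : Arg S μ c m n) (σ : Fin n → Tm S μ k)
    (ts : Fin m → Tm S μ k) :
    (BB.eqn e₁ e₂).instAux σ ts =
      (BB.instAux σ ts).eqn (e₁.instAux σ ts) (e₂.instAux σ ts) := by
  induction BB <;> simp [Bdry.eqn, Bdry.instAux, Arg.instAux, *] <;> rfl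

/-- Simultaneous action of an instantiation and of a substitution on judgements and boundaries. -/
def Stmt.msubst (I : Inst S ν μ k) (σ : Fin n → Tm S μ k) : Stmt S ν c m n → Stmt S μ c m k
  | .judg BB e => .judg (BB.msubst I σ) (e.msubst I σ)
  | .bdry BB => .bdry (BB.msubst I σ)

theorem Stmt.msubst_eqn (BB : Bdry S ν c m n) (e₁ e₂ : Arg S ν c m n) (I : Inst S ν μ k)
    (σ : Fin n → Tm S μ k) :
    (Stmt.eqn BB e₁ e₂).msubst I σ = .eqn (BB.msubst I σ) (e₁.msubst I σ) (e₂.msubst I σ) := by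
  simp only [Stmt.eqn, Stmt.msubst, Bdry.msubst_eqn]
  congr 1
  exact Arg.eq_of_not_isObj c.not_isObj_eqn _ _

end BoundarySyntax

/-! ### Preservation of derivability -/

section Transport

variable {S : Signature.{u}} {T : RawTheory.{u, v} S} {μ ν : List MArity} {c : Cls} {m n k : ℕ}

/-- The rules for applications of the metavariables of `Ξ` become derivable over `Θ; Δ` once the
metavariables are interpreted by `I`. -/
structure RawTheory.InterpretsMVars (T : RawTheory.{u, v} S) (Ξ : MCtx S ν) (Θ : MCtx S μ)
    (Δ : Ctx S μ k) (I : Inst S ν μ k) : Prop where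
  app : ∀ {c : Cls} {m : ℕ} (M : MVar ν ⟨c, m⟩) (ts : Fin m → Tm S μ k),
    (∀ j, T.Derives Θ Δ (.judg (.tm ((Ξ.get M).msubstArgTy I Fin.elim0 ts j)) (ts j))) →
    T.Derives Θ Δ (.bdry ((Ξ.get M).msubstInst I Fin.elim0 ts)) →
    T.Derives Θ Δ (.judg ((Ξ.get M).msubstInst I Fin.elim0 ts) ((I _ M).inst ts))
  congrTy : ∀ {m : ℕ} (M : MVar ν ⟨.ty, m⟩) (ss ts : Fin m → Tm S μ k),
    (∀ j, T.Derives Θ Δ (.judg (.tm ((Ξ.get M).msubstArgTy I Fin.elim0 ss j)) (ss j))) →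
    (∀ j, T.Derives Θ Δ (.judg (.tm ((Ξ.get M).msubstArgTy I Fin.elim0 ts j)) (ts j))) →
    (∀ j, T.Derives Θ Δ
      (.judg (.eqTm (ss j) (ts j) ((Ξ.get M).msubstArgTy I Fin.elim0 ss j)) .starTm)) →
    T.Derives Θ Δ (.judg (.eqTy ((I _ M).inst ss) ((I _ M).inst ts)) .starTy)
  congrTm : ∀ {m : ℕ} (M : MVar ν ⟨.tm, m⟩) (ss ts : Fin m → Tm S μ k),
    (∀ j, T.Derives Θ Δ (.judg (.tm ((Ξ.get M).msubstArgTy I Fin.elim0 ss j)) (ss j))) →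
    (∀ j, T.Derives Θ Δ (.judg (.tm ((Ξ.get M).msubstArgTy I Fin.elim0 ts j)) (ts j))) →
    (∀ j, T.Derives Θ Δ
      (.judg (.eqTm (ss j) (ts j) ((Ξ.get M).msubstArgTy I Fin.elim0 ss j)) .starTm)) →
    T.Derives Θ Δ (.judg (.eqTy ((Ξ.get M).msubstInst I Fin.elim0 ss).type
      ((Ξ.get M).msubstInst I Fin.elim0 ts).type) .starTy) →
    T.Derives Θ Δ (.judg (.eqTm ((I _ M).inst ss) ((I _ M).inst ts)
      ((Ξ.get M).msubstInst I Fin.elim0 ss).type) .starTm)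

/-- A class `G` of pairs of an instantiation and a substitution, closed under passage below a
binder, along which derivability over `Ξ` is transported to derivability over `Θ`. -/
structure RawTheory.Transports (T : RawTheory.{u, v} S) (Ξ : MCtx S ν) (Θ : MCtx S μ)
    (G : ∀ {n k : ℕ}, Ctx S ν n → Ctx S μ k → Inst S ν μ k → (Fin n → Tm S μ k) → Prop) :
    Prop where
  var : ∀ {n k : ℕ} {Γ : Ctx S ν n} {Δ : Ctx S μ k} {I : Inst S ν μ k} {σ : Fin n → Tm S μ k},
    G Γ Δ I σ → ∀ i, T.Derives Θ Δ (.judg (.tm ((Γ.get i).msubst I σ)) (σ i))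
  lift : ∀ {n k : ℕ} {Γ : Ctx S ν n} {Δ : Ctx S μ k} {I : Inst S ν μ k} {σ : Fin n → Tm S μ k},
    G Γ Δ I σ → ∀ A : Ty S ν n, T.Derives Θ Δ (.judg .ty (A.msubst I σ)) →
    G (Γ.snoc A) (Δ.snoc (A.msubst I σ)) I.wk (liftSub σ)
  interprets : ∀ {n k : ℕ} {Γ : Ctx S ν n} {Δ : Ctx S μ k} {I : Inst S ν μ k}
    {σ : Fin n → Tm S μ k}, G Γ Δ I σ → T.InterpretsMVars Ξ Θ Δ I

theorem RawTheory.Transports.derives {Ξ : MCtx S ν} {Θ : MCtx S μ}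
    {G : ∀ {n k : ℕ}, Ctx S ν n → Ctx S μ k → Inst S ν μ k → (Fin n → Tm S μ k) → Prop}
    (hG : T.Transports Ξ Θ G) {Γ : Ctx S ν n} {J : Stmt S ν c m n} (h : T.Derives Ξ Γ J)
    {Δ : Ctx S μ k} {I : Inst S ν μ k} {σ : Fin n → Tm S μ k} (hg : G Γ Δ I σ) :
    T.Derives Θ Δ (J.msubst I σ) := by
  induction h generalizing k with
  | var a => exact hG.var hg a
  | mvar M ts _ _ ih₁ ih₂ =>
    simp only [Stmt.msubst, Bdry.msubst, Bdry.msubst_inst, Bdry.msubst_argTy, Arg.msubst_mapp] at *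
    exact (hG.interprets hg).app M _ (fun j => ih₁ j hg) (ih₂ hg)
  | mvarCongrTy M ss ts _ _ _ ih₁ ih₂ ih₃ =>
    simp only [Stmt.msubst, Bdry.msubst, Bdry.msubst_argTy, Arg.msubst_mapp, Arg.msubst] at *
    exact (hG.interprets hg).congrTy M _ _ (fun j => ih₁ j hg) (fun j => ih₂ j hg)
      (fun j => ih₃ j hg)
  | mvarCongrTm M ss ts _ _ _ _ ih₁ ih₂ ih₃ ih₄ =>
    simp only [Stmt.msubst, Bdry.msubst, Bdry.msubst_argTy, Arg.msubst_mapp, Arg.msubst,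
      ← Bdry.msubst_type, Bdry.msubst_inst] at *
    exact (hG.interprets hg).congrTm M _ _ (fun j => ih₁ j hg) (fun j => ih₂ j hg)
      (fun j => ih₃ j hg) (ih₄ hg)
  | abs _ _ ih₁ ih₂ => exact .abs (ih₁ hg) (ih₂ (hG.lift hg _ (ih₁ hg)))
  | tyRefl _ ih => exact .tyRefl (ih hg)
  | tySym _ ih => exact .tySym (ih hg)
  | tyTran _ _ ih₁ ih₂ => exact .tyTran (ih₁ hg) (ih₂ hg)
  | tmRefl _ ih => exact .tmRefl (ih hg)
  | tmSym _ ih => exact .tmSym (ih hg)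
  | tmTran _ _ ih₁ ih₂ => exact .tmTran (ih₁ hg) (ih₂ hg)
  | convTm _ _ ih₁ ih₂ => exact .convTm (ih₁ hg) (ih₂ hg)
  | convEq _ _ ih₁ ih₂ => exact .convEq (ih₁ hg) (ih₂ hg)
  | bdryTy => exact .bdryTy
  | bdryTm _ ih => exact .bdryTm (ih hg)
  | bdryEqTy _ _ ih₁ ih₂ => exact .bdryEqTy (ih₁ hg) (ih₂ hg)
  | bdryEqTm _ _ _ ih₁ ih₂ ih₃ => exact .bdryEqTm (ih₁ hg) (ih₂ hg) (ih₃ hg)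
  | bdryAbs _ _ ih₁ ih₂ => exact .bdryAbs (ih₁ hg) (ih₂ (hG.lift hg _ (ih₁ hg)))
  | rule i J _ _ ih₁ ih₂ =>
    simp only [Stmt.msubst, Bdry.msubst_actC, Arg.msubst_actC] at *
    exact .rule i _ (fun α M => ih₁ α M hg) (ih₂ hg)
  | congrTy i J K _ _ _ ih₁ ih₂ ih₃ =>
    simp only [Stmt.msubst, Bdry.msubst, Bdry.msubst_actC, Arg.msubst_actC, Arg.msubst] at ih₁ ih₂ ⊢
    exact .congrTy i _ _ (fun α M => ih₁ α M hg) (fun α M => ih₂ α M hg)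
      (fun α M h => by
        simpa only [Stmt.msubst_eqn, Bdry.msubst_actC, Inst.msubst] using ih₃ α M h hg)
  | congrTm i J K _ _ _ _ ih₁ ih₂ ih₃ ih₄ =>
    simp only [Stmt.msubst, Bdry.msubst, Bdry.msubst_actC, Arg.msubst_actC, Arg.msubst,
      ← Bdry.msubst_type] at ih₁ ih₂ ih₄ ⊢
    exact .congrTm i _ _ (fun α M => ih₁ α M hg) (fun α M => ih₂ α M hg)
      (fun α M h => by
        simpa only [Stmt.msubst_eqn, Bdry.msubst_actC, Inst.msubst] using ih₃ α M h hg) (ih₄ hg)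

/-- The renaming `ρ` of metavariables respects boundaries, so that derivations over `Ξ` can be read
over `Θ`. -/
def MCtx.Ren (Ξ : MCtx S ν) (Θ : MCtx S μ) (ρ : MRen ν μ) : Prop :=
  ∀ (α : MArity) (M : MVar ν α), Θ.get (ρ α M) = (Ξ.get M).mrename ρ

theorem MCtx.Ren.interpretsMVars {Ξ : MCtx S ν} {Θ : MCtx S μ}
    {ρ : MRen ν μ} (h : Ξ.Ren Θ ρ) (Δ : Ctx S μ k) :
    T.InterpretsMVars Ξ Θ Δ (Inst.gen ρ) where
  app M ts h₁ h₂ := by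
    simp only [← Bdry.inst_mrename, ← Bdry.argTy_mrename, ← h _ M, Inst.gen, inst_genApp] at *
    exact .mvar _ ts h₁ h₂
  congrTy M ss ts h₁ h₂ h₃ := by
    simp only [← Bdry.argTy_mrename, ← h _ M, Inst.gen, inst_genApp] at *
    exact .mvarCongrTy _ ss ts h₁ h₂ h₃
  congrTm M ss ts h₁ h₂ h₃ h₄ := by
    simp only [← Bdry.inst_mrename, ← Bdry.argTy_mrename, ← h _ M, Inst.gen, inst_genApp] at *
    exact .mvarCongrTm _ ss ts h₁ h₂ h₃ h₄

theorem MCtx.Ren.id (Θ : MCtx S μ) : Θ.Ren Θ (fun _ M => M) := by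
  intro α M
  rw [Bdry.mrename_eq_msubst, Bdry.msubst_idn_var]

/-- The instantiation `I` is the renaming `ρm` of metavariables, and the substitution `σ` is a
renaming of variables which respects their types. -/
def IsRenaming (ρm : MRen ν μ) {n k : ℕ} (Γ : Ctx S ν n) (Δ : Ctx S μ k)
    (I : Inst S ν μ k) (σ : Fin n → Tm S μ k) : Prop :=
  I = Inst.gen ρm ∧ ∃ ρ : Fin n → Fin k, σ = (fun i => .var (ρ i)) ∧
    ∀ i, Δ.get (ρ i) = (Γ.get i).msubst I σ

theorem rename_succ_msubst (A : Arg S ν c m n) (I : Inst S ν μ k) (σ : Fin n → Tm S μ k) :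
    (A.rename Fin.succ).msubst I.wk (liftSub σ) = (A.msubst I σ).rename Fin.succ := by
  rw [Arg.msubst_rename, Arg.rename_msubst]
  rfl

theorem Ctx.get_zero (Γ : Ctx S μ n) (A : Ty S μ n) :
    (Γ.snoc A).get 0 = A.rename Fin.succ := rfl

theorem Ctx.get_succ (Γ : Ctx S μ n) (A : Ty S μ n) (i : Fin n) :
    (Γ.snoc A).get i.succ = (Γ.get i).rename Fin.succ := rfl

theorem MCtx.Ren.transports_renaming {Ξ : MCtx S ν} {Θ : MCtx S μ}
    {ρm : MRen ν μ} (h : Ξ.Ren Θ ρm) :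
    T.Transports Ξ Θ (IsRenaming ρm) where
  var := by
    rintro n k Γ Δ _ _ ⟨rfl, ρ, rfl, h⟩ i
    rw [← h]
    exact .var _
  lift := by
    rintro n k Γ Δ I σ ⟨rfl, ρ, rfl, h⟩ A -
    refine ⟨Inst.wk_gen _, liftRen ρ, liftSub_ren ρ, fun i => ?_⟩
    cases i using Fin.cases with
    | zero => simp only [liftRen_zero, Ctx.get_zero, rename_succ_msubst]
    | succ i => simp only [liftRen_succ, Ctx.get_succ, rename_succ_msubst, h]
  interprets := by
    rintro n k Γ Δ _ _ ⟨rfl, -⟩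
    exact h.interpretsMVars Δ

theorem IsRenaming.succ (Γ : Ctx S μ n) (A : Ty S μ n) :
    IsRenaming (fun _ M => M) Γ (Γ.snoc A) Inst.idn (fun i => .var i.succ) :=
  ⟨rfl, Fin.succ, rfl, fun i => by rw [Ctx.get_succ, Arg.rename_eq_subst, Arg.subst_eq_msubst]⟩

theorem RawTheory.Derives.weaken {Θ : MCtx S μ} {Γ : Ctx S μ n} {BB : Bdry S μ c m n}
    {e : Arg S μ c m n} (h : T.Derives Θ Γ (.judg BB e)) (A : Ty S μ n) :
    T.Derives Θ (Γ.snoc A) (.judg (BB.rename Fin.succ) (e.rename Fin.succ)) := by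
  rw [Bdry.rename_eq_msubst, Arg.rename_eq_subst, Arg.subst_eq_msubst]
  exact (MCtx.Ren.id Θ).transports_renaming.derives h (IsRenaming.succ Γ A)

/-- The substitution `σ` is well-typed once metavariables are instantiated by `I`. -/
def RawTheory.WfSubst (T : RawTheory.{u, v} S) (Θ : MCtx S μ) (Γ : Ctx S ν n) (Δ : Ctx S μ k)
    (I : Inst S ν μ k) (σ : Fin n → Tm S μ k) : Prop :=
  ∀ i, T.Derives Θ Δ (.judg (.tm ((Γ.get i).msubst I σ)) (σ i))

theorem RawTheory.WfSubst.lift {Θ : MCtx S μ} {Γ : Ctx S ν n} {Δ : Ctx S μ k} {I : Inst S ν μ k}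
    {σ : Fin n → Tm S μ k} (h : T.WfSubst Θ Γ Δ I σ) (A : Ty S ν n) :
    T.WfSubst Θ (Γ.snoc A) (Δ.snoc (A.msubst I σ)) I.wk (liftSub σ) := by
  intro i
  cases i using Fin.cases with
  | zero =>
    rw [Ctx.get_zero, rename_succ_msubst]
    exact .var 0
  | succ i =>
    rw [Ctx.get_succ, rename_succ_msubst]
    exact (h i).weaken _

theorem MCtx.Ren.transports {Ξ : MCtx S ν} {Θ : MCtx S μ}
    {ρm : MRen ν μ} (h : Ξ.Ren Θ ρm) :
    T.Transports Ξ Θ (fun Γ Δ I σ => I = Inst.gen ρm ∧ T.WfSubst Θ Γ Δ I σ) where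
  var hg := hg.2
  lift := by
    rintro n k Γ Δ I σ ⟨rfl, h⟩ A -
    exact ⟨Inst.wk_gen _, h.lift A⟩
  interprets := by
    rintro n k Γ Δ _ _ ⟨rfl, -⟩
    exact h.interpretsMVars Δ

theorem RawTheory.Derives.msubst_gen {Ξ : MCtx S ν} {Θ : MCtx S μ}
    {ρm : MRen ν μ} {Γ : Ctx S ν n} {J : Stmt S ν c m n}
    (h : T.Derives Ξ Γ J) (hρ : Ξ.Ren Θ ρm) {Δ : Ctx S μ k} {σ : Fin n → Tm S μ k}
    (hσ : T.WfSubst Θ Γ Δ (Inst.gen ρm) σ) : T.Derives Θ Δ (J.msubst (Inst.gen ρm) σ) :=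
  hρ.transports.derives h ⟨rfl, hσ⟩

theorem RawTheory.Derives.msubst_idn {Θ : MCtx S μ} {Γ : Ctx S μ n} {J : Stmt S μ c m n}
    (h : T.Derives Θ Γ J) {Δ : Ctx S μ k} {σ : Fin n → Tm S μ k}
    (hσ : T.WfSubst Θ Γ Δ Inst.idn σ) : T.Derives Θ Δ (J.msubst Inst.idn σ) :=
  h.msubst_gen (MCtx.Ren.id Θ) hσ

end Transport

/-! ### Inversion of abstractions and boundaries -/

section Inversion

variable {S : Signature.{u}} {T : RawTheory.{u, v} S} {μ : List MArity} {c : Cls}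
  {m n : ℕ} {Θ : MCtx S μ}

theorem RawTheory.Derives.abs_inv {Γ : Ctx S μ n} {A : Ty S μ n} {BB : Bdry S μ c m (n + 1)}
    {e : Arg S μ c (m + 1) n} (h : T.Derives Θ Γ (.judg (.abs A BB) e)) :
    T.Derives Θ Γ (.judg .ty A) ∧ T.Derives Θ (Γ.snoc A) (.judg BB e.body) := by
  cases h with
  | abs h₁ h₂ => exact ⟨h₁, h₂⟩

theorem RawTheory.Derives.bdryAbs_inv {Γ : Ctx S μ n} {A : Ty S μ n}
    {BB : Bdry S μ c m (n + 1)} (h : T.Derives Θ Γ (.bdry (.abs A BB))) :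
    T.Derives Θ Γ (.judg .ty A) ∧ T.Derives Θ (Γ.snoc A) (.bdry BB) := by
  cases h with
  | bdryAbs h₁ h₂ => exact ⟨h₁, h₂⟩

theorem RawTheory.Derives.bdryTm_inv {Γ : Ctx S μ n} {A : Ty S μ n}
    (h : T.Derives Θ Γ (.bdry (.tm A))) : T.Derives Θ Γ (.judg .ty A) := by
  cases h with
  | bdryTm h => exact h

theorem RawTheory.Derives.bdryEqTy_inv {Γ : Ctx S μ n} {A B : Ty S μ n}
    (h : T.Derives Θ Γ (.bdry (.eqTy A B))) :
    T.Derives Θ Γ (.judg .ty A) ∧ T.Derives Θ Γ (.judg .ty B) := by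
  cases h with
  | bdryEqTy h₁ h₂ => exact ⟨h₁, h₂⟩

theorem RawTheory.Derives.bdryEqTm_inv {Γ : Ctx S μ n} {s t : Tm S μ n} {A : Ty S μ n}
    (h : T.Derives Θ Γ (.bdry (.eqTm s t A))) :
    T.Derives Θ Γ (.judg .ty A) ∧ T.Derives Θ Γ (.judg (.tm A) s) ∧
      T.Derives Θ Γ (.judg (.tm A) t) := by
  cases h with
  | bdryEqTm h₁ h₂ h₃ => exact ⟨h₁, h₂, h₃⟩

theorem RawTheory.Derives.eqn_bdry_inv (hc : c.IsObj) {Γ : Ctx S μ n} {BB : Bdry S μ c m n}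
    {e₁ e₂ : Arg S μ c m n} (h : T.Derives Θ Γ (.bdry (BB.eqn e₁ e₂))) :
    T.Derives Θ Γ (.judg BB e₁) ∧ T.Derives Θ Γ (.judg BB e₂) := by
  induction BB with
  | ty => exact h.bdryEqTy_inv
  | tm A => exact h.bdryEqTm_inv.2
  | eqTy A B => rcases hc with h | h <;> cases h
  | eqTm s t A => rcases hc with h | h <;> cases h
  | abs A BB ih =>
    obtain ⟨h₁, h₂⟩ := h.bdryAbs_inv
    obtain ⟨h₃, h₄⟩ := ih hc h₂
    rw [← e₁.abs_body, ← e₂.abs_body]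
    exact ⟨.abs h₁ h₃, .abs h₁ h₄⟩

theorem Bdry.eq_ty (B : Bdry S μ .ty 0 n) : B = .ty := by
  cases B; rfl

theorem Bdry.eq_tm (B : Bdry S μ .tm 0 n) : B = .tm B.type := by
  cases B; rfl

theorem Stmt.eqn_ty (B : Bdry S μ .ty 0 n) (A A' : Ty S μ n) :
    Stmt.eqn B A A' = .judg (.eqTy A A') .starTy := by
  cases B; rfl

theorem Stmt.eqn_tm (B : Bdry S μ .tm 0 n) (s t : Tm S μ n) :
    Stmt.eqn B s t = .judg (.eqTm s t B.type) .starTm := by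
  cases B; rfl

theorem Stmt.eqn_abs (A : Ty S μ n) (BB : Bdry S μ c m (n + 1)) (e₁ e₂ : Arg S μ c (m + 1) n) :
    Stmt.eqn (.abs A BB) e₁ e₂ =
      .judg (.abs A (BB.eqn e₁.body e₂.body)) (.abs (Arg.dummy c m)) := rfl

theorem RawTheory.Derives.eqn_abs_inv {Γ : Ctx S μ n} {A : Ty S μ n}
    {BB : Bdry S μ c m (n + 1)} {e₁ e₂ : Arg S μ c (m + 1) n}
    (h : T.Derives Θ Γ (.eqn (.abs A BB) e₁ e₂)) :
    T.Derives Θ Γ (.judg .ty A) ∧ T.Derives Θ (Γ.snoc A) (.eqn BB e₁.body e₂.body) := by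
  rw [Stmt.eqn_abs] at h
  exact h.abs_inv

theorem RawTheory.Derives.eqn_symm (hc : c.IsObj) {Γ : Ctx S μ n} {BB : Bdry S μ c m n}
    {e₁ e₂ : Arg S μ c m n} (h : T.Derives Θ Γ (.eqn BB e₁ e₂)) :
    T.Derives Θ Γ (.eqn BB e₂ e₁) := by
  induction BB with
  | ty => exact h.tySym
  | tm A => exact h.tmSym
  | eqTy A B => rcases hc with h | h <;> cases h
  | eqTm s t A => rcases hc with h | h <;> cases h
  | abs A BB ih => exact .abs h.eqn_abs_inv.1 (ih hc h.eqn_abs_inv.2)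

theorem RawTheory.Derives.eqn_trans (hc : c.IsObj) {Γ : Ctx S μ n} {BB : Bdry S μ c m n}
    {e₁ e₂ e₃ : Arg S μ c m n} (h₁ : T.Derives Θ Γ (.eqn BB e₁ e₂))
    (h₂ : T.Derives Θ Γ (.eqn BB e₂ e₃)) : T.Derives Θ Γ (.eqn BB e₁ e₃) := by
  induction BB with
  | ty => exact h₁.tyTran h₂
  | tm A => exact h₁.tmTran h₂
  | eqTy A B => rcases hc with h | h <;> cases h
  | eqTm s t A => rcases hc with h | h <;> cases h
  | abs A BB ih =>
    exact .abs h₁.eqn_abs_inv.1 (ih hc h₁.eqn_abs_inv.2 h₂.eqn_abs_inv.2)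

theorem RawTheory.Derives.eqn_refl (hc : c.IsObj) {Γ : Ctx S μ n} {BB : Bdry S μ c m n}
    {e : Arg S μ c m n} (h : T.Derives Θ Γ (.judg BB e)) : T.Derives Θ Γ (.eqn BB e e) := by
  induction BB with
  | ty => exact .tyRefl h
  | tm A => exact .tmRefl h
  | eqTy A B => rcases hc with h | h <;> cases h
  | eqTm s t A => rcases hc with h | h <;> cases h
  | abs A BB ih => exact .abs h.abs_inv.1 (ih hc h.abs_inv.2)

end Inversion

/-! ### Convertible boundaries -/

section Conv

variable {S : Signature.{u}} {T : RawTheory.{u, v} S} {μ ν : List MArity} {c : Cls}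
  {m n k : ℕ} {Θ : MCtx S μ}

/-- Judgementally equal boundaries, compared componentwise. -/
inductive RawTheory.BdryConv (T : RawTheory.{u, v} S) (Θ : MCtx S μ) :
    {n : ℕ} → Ctx S μ n → {c : Cls} → {m : ℕ} → Bdry S μ c m n → Bdry S μ c m n → Prop
  | ty {n : ℕ} {Γ : Ctx S μ n} : T.BdryConv Θ Γ .ty .ty
  | tm {n : ℕ} {Γ : Ctx S μ n} {A A' : Ty S μ n} :
      T.Derives Θ Γ (.judg (.eqTy A A') .starTy) → T.BdryConv Θ Γ (.tm A) (.tm A')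
  | eqTy {n : ℕ} {Γ : Ctx S μ n} {A A' B B' : Ty S μ n} :
      T.Derives Θ Γ (.judg (.eqTy A A') .starTy) → T.Derives Θ Γ (.judg (.eqTy B B') .starTy) →
      T.BdryConv Θ Γ (.eqTy A B) (.eqTy A' B')
  | eqTm {n : ℕ} {Γ : Ctx S μ n} {s s' t t' : Tm S μ n} {A A' : Ty S μ n} :
      T.Derives Θ Γ (.judg (.eqTm s s' A) .starTm) →
      T.Derives Θ Γ (.judg (.eqTm t t' A) .starTm) →
      T.Derives Θ Γ (.judg (.eqTy A A') .starTy) →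
      T.BdryConv Θ Γ (.eqTm s t A) (.eqTm s' t' A')
  | abs {n : ℕ} {Γ : Ctx S μ n} {c : Cls} {m : ℕ} {A A' : Ty S μ n}
      {BB BB' : Bdry S μ c m (n + 1)} :
      T.Derives Θ Γ (.judg (.eqTy A A') .starTy) → T.BdryConv Θ (Γ.snoc A) BB BB' →
      T.BdryConv Θ Γ (.abs A BB) (.abs A' BB')

theorem RawTheory.BdryConv.type {Γ : Ctx S μ n} {B B' : Bdry S μ .tm 0 n}
    (h : T.BdryConv Θ Γ B B') : T.Derives Θ Γ (.judg (.eqTy B.type B'.type) .starTy) := by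
  cases h with
  | tm h => exact h

theorem RawTheory.Derives.snoc_conv {Γ : Ctx S μ n} {A A' : Ty S μ n}
    {J : Stmt S μ c m (n + 1)} (h : T.Derives Θ (Γ.snoc A) J)
    (hA : T.Derives Θ Γ (.judg (.eqTy A' A) .starTy)) : T.Derives Θ (Γ.snoc A') J := by
  have hσ : T.WfSubst Θ (Γ.snoc A) (Γ.snoc A') Inst.idn Arg.var := by
    intro i
    rw [Arg.msubst_idn_var]
    cases i using Fin.cases with
    | zero => exact .convTm (.var 0) (hA.weaken A')
    | succ i => exact .var (Γ := Γ.snoc A') i.succ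
  have := h.msubst_idn hσ
  cases J <;> simpa only [Stmt.msubst, Bdry.msubst_idn_var, Arg.msubst_idn_var] using this

theorem RawTheory.BdryConv.judg {Γ : Ctx S μ n} {BB BB' : Bdry S μ c m n}
    (h : T.BdryConv Θ Γ BB BB') {e : Arg S μ c m n} (he : T.Derives Θ Γ (.judg BB e))
    (hBB' : T.Derives Θ Γ (.bdry BB')) : T.Derives Θ Γ (.judg BB' e) := by
  induction h with
  | ty => exact he
  | tm h => exact .convTm he h
  | eqTy h₁ h₂ =>
    rw [Arg.eq_of_not_isObj (Cls.not_isObj_eqn .ty) e .starTy] at he ⊢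
    exact (h₁.tySym.tyTran he).tyTran h₂
  | eqTm h₁ h₂ h₃ =>
    rw [Arg.eq_of_not_isObj (Cls.not_isObj_eqn .tm) e .starTm] at he ⊢
    exact .convEq ((h₁.tmSym.tmTran he).tmTran h₂) h₃
  | abs h₁ _ ih =>
    obtain ⟨-, h₄⟩ := he.abs_inv
    obtain ⟨h₅, h₆⟩ := hBB'.bdryAbs_inv
    rw [← e.abs_body]
    exact .abs h₅ ((ih h₄ (h₆.snoc_conv h₁)).snoc_conv h₁.tySym)

theorem RawTheory.BdryConv.refl {Γ : Ctx S μ n} {BB : Bdry S μ c m n}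
    (h : T.Derives Θ Γ (.bdry BB)) : T.BdryConv Θ Γ BB BB := by
  induction BB with
  | ty => exact .ty
  | tm A => exact .tm h.bdryTm_inv.tyRefl
  | eqTy A B => exact .eqTy h.bdryEqTy_inv.1.tyRefl h.bdryEqTy_inv.2.tyRefl
  | eqTm s t A =>
    exact .eqTm h.bdryEqTm_inv.2.1.tmRefl h.bdryEqTm_inv.2.2.tmRefl h.bdryEqTm_inv.1.tyRefl
  | abs A BB ih => exact .abs h.bdryAbs_inv.1.tyRefl (ih h.bdryAbs_inv.2)

/-! ### Preservation of equality -/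

/-- A class `G` of pairs of equal instantiations and substitutions, closed under passage below a
binder, along which object judgements over `Ξ` are transported to equations over `Θ`. -/
structure RawTheory.EqTransports (T : RawTheory.{u, v} S) (Ξ : MCtx S ν) (Θ : MCtx S μ)
    (G : ∀ {n k : ℕ}, Ctx S ν n → Ctx S μ k → Inst S ν μ k → (Fin n → Tm S μ k) →
      Inst S ν μ k → (Fin n → Tm S μ k) → Prop) : Prop where
  left : ∀ {n k : ℕ} {Γ : Ctx S ν n} {Δ : Ctx S μ k} {I I' : Inst S ν μ k}
    {σ σ' : Fin n → Tm S μ k}, G Γ Δ I σ I' σ' → ∀ {c : Cls} {m : ℕ} {J : Stmt S ν c m n},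
    T.Derives Ξ Γ J → T.Derives Θ Δ (J.msubst I σ)
  right : ∀ {n k : ℕ} {Γ : Ctx S ν n} {Δ : Ctx S μ k} {I I' : Inst S ν μ k}
    {σ σ' : Fin n → Tm S μ k}, G Γ Δ I σ I' σ' → ∀ {c : Cls} {m : ℕ} {J : Stmt S ν c m n},
    T.Derives Ξ Γ J → T.Derives Θ Δ (J.msubst I' σ')
  var : ∀ {n k : ℕ} {Γ : Ctx S ν n} {Δ : Ctx S μ k} {I I' : Inst S ν μ k}
    {σ σ' : Fin n → Tm S μ k}, G Γ Δ I σ I' σ' → ∀ i,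
    T.Derives Θ Δ (.judg (.eqTm (σ i) (σ' i) ((Γ.get i).msubst I σ)) .starTm)
  lift : ∀ {n k : ℕ} {Γ : Ctx S ν n} {Δ : Ctx S μ k} {I I' : Inst S ν μ k}
    {σ σ' : Fin n → Tm S μ k}, G Γ Δ I σ I' σ' → ∀ {A : Ty S ν n},
    T.Derives Ξ Γ (.judg .ty A) →
    T.Derives Θ Δ (.judg (.eqTy (A.msubst I σ) (A.msubst I' σ')) .starTy) →
    G (Γ.snoc A) (Δ.snoc (A.msubst I σ)) I.wk (liftSub σ) I'.wk (liftSub σ')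
  congr : ∀ {n k : ℕ} {Γ : Ctx S ν n} {Δ : Ctx S μ k} {I I' : Inst S ν μ k}
    {σ σ' : Fin n → Tm S μ k}, G Γ Δ I σ I' σ' → ∀ {c : Cls} {m : ℕ} (_ : c.IsObj)
    (M : MVar ν ⟨c, m⟩) {ss ts : Fin m → Tm S μ k},
    (∀ j, T.Derives Θ Δ (.judg (.tm ((Ξ.get M).msubstArgTy I Fin.elim0 ss j)) (ss j))) →
    (∀ j, T.Derives Θ Δ (.judg (.tm ((Ξ.get M).msubstArgTy I' Fin.elim0 ts j)) (ts j))) →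
    (∀ j, T.Derives Θ Δ
      (.judg (.eqTm (ss j) (ts j) ((Ξ.get M).msubstArgTy I Fin.elim0 ss j)) .starTm)) →
    T.BdryConv Θ Δ ((Ξ.get M).msubstInst I Fin.elim0 ss) ((Ξ.get M).msubstInst I' Fin.elim0 ts) →
    T.Derives Θ Δ (.eqn ((Ξ.get M).msubstInst I Fin.elim0 ss) ((I _ M).inst ss) ((I' _ M).inst ts))

/-- The two instances of an object judgement, or of a boundary, are equal.  There is nothing to say
about judgements which are equations themselves. -/
def RawTheory.EqInstances (T : RawTheory.{u, v} S) (Θ : MCtx S μ) (Δ : Ctx S μ k)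
    (I : Inst S ν μ k) (σ : Fin n → Tm S μ k) (I' : Inst S ν μ k) (σ' : Fin n → Tm S μ k) :
    Stmt S ν c m n → Prop
  | .judg BB e => c.IsObj → T.Derives Θ Δ (.eqn (BB.msubst I σ) (e.msubst I σ) (e.msubst I' σ'))
  | .bdry BB => T.BdryConv Θ Δ (BB.msubst I σ) (BB.msubst I' σ')

theorem RawTheory.InterpretsMVars.eqn {Ξ : MCtx S ν} {Δ : Ctx S μ k} {I : Inst S ν μ k}
    (hI : T.InterpretsMVars Ξ Θ Δ I) (hc : c.IsObj) (M : MVar ν ⟨c, m⟩) {ss ts : Fin m → Tm S μ k}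
    (hss : ∀ j, T.Derives Θ Δ
      (.judg (.tm ((Ξ.get M).msubstArgTy I Fin.elim0 ss j)) (ss j)))
    (hts : ∀ j, T.Derives Θ Δ
      (.judg (.tm ((Ξ.get M).msubstArgTy I Fin.elim0 ts j)) (ts j)))
    (heq : ∀ j, T.Derives Θ Δ
      (.judg (.eqTm (ss j) (ts j) ((Ξ.get M).msubstArgTy I Fin.elim0 ss j)) .starTm))
    (hB : T.BdryConv Θ Δ ((Ξ.get M).msubstInst I Fin.elim0 ss)
      ((Ξ.get M).msubstInst I Fin.elim0 ts)) :
    T.Derives Θ Δ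
      (.eqn ((Ξ.get M).msubstInst I Fin.elim0 ss) ((I _ M).inst ss) ((I _ M).inst ts)) := by
  rcases hc with rfl | rfl
  · rw [Stmt.eqn_ty]
    exact hI.congrTy M ss ts hss hts heq
  · rw [Stmt.eqn_tm]
    exact hI.congrTm M ss ts hss hts heq hB.type

theorem RawTheory.Derives.eqn_rule (hc : c.IsObj) {Γ : Ctx S μ n} (i : T.Idx c)
    {I J : Inst S (T.rule i).ar μ n} (hI : T.DerivableInst (T.rule i).prem Θ Γ I)
    (hJ : T.DerivableInst (T.rule i).prem Θ Γ J)
    (hIJ : ∀ (α : MArity) (M : MVar (T.rule i).ar α), α.cls.IsObj →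
      T.Derives Θ Γ (.eqn (((T.rule i).prem.get M).actC I) (I α M) (J α M)))
    (hB : T.BdryConv Θ Γ ((T.rule i).bdry.actC I) ((T.rule i).bdry.actC J)) :
    T.Derives Θ Γ
      (.eqn ((T.rule i).bdry.actC I) ((T.rule i).head.actC I) ((T.rule i).head.actC J)) := by
  rcases hc with rfl | rfl
  · rw [Stmt.eqn_ty]
    exact .congrTy i I J hI hJ hIJ
  · rw [Stmt.eqn_tm]
    exact .congrTm i I J hI hJ hIJ hB.type

theorem RawTheory.EqTransports.eqInstances {Ξ : MCtx S ν}
    {G : ∀ {n k : ℕ}, Ctx S ν n → Ctx S μ k → Inst S ν μ k → (Fin n → Tm S μ k) →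
      Inst S ν μ k → (Fin n → Tm S μ k) → Prop}
    (hG : T.EqTransports Ξ Θ G) {Γ : Ctx S ν n} {J : Stmt S ν c m n} (h : T.Derives Ξ Γ J)
    {Δ : Ctx S μ k} {I I' : Inst S ν μ k} {σ σ' : Fin n → Tm S μ k} (hg : G Γ Δ I σ I' σ') :
    T.EqInstances Θ Δ I σ I' σ' J := by
  induction h generalizing k with
  | var a => exact fun _ => hG.var hg a
  | mvar M ts h₁ _ ih₁ ih₂ =>
    intro hc
    have l₁ := fun j => hG.left hg (h₁ j)
    have r₁ := fun j => hG.right hg (h₁ j)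
    have e₁ := fun j => ih₁ j hg (Or.inr rfl)
    have e₂ := ih₂ hg
    simp only [EqInstances, Stmt.msubst, Bdry.msubst, Bdry.msubst_inst, Bdry.msubst_argTy,
      Arg.msubst_mapp] at *
    exact hG.congr hg hc M l₁ r₁ e₁ e₂
  | abs h₁ _ ih₁ ih₂ =>
    intro hc
    exact .abs (hG.left hg h₁) (ih₂ (hG.lift hg h₁ (ih₁ hg (Or.inl rfl))) hc)
  | convTm _ h₂ ih₁ _ => exact fun hc => .convEq (ih₁ hg hc) (hG.left hg h₂)
  | bdryTy => exact .ty
  | bdryTm _ ih => exact .tm (ih hg (Or.inl rfl))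
  | bdryEqTy _ _ ih₁ ih₂ => exact .eqTy (ih₁ hg (Or.inl rfl)) (ih₂ hg (Or.inl rfl))
  | bdryEqTm _ _ _ ih₁ ih₂ ih₃ =>
    exact .eqTm (ih₂ hg (Or.inr rfl)) (ih₃ hg (Or.inr rfl)) (ih₁ hg (Or.inl rfl))
  | bdryAbs h₁ _ ih₁ ih₂ =>
    exact .abs (ih₁ hg (Or.inl rfl)) (ih₂ (hG.lift hg h₁ (ih₁ hg (Or.inl rfl))))
  | rule i J h₁ _ ih₁ ih₂ =>
    intro hc
    have l₁ := fun α M => hG.left hg (h₁ α M)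
    have r₁ := fun α M => hG.right hg (h₁ α M)
    have e₁ := fun α M => ih₁ α M hg
    have e₂ := ih₂ hg
    simp only [EqInstances, Stmt.msubst, Bdry.msubst_actC, Arg.msubst_actC] at l₁ r₁ e₁ e₂ ⊢
    exact .eqn_rule hc i l₁ r₁ e₁ e₂
  | _ => rintro (hc | hc) <;> cases hc

/-- Pairs of judgementally equal well-typed substitutions. -/
structure RawTheory.EqSubst (T : RawTheory.{u, v} S) (Θ : MCtx S μ) (Γ : Ctx S μ n) (Δ : Ctx S μ k)
    (σ σ' : Fin n → Tm S μ k) : Prop where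
  left : T.WfSubst Θ Γ Δ Inst.idn σ
  right : T.WfSubst Θ Γ Δ Inst.idn σ'
  eq : ∀ i, T.Derives Θ Δ (.judg (.eqTm (σ i) (σ' i) ((Γ.get i).msubst Inst.idn σ)) .starTm)

theorem RawTheory.WfSubst.lift_conv {Γ : Ctx S ν n} {Δ : Ctx S μ k} {I : Inst S ν μ k}
    {σ : Fin n → Tm S μ k} (h : T.WfSubst Θ Γ Δ I σ) {A : Ty S ν n} {A' : Ty S μ k}
    (hA : T.Derives Θ Δ (.judg (.eqTy A' (A.msubst I σ)) .starTy)) :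
    T.WfSubst Θ (Γ.snoc A) (Δ.snoc A') I.wk (liftSub σ) := by
  intro i
  cases i using Fin.cases with
  | zero =>
    rw [Ctx.get_zero, rename_succ_msubst]
    exact .convTm (.var 0) (hA.weaken _)
  | succ i =>
    rw [Ctx.get_succ, rename_succ_msubst]
    exact (h i).weaken _

theorem RawTheory.EqSubst.lift {Γ : Ctx S μ n} {Δ : Ctx S μ k} {σ σ' : Fin n → Tm S μ k}
    (h : T.EqSubst Θ Γ Δ σ σ') {A : Ty S μ n}
    (hA : T.Derives Θ Δ
      (.judg (.eqTy (A.msubst Inst.idn σ) (A.msubst Inst.idn σ')) .starTy)) :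
    T.EqSubst Θ (Γ.snoc A) (Δ.snoc (A.msubst Inst.idn σ)) (liftSub σ) (liftSub σ') where
  left := by simpa only [Inst.wk_gen] using h.left.lift A
  right := by simpa only [Inst.wk_gen] using h.right.lift_conv hA
  eq i := by
    have lift_wk (B : Ty S μ n) : (B.rename Fin.succ).msubst Inst.idn (liftSub σ) =
        (B.msubst Inst.idn σ).rename Fin.succ := by
      simpa only [Inst.wk_gen] using rename_succ_msubst B Inst.idn σ
    cases i using Fin.cases with
    | zero =>
      rw [Ctx.get_zero, lift_wk]
      exact .tmRefl (.var 0)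
    | succ i =>
      rw [Ctx.get_succ, lift_wk]
      exact (h.eq i).weaken _

theorem RawTheory.EqSubst.transports :
    T.EqTransports Θ Θ (fun Γ Δ I σ I' σ' => I = Inst.idn ∧ I' = Inst.idn ∧
      T.EqSubst Θ Γ Δ σ σ') where
  left := by
    rintro n k Γ Δ I I' σ σ' ⟨rfl, rfl, h⟩ c m J hJ
    exact hJ.msubst_idn h.left
  right := by
    rintro n k Γ Δ I I' σ σ' ⟨rfl, rfl, h⟩ c m J hJ
    exact hJ.msubst_idn h.right
  var := by
    rintro n k Γ Δ I I' σ σ' ⟨rfl, rfl, h⟩ i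
    exact h.eq i
  lift := by
    rintro n k Γ Δ I I' σ σ' ⟨rfl, rfl, h⟩ A - hA
    exact ⟨Inst.wk_gen _, Inst.wk_gen _, h.lift hA⟩
  congr := by
    rintro n k Γ Δ I I' σ σ' ⟨rfl, rfl, -⟩ c m hc M ss ts h₁ h₂ h₃ h₄
    exact ((MCtx.Ren.id Θ).interpretsMVars Δ).eqn hc M h₁ h₂ h₃ h₄

theorem RawTheory.Derives.msubst_eqn {Γ : Ctx S μ n} {BB : Bdry S μ c m n} {e : Arg S μ c m n}
    (hc : c.IsObj) (h : T.Derives Θ Γ (.judg BB e)) {Δ : Ctx S μ k} {σ σ' : Fin n → Tm S μ k}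
    (hσ : T.EqSubst Θ Γ Δ σ σ') :
    T.Derives Θ Δ (.eqn (BB.msubst Inst.idn σ) (e.msubst Inst.idn σ) (e.msubst Inst.idn σ')) :=
  RawTheory.EqSubst.transports.eqInstances h ⟨rfl, rfl, hσ⟩ hc

theorem RawTheory.Derives.bdryConv_msubst {Γ : Ctx S μ n} {BB : Bdry S μ c m n}
    (h : T.Derives Θ Γ (.bdry BB)) {Δ : Ctx S μ k} {σ σ' : Fin n → Tm S μ k}
    (hσ : T.EqSubst Θ Γ Δ σ σ') :
    T.BdryConv Θ Δ (BB.msubst Inst.idn σ) (BB.msubst Inst.idn σ') :=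
  RawTheory.EqSubst.transports.eqInstances h ⟨rfl, rfl, hσ⟩

end Conv

/-! ### Presuppositions -/

section Presup

variable {S : Signature.{u}} {T : RawTheory.{u, v} S} {μ : List MArity} {c : Cls}
  {m n k : ℕ} {Θ : MCtx S μ}

theorem RawTheory.WfCtx.get {Γ : Ctx S μ n} (h : T.WfCtx Θ Γ) (i : Fin n) :
    T.Derives Θ Γ (.judg .ty (Γ.get i)) := by
  induction h with
  | nil => exact i.elim0
  | snoc _ hA ih =>
    cases i using Fin.cases with
    | zero => exact hA.weaken _
    | succ i => exact (ih i).weaken _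

theorem RawTheory.Derives.mvarTy {Γ : Ctx S μ n} (M : MVar μ ⟨.ty, k⟩) (ts : Fin k → Tm S μ n)
    (h : ∀ j, T.Derives Θ Γ (.judg (.tm ((Θ.get M).argTy ts j)) (ts j))) :
    T.Derives Θ Γ (.judg .ty (Arg.mapp M ts)) := by
  have := RawTheory.Derives.mvar M ts h (by rw [Bdry.eq_ty ((Θ.get M).inst ts)]; exact .bdryTy)
  rwa [Bdry.eq_ty ((Θ.get M).inst ts)] at this

theorem RawTheory.Derives.mvarTm {Γ : Ctx S μ n} (M : MVar μ ⟨.tm, k⟩) (ts : Fin k → Tm S μ n)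
    (h : ∀ j, T.Derives Θ Γ (.judg (.tm ((Θ.get M).argTy ts j)) (ts j)))
    (h' : T.Derives Θ Γ (.judg .ty ((Θ.get M).inst ts).type)) :
    T.Derives Θ Γ (.judg (.tm ((Θ.get M).inst ts).type) (Arg.mapp M ts)) := by
  have := RawTheory.Derives.mvar M ts h
    (by rw [Bdry.eq_tm ((Θ.get M).inst ts)]; exact .bdryTm h')
  rwa [Bdry.eq_tm ((Θ.get M).inst ts)] at this

theorem RawTheory.Derives.ruleTy {Γ : Ctx S μ n} (i : T.Idx .ty) (I : Inst S (T.rule i).ar μ n)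
    (h : T.DerivableInst (T.rule i).prem Θ Γ I) :
    T.Derives Θ Γ (.judg .ty ((T.rule i).head.actC I)) := by
  have := RawTheory.Derives.rule i I h
    (by rw [Bdry.eq_ty ((T.rule i).bdry.actC I)]; exact .bdryTy)
  rwa [Bdry.eq_ty ((T.rule i).bdry.actC I)] at this

theorem RawTheory.Derives.ruleTm {Γ : Ctx S μ n} (i : T.Idx .tm) (I : Inst S (T.rule i).ar μ n)
    (h : T.DerivableInst (T.rule i).prem Θ Γ I)
    (h' : T.Derives Θ Γ (.judg .ty ((T.rule i).bdry.actC I).type)) :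
    T.Derives Θ Γ (.judg (.tm ((T.rule i).bdry.actC I).type) ((T.rule i).head.actC I)) := by
  have := RawTheory.Derives.rule i I h
    (by rw [Bdry.eq_tm ((T.rule i).bdry.actC I)]; exact .bdryTm h')
  rwa [Bdry.eq_tm ((T.rule i).bdry.actC I)] at this

/-- The boundary presupposed by a judgement. -/
def Stmt.presup : Stmt S μ c m n → Stmt S μ c m n
  | .judg BB _ => .bdry BB
  | .bdry BB => .bdry BB

theorem RawTheory.Derives.derives_presup {Γ : Ctx S μ n} {J : Stmt S μ c m n}
    (h : T.Derives Θ Γ J) (hΓ : T.WfCtx Θ Γ) : T.Derives Θ Γ J.presup := by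
  induction h with
  | var a => exact .bdryTm (hΓ.get a)
  | mvar _ _ _ h => exact h
  | mvarCongrTy M ss ts h₁ h₂ => exact .bdryEqTy (.mvarTy M ss h₁) (.mvarTy M ts h₂)
  | mvarCongrTm M ss ts h₁ h₂ _ h₄ _ _ _ ih₄ =>
    obtain ⟨h₅, h₆⟩ := (ih₄ hΓ).bdryEqTy_inv
    exact .bdryEqTm h₅ (.mvarTm M ss h₁ h₅) ((mvarTm M ts h₂ h₆).convTm h₄.tySym)
  | abs h₁ _ _ ih => exact .bdryAbs h₁ (ih (hΓ.snoc h₁))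
  | tyRefl h => exact .bdryEqTy h h
  | tySym _ ih => exact .bdryEqTy (ih hΓ).bdryEqTy_inv.2 (ih hΓ).bdryEqTy_inv.1
  | tyTran _ _ ih₁ ih₂ => exact .bdryEqTy (ih₁ hΓ).bdryEqTy_inv.1 (ih₂ hΓ).bdryEqTy_inv.2
  | tmRefl h ih => exact .bdryEqTm (ih hΓ).bdryTm_inv h h
  | tmSym _ ih =>
    obtain ⟨h₁, h₂, h₃⟩ := (ih hΓ).bdryEqTm_inv
    exact .bdryEqTm h₁ h₃ h₂
  | tmTran _ _ ih₁ ih₂ =>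
    obtain ⟨h₁, h₂, -⟩ := (ih₁ hΓ).bdryEqTm_inv
    obtain ⟨-, -, h₃⟩ := (ih₂ hΓ).bdryEqTm_inv
    exact .bdryEqTm h₁ h₂ h₃
  | convTm _ _ _ ih₂ => exact .bdryTm (ih₂ hΓ).bdryEqTy_inv.2
  | convEq _ h ih₁ ih₂ =>
    obtain ⟨-, h₂, h₃⟩ := (ih₁ hΓ).bdryEqTm_inv
    exact .bdryEqTm (ih₂ hΓ).bdryEqTy_inv.2 (h₂.convTm h) (h₃.convTm h)
  | bdryTy => exact .bdryTy
  | bdryTm h => exact .bdryTm h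
  | bdryEqTy h₁ h₂ => exact .bdryEqTy h₁ h₂
  | bdryEqTm h₁ h₂ h₃ => exact .bdryEqTm h₁ h₂ h₃
  | bdryAbs h₁ h₂ => exact .bdryAbs h₁ h₂
  | rule _ _ _ h => exact h
  | congrTy i I J h₁ h₂ => exact .bdryEqTy (.ruleTy i I h₁) (.ruleTy i J h₂)
  | congrTm i I J h₁ h₂ _ h₄ _ _ _ ih₄ =>
    obtain ⟨h₅, h₆⟩ := (ih₄ hΓ).bdryEqTy_inv
    exact .bdryEqTm h₅ (.ruleTm i I h₁ h₅) ((ruleTm i J h₂ h₆).convTm h₄.tySym)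

theorem RawTheory.Derives.presup {Γ : Ctx S μ n} {BB : Bdry S μ c m n} {e : Arg S μ c m n}
    (h : T.Derives Θ Γ (.judg BB e)) (hΓ : T.WfCtx Θ Γ) : T.Derives Θ Γ (.bdry BB) :=
  h.derives_presup hΓ

theorem RawTheory.Derives.eqn_left (hc : c.IsObj) {Γ : Ctx S μ n} {BB : Bdry S μ c m n}
    {e₁ e₂ : Arg S μ c m n} (h : T.Derives Θ Γ (.eqn BB e₁ e₂)) (hΓ : T.WfCtx Θ Γ) :
    T.Derives Θ Γ (.judg BB e₁) :=
  ((presup h hΓ).eqn_bdry_inv hc).1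

theorem RawTheory.Derives.eqn_right (hc : c.IsObj) {Γ : Ctx S μ n} {BB : Bdry S μ c m n}
    {e₁ e₂ : Arg S μ c m n} (h : T.Derives Θ Γ (.eqn BB e₁ e₂)) (hΓ : T.WfCtx Θ Γ) :
    T.Derives Θ Γ (.judg BB e₂) :=
  ((presup h hΓ).eqn_bdry_inv hc).2

end Presup

/-! ### Substitution for abstracted variables preserves derivability -/

section Instances

variable {S : Signature.{u}} {T : RawTheory.{u, v} S} {μ ν : List MArity} {c : Cls}
  {m n k : ℕ} {Θ : MCtx S μ}

theorem Bdry.instAux_zero (B : Bdry S μ c 0 n) (σ : Fin n → Tm S μ k) (ts : Fin 0 → Tm S μ k) :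
    B.instAux σ ts = B.msubst Inst.idn σ := by
  cases B <;> simp [Bdry.instAux, Bdry.msubst, Arg.subst_eq_msubst]

theorem Arg.instAux_zero (e : Arg S μ c 0 n) (σ : Fin n → Tm S μ k) (ts : Fin 0 → Tm S μ k) :
    e.instAux σ ts = e.msubst Inst.idn σ := by
  simp [Arg.instAux, Arg.subst_eq_msubst]

theorem rename_succ_msubst_finCases (A : Arg S ν c m n) (I : Inst S ν μ k) (t : Tm S μ k)
    (σ : Fin n → Tm S μ k) :
    (A.rename Fin.succ).msubst I (Fin.cases t σ) = A.msubst I σ := by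
  simp [Arg.msubst_rename]

theorem RawTheory.WfSubst.cons {Γ : Ctx S ν n} {Δ : Ctx S μ k} {I : Inst S ν μ k}
    {σ : Fin n → Tm S μ k} (h : T.WfSubst Θ Γ Δ I σ) {A : Ty S ν n} {t : Tm S μ k}
    (ht : T.Derives Θ Δ (.judg (.tm (A.msubst I σ)) t)) :
    T.WfSubst Θ (Γ.snoc A) Δ I (Fin.cases t σ) := by
  intro i
  cases i using Fin.cases with
  | zero =>
    rw [Ctx.get_zero, rename_succ_msubst_finCases]
    exact ht
  | succ i =>
    rw [Ctx.get_succ, rename_succ_msubst_finCases]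
    exact h i

theorem RawTheory.EqSubst.cons {Γ : Ctx S μ n} {Δ : Ctx S μ k} {σ σ' : Fin n → Tm S μ k}
    (h : T.EqSubst Θ Γ Δ σ σ') {A : Ty S μ n} {s t : Tm S μ k}
    (hs : T.Derives Θ Δ (.judg (.tm (A.msubst Inst.idn σ)) s))
    (ht : T.Derives Θ Δ (.judg (.tm (A.msubst Inst.idn σ')) t))
    (hst : T.Derives Θ Δ (.judg (.eqTm s t (A.msubst Inst.idn σ)) .starTm)) :
    T.EqSubst Θ (Γ.snoc A) Δ (Fin.cases s σ) (Fin.cases t σ') where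
  left := h.left.cons hs
  right := h.right.cons ht
  eq i := by
    cases i using Fin.cases with
    | zero =>
      rw [Ctx.get_zero, rename_succ_msubst_finCases]
      exact hst
    | succ i =>
      rw [Ctx.get_succ, rename_succ_msubst_finCases]
      exact h.eq i

theorem RawTheory.WfSubst.refl {Γ : Ctx S μ n} {Δ : Ctx S μ k} {σ : Fin n → Tm S μ k}
    (h : T.WfSubst Θ Γ Δ Inst.idn σ) : T.EqSubst Θ Γ Δ σ σ :=
  ⟨h, h, fun i => .tmRefl (h i)⟩

/-- The terms `ts` have the types which `BB`, after substitution of `σ` for its free variables,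
assigns to its abstracted variables; they can then be substituted for the latter. -/
def RawTheory.Fits (T : RawTheory.{u, v} S) (Θ : MCtx S μ) (Δ : Ctx S μ k)
    (BB : Bdry S μ c m n) (σ : Fin n → Tm S μ k) (ts : Fin m → Tm S μ k) : Prop :=
  ∀ j, T.Derives Θ Δ (.judg (.tm (BB.argTyAux σ ts j)) (ts j))

theorem RawTheory.Fits.zero {Δ : Ctx S μ k} {A : Ty S μ n} {BB : Bdry S μ c m (n + 1)}
    {σ : Fin n → Tm S μ k} {ts : Fin (m + 1) → Tm S μ k}
    (h : T.Fits Θ Δ (.abs A BB) σ ts) :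
    T.Derives Θ Δ (.judg (.tm (A.msubst Inst.idn σ)) (ts 0)) := by
  have := h 0
  rwa [← Arg.subst_eq_msubst]

theorem RawTheory.Fits.succ {Δ : Ctx S μ k} {A : Ty S μ n} {BB : Bdry S μ c m (n + 1)}
    {σ : Fin n → Tm S μ k} {ts : Fin (m + 1) → Tm S μ k}
    (h : T.Fits Θ Δ (.abs A BB) σ ts) :
    T.Fits Θ Δ BB (Fin.cases (ts 0) σ) (fun j => ts j.succ) :=
  fun j => h j.succ

theorem RawTheory.Derives.judg_instAux {Γ : Ctx S μ n} {BB : Bdry S μ c m n} {e : Arg S μ c m n}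
    (h : T.Derives Θ Γ (.judg BB e)) {Δ : Ctx S μ k} {σ : Fin n → Tm S μ k}
    (hσ : T.WfSubst Θ Γ Δ Inst.idn σ) {ts : Fin m → Tm S μ k} (hts : T.Fits Θ Δ BB σ ts) :
    T.Derives Θ Δ (.judg (BB.instAux σ ts) (e.instAux σ ts)) := by
  induction m generalizing n with
  | zero =>
    rw [Bdry.instAux_zero, Arg.instAux_zero]
    exact h.msubst_idn hσ
  | succ m ih =>
    cases BB with
    | abs A BB => exact ih h.abs_inv.2 (hσ.cons hts.zero) hts.succ

theorem RawTheory.Derives.eqn_instAux (hc : c.IsObj) {Γ : Ctx S μ n} {BB : Bdry S μ c m n}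
    {e : Arg S μ c m n} (h : T.Derives Θ Γ (.judg BB e)) {Δ : Ctx S μ k}
    {σ σ' : Fin n → Tm S μ k} (hσ : T.EqSubst Θ Γ Δ σ σ') {ss ts : Fin m → Tm S μ k}
    (hss : T.Fits Θ Δ BB σ ss) (hts : T.Fits Θ Δ BB σ' ts)
    (hst : ∀ j, T.Derives Θ Δ (.judg (.eqTm (ss j) (ts j) (BB.argTyAux σ ss j)) .starTm)) :
    T.Derives Θ Δ (.eqn (BB.instAux σ ss) (e.instAux σ ss) (e.instAux σ' ts)) := by
  induction m generalizing n with
  | zero =>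
    rw [Bdry.instAux_zero, Arg.instAux_zero, Arg.instAux_zero]
    exact h.msubst_eqn hc hσ
  | succ m ih =>
    cases BB with
    | abs A BB =>
      refine ih h.abs_inv.2 (hσ.cons hss.zero hts.zero ?_) hss.succ hts.succ
        (fun j => hst j.succ)
      have := hst 0
      rwa [← Arg.subst_eq_msubst]

theorem RawTheory.Derives.bdryConv_instAux {Γ : Ctx S μ n} {BB : Bdry S μ c m n}
    (h : T.Derives Θ Γ (.bdry BB)) {Δ : Ctx S μ k}
    {σ σ' : Fin n → Tm S μ k} (hσ : T.EqSubst Θ Γ Δ σ σ') {ss ts : Fin m → Tm S μ k}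
    (hss : T.Fits Θ Δ BB σ ss) (hts : T.Fits Θ Δ BB σ' ts)
    (hst : ∀ j, T.Derives Θ Δ (.judg (.eqTm (ss j) (ts j) (BB.argTyAux σ ss j)) .starTm)) :
    T.BdryConv Θ Δ (BB.instAux σ ss) (BB.instAux σ' ts) := by
  induction m generalizing n with
  | zero =>
    rw [Bdry.instAux_zero, Bdry.instAux_zero]
    exact h.bdryConv_msubst hσ
  | succ m ih =>
    cases BB with
    | abs A BB =>
      refine ih h.bdryAbs_inv.2 (hσ.cons hss.zero hts.zero ?_) hss.succ hts.succ
        (fun j => hst j.succ)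
      have := hst 0
      rwa [← Arg.subst_eq_msubst]

theorem RawTheory.Fits.of_eq {Γ : Ctx S μ n} {BB : Bdry S μ c m n}
    (h : T.Derives Θ Γ (.bdry BB)) {Δ : Ctx S μ k} (hΔ : T.WfCtx Θ Δ)
    {σ σ' : Fin n → Tm S μ k} (hσ : T.EqSubst Θ Γ Δ σ σ') {ss ts : Fin m → Tm S μ k}
    (hss : T.Fits Θ Δ BB σ ss)
    (hst : ∀ j, (T.Derives Θ Δ (.judg (.tm (BB.argTyAux σ' ts j)) (ts j)) →
        T.Derives Θ Δ (.judg (.tm (BB.argTyAux σ ss j)) (ts j))) →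
      T.Derives Θ Δ (.judg (.eqTm (ss j) (ts j) (BB.argTyAux σ ss j)) .starTm)) :
    T.Fits Θ Δ BB σ' ts ∧
      ∀ j, T.Derives Θ Δ (.judg (.eqTm (ss j) (ts j) (BB.argTyAux σ ss j)) .starTm) := by
  induction m generalizing n with
  | zero => exact ⟨fun j => j.elim0, fun j => j.elim0⟩
  | succ m ih =>
    cases BB with
    | abs A BB =>
      have hA : T.Derives Θ Δ (.judg (.eqTy (A.subst σ) (A.subst σ')) .starTy) := by
        have := h.bdryAbs_inv.1.msubst_eqn (Or.inl rfl) hσ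
        rwa [Arg.subst_eq_msubst, Arg.subst_eq_msubst]
      have h₀ : T.Derives Θ Δ (.judg (.eqTm (ss 0) (ts 0) (A.subst σ)) .starTm) :=
        hst 0 fun h => .convTm h hA.tySym
      have h₁ : T.Derives Θ Δ (.judg (.tm (A.subst σ')) (ts 0)) :=
        (h₀.presup hΔ).bdryEqTm_inv.2.2.convTm hA
      obtain ⟨h₂, h₃⟩ := ih (ts := fun j => ts j.succ) h.bdryAbs_inv.2
        (hσ.cons hss.zero (by rwa [← Arg.subst_eq_msubst]) (by rwa [← Arg.subst_eq_msubst]))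
        hss.succ (fun j => hst j.succ)
      exact ⟨fun j => Fin.cases h₁ h₂ j, fun j => Fin.cases h₀ h₃ j⟩

theorem finCases_var (ρ : Fin (n + 1) → Fin k) :
    (Fin.cases (Arg.var (ρ 0)) (fun i => .var (ρ i.succ)) : Fin (n + 1) → Tm S μ k) =
      fun i => .var (ρ i) :=
  finCases_eta fun i => (Arg.var (ρ i) : Tm S μ k)

theorem RawTheory.Derives.eqn_of_instances (hc : c.IsObj) {Γ : Ctx S μ n} (hΓ : T.WfCtx Θ Γ)
    {BB : Bdry S μ c m n} {e₁ e₂ : Arg S μ c m n} (b : Prop) (h₁ : T.Derives Θ Γ (.judg BB e₁))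
    (h₂ : b → T.Derives Θ Γ (.judg BB e₂))
    (H : ∀ (k : ℕ) (Δ : Ctx S μ k) (σ : Fin n → Tm S μ k) (ts : Fin m → Tm S μ k),
      T.WfCtx Θ Δ → T.Derives Θ Δ (.judg (BB.instAux σ ts) (e₁.instAux σ ts)) →
      (b → T.Derives Θ Δ (.judg (BB.instAux σ ts) (e₂.instAux σ ts))) →
      T.Derives Θ Δ (.eqn (BB.instAux σ ts) (e₁.instAux σ ts) (e₂.instAux σ ts))) :
    T.Derives Θ Γ (.eqn BB e₁ e₂) := by
  induction m generalizing n with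
  | zero =>
    have := H n Γ Arg.var Fin.elim0 hΓ
    simp only [Bdry.instAux_zero, Arg.instAux_zero, Bdry.msubst_idn_var, Arg.msubst_idn_var] at this
    exact this h₁ h₂
  | succ m ih =>
    cases BB with
    | abs A BB =>
      refine .abs h₁.abs_inv.1 (ih (hΓ.snoc h₁.abs_inv.1) h₁.abs_inv.2 (fun hb => (h₂ hb).abs_inv.2)
        fun k Δ σ ts => ?_)
      simpa [Bdry.instAux, Arg.instAux, finCases_eta] using
        H k Δ (fun i => σ i.succ) (Fin.cases (σ 0) ts)

/-- The renaming `ρ` of variables respects types, so that derivations over `Γ` can be read over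
`Δ`. -/
def Ctx.Ren (Γ : Ctx S μ n) (Δ : Ctx S μ k) (ρ : Fin n → Fin k) : Prop :=
  ∀ i, Δ.get (ρ i) = (Γ.get i).rename ρ

namespace Ctx.Ren

variable {Γ : Ctx S μ n} {Δ : Ctx S μ k}

theorem id (Γ : Ctx S μ n) : Γ.Ren Γ (fun i => i) := by
  intro i
  rw [Arg.rename_id]

theorem succ {ρ : Fin n → Fin k} (h : Γ.Ren Δ ρ) (A : Ty S μ k) :
    Γ.Ren (Δ.snoc A) (fun i => (ρ i).succ) := by
  intro i
  rw [Ctx.get_succ, h, Arg.rename_rename]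

theorem lift {ρ : Fin n → Fin k} (h : Γ.Ren Δ ρ) (A : Ty S μ n) :
    (Γ.snoc A).Ren (Δ.snoc (A.rename ρ)) (liftRen ρ) := by
  intro i
  cases i using Fin.cases with
  | zero => simp [Ctx.get_zero, Arg.rename_rename]
  | succ i => simp [Ctx.get_succ, Arg.rename_rename, h i]

theorem tail {A : Ty S μ n} {ρ : Fin (n + 1) → Fin k} (h : (Γ.snoc A).Ren Δ ρ) :
    Γ.Ren Δ (fun i => ρ i.succ) := by
  intro i
  rw [h, Ctx.get_succ, Arg.rename_rename]

theorem get_head {A : Ty S μ n} {ρ : Fin (n + 1) → Fin k} (h : (Γ.snoc A).Ren Δ ρ) :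
    Δ.get (ρ 0) = A.subst (fun i => .var (ρ i.succ)) := by
  rw [h, Ctx.get_zero, Arg.rename_rename, Arg.rename_eq_subst]

theorem wfSubst {ρ : Fin n → Fin k} (h : Γ.Ren Δ ρ) :
    T.WfSubst Θ Γ Δ Inst.idn (fun i => .var (ρ i)) := by
  intro i
  rw [← Arg.subst_eq_msubst, ← Arg.rename_eq_subst, ← h]
  exact .var _

theorem fits_finCases {A : Ty S μ n} {ρ : Fin (n + 1) → Fin k} (h : (Γ.snoc A).Ren Δ ρ)
    {BB : Bdry S μ c m (n + 1)} {ts : Fin m → Tm S μ k}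
    (hts : T.Fits Θ Δ BB (fun i => .var (ρ i)) ts) :
    T.Fits Θ Δ (.abs A BB) (fun i => .var (ρ i.succ)) (Fin.cases (.var (ρ 0)) ts) := by
  intro j
  cases j using Fin.cases with
  | zero =>
    simp only [Bdry.argTyAux, Fin.cases_zero, ← h.get_head]
    exact .var _
  | succ j => simpa only [Bdry.argTyAux, Fin.cases_zero, Fin.cases_succ, finCases_var] using hts j

end Ctx.Ren

theorem RawTheory.Derives.rename {Γ : Ctx S μ n} {BB : Bdry S μ c m n} {e : Arg S μ c m n}
    (h : T.Derives Θ Γ (.judg BB e)) {Δ : Ctx S μ k} {ρ : Fin n → Fin k} (hρ : Γ.Ren Δ ρ) :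
    T.Derives Θ Δ (.judg (BB.rename ρ) (e.rename ρ)) := by
  rw [Bdry.rename_eq_msubst, Arg.rename_eq_subst, Arg.subst_eq_msubst]
  exact h.msubst_idn hρ.wfSubst

theorem RawTheory.Derives.bdry_rename {Γ : Ctx S μ n} {BB : Bdry S μ c m n}
    (h : T.Derives Θ Γ (.bdry BB)) {Δ : Ctx S μ k} {ρ : Fin n → Fin k} (hρ : Γ.Ren Δ ρ) :
    T.Derives Θ Δ (.bdry (BB.rename ρ)) := by
  rw [Bdry.rename_eq_msubst]
  exact h.msubst_idn hρ.wfSubst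

theorem RawTheory.Derives.rename_of_instances {Γ : Ctx S μ n} {BB : Bdry S μ c m n}
    {e : Arg S μ c m n} (h : T.Derives Θ Γ (.bdry BB))
    (H : ∀ (k : ℕ) (Δ : Ctx S μ k) (ρ : Fin n → Fin k) (ts : Fin m → Tm S μ k),
      T.WfCtx Θ Δ → Γ.Ren Δ ρ → T.Fits Θ Δ BB (fun i => .var (ρ i)) ts →
      T.Derives Θ Δ (.bdry (BB.instAux (fun i => .var (ρ i)) ts)) →
      T.Derives Θ Δ (.judg (BB.instAux (fun i => .var (ρ i)) ts)
        (e.instAux (fun i => .var (ρ i)) ts)))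
    {Δ : Ctx S μ k} {ρ : Fin n → Fin k} (hΔ : T.WfCtx Θ Δ) (hρ : Γ.Ren Δ ρ) :
    T.Derives Θ Δ (.judg (BB.rename ρ) (e.rename ρ)) := by
  induction m generalizing n k with
  | zero =>
    have := H k Δ ρ Fin.elim0 hΔ hρ (fun j => j.elim0)
    rw [Bdry.instAux_zero, Arg.instAux_zero, ← Arg.subst_eq_msubst, ← Arg.rename_eq_subst,
      ← Bdry.rename_eq_msubst] at this
    exact this (h.bdry_rename hρ)
  | succ m ih =>
    cases BB with
    | abs A BB =>
      have hA : T.Derives Θ Δ (.judg .ty (A.rename ρ)) := h.bdryAbs_inv.1.rename hρ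
      rw [← e.abs_body]
      refine .abs hA (ih h.bdryAbs_inv.2 ?_ (hΔ.snoc hA) (hρ.lift A))
      intro k Δ ρ ts hΔ hρ hts hb
      have := H k Δ _ _ hΔ hρ.tail (hρ.fits_finCases hts)
      simp only [Bdry.instAux, Arg.instAux, Fin.cases_zero, Fin.cases_succ, finCases_var] at this
      exact this hb

theorem RawTheory.Derives.judg_of_instances {Γ : Ctx S μ n} {BB : Bdry S μ c m n}
    {e : Arg S μ c m n} (hΓ : T.WfCtx Θ Γ) (h : T.Derives Θ Γ (.bdry BB))
    (H : ∀ (k : ℕ) (Δ : Ctx S μ k) (ρ : Fin n → Fin k) (ts : Fin m → Tm S μ k),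
      T.WfCtx Θ Δ → Γ.Ren Δ ρ → T.Fits Θ Δ BB (fun i => .var (ρ i)) ts →
      T.Derives Θ Δ (.bdry (BB.instAux (fun i => .var (ρ i)) ts)) →
      T.Derives Θ Δ (.judg (BB.instAux (fun i => .var (ρ i)) ts)
        (e.instAux (fun i => .var (ρ i)) ts))) :
    T.Derives Θ Γ (.judg BB e) := by
  simpa only [Bdry.rename_eq_msubst, Arg.rename_eq_subst, Arg.subst_eq_msubst, Arg.msubst_idn_var,
    Bdry.msubst_idn_var] using h.rename_of_instances H hΓ (Ctx.Ren.id Γ)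

end Instances

/-! ### Instantiation preserves derivability -/

section Instantiation

variable {S : Signature.{u}} {T : RawTheory.{u, v} S} {μ ν ξ : List MArity} {c : Cls}
  {m n k l : ℕ} {Ξ : MCtx S ν} {Θ : MCtx S μ}

/-- `I` and all its weakenings interpret the metavariables of `Ξ`. This is stable under passage
below a binder, so that derivability is transported along `I`; derivable instantiations have the
property, and so do some instantiations of equational metavariables which are not known to be
derivable. -/
def RawTheory.Admissible (T : RawTheory.{u, v} S) (Ξ : MCtx S ν) (Θ : MCtx S μ) (Γ : Ctx S μ n)
    (I : Inst S ν μ n) : Prop :=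
  ∀ (k : ℕ) (Δ : Ctx S μ k) (ρ : Fin n → Fin k), T.WfCtx Θ Δ → Γ.Ren Δ ρ →
    T.InterpretsMVars Ξ Θ Δ (I.rename ρ)

theorem Inst.rename_wk (I : Inst S ν μ n) (ρ : Fin n → Fin k) :
    (I.rename ρ).wk = I.rename (fun i => (ρ i).succ) := by
  funext α M
  simp [Inst.wk, Inst.rename, Arg.rename_rename]

theorem RawTheory.Admissible.transports {Γ₀ : Ctx S μ l} {I₀ : Inst S ν μ l}
    (h : T.Admissible Ξ Θ Γ₀ I₀) :
    T.Transports Ξ Θ (fun {_ _} Γ Δ I σ => T.WfCtx Θ Δ ∧ T.WfSubst Θ Γ Δ I σ ∧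
      ∃ ρ, Γ₀.Ren Δ ρ ∧ I = I₀.rename ρ) where
  var hg := hg.2.1
  lift := by
    rintro n k Γ Δ I σ ⟨hΔ, hσ, ρ, hρ, rfl⟩ A hA
    exact ⟨hΔ.snoc hA, hσ.lift A, _, hρ.succ _, Inst.rename_wk _ _⟩
  interprets := by
    rintro n k Γ Δ I σ ⟨hΔ, hσ, ρ, hρ, rfl⟩
    exact h _ Δ ρ hΔ hρ

theorem Inst.rename_id (I : Inst S ν μ n) : I.rename (fun i => i) = I := by
  funext α M
  exact Arg.rename_id _

theorem RawTheory.Admissible.derives {Γ : Ctx S μ n} {I : Inst S ν μ n}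
    (h : T.Admissible Ξ Θ Γ I) (hΓ : T.WfCtx Θ Γ) {J : Stmt S ν c m 0}
    (hJ : T.Derives Ξ Ctx.nil J) : T.Derives Θ Γ (J.msubst I Fin.elim0) :=
  h.transports.derives hJ ⟨hΓ, fun i => i.elim0, _, Ctx.Ren.id Γ, (Inst.rename_id I).symm⟩

theorem Inst.rename_inst (I : Inst S ν μ n) (ρ : Fin n → Fin k) {α : MArity} (M : MVar ν α)
    (ts : Fin α.bind → Tm S μ k) :
    ((I.rename ρ) α M).inst ts = (I α M).instAux (fun i => .var (ρ i)) ts := by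
  simp [Inst.rename, Arg.inst, Arg.rename_eq_subst, Arg.instAux_subst, Arg.subst]

theorem Bdry.instAux_actC_ren (BB : Bdry S ν c m 0) (I : Inst S ν μ n) (ρ : Fin n → Fin k)
    (ts : Fin m → Tm S μ k) :
    BB.msubstInst (I.rename ρ) Fin.elim0 ts = (BB.actC I).instAux (fun i => .var (ρ i)) ts := by
  rw [Bdry.instAux_actC, Inst.rename_eq_subst]

theorem Bdry.argTyAux_actC_ren (BB : Bdry S ν c m 0) (I : Inst S ν μ n) (ρ : Fin n → Fin k)
    (ts : Fin m → Tm S μ k) (j : Fin m) :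
    BB.msubstArgTy (I.rename ρ) Fin.elim0 ts j =
      (BB.actC I).argTyAux (fun i => .var (ρ i)) ts j := by
  rw [Bdry.argTyAux_actC, Inst.rename_eq_subst]

theorem RawTheory.DerivableInst.admissible {Γ : Ctx S μ n} {I : Inst S ν μ n}
    (h : T.DerivableInst Ξ Θ Γ I) : T.Admissible Ξ Θ Γ I := by
  intro k Δ ρ _ hρ
  constructor
  · intro c m M ts h₁ _
    simp only [Inst.rename_inst, Bdry.instAux_actC_ren, Bdry.argTyAux_actC_ren] at *
    exact (h _ M).judg_instAux hρ.wfSubst h₁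
  · intro m M ss ts h₁ h₂ h₃
    simp only [Inst.rename_inst, Bdry.argTyAux_actC_ren] at *
    have := (h _ M).eqn_instAux (Or.inl rfl) hρ.wfSubst.refl h₁ h₂ h₃
    rwa [Stmt.eqn_ty] at this
  · intro m M ss ts h₁ h₂ h₃ h₄
    simp only [Inst.rename_inst, Bdry.instAux_actC_ren, Bdry.argTyAux_actC_ren] at *
    have := (h _ M).eqn_instAux (Or.inr rfl) hρ.wfSubst.refl h₁ h₂ h₃
    rwa [Stmt.eqn_tm] at this

theorem RawTheory.DerivableInst.derives_judg {Γ : Ctx S μ n} {I : Inst S ν μ n}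
    (h : T.DerivableInst Ξ Θ Γ I) (hΓ : T.WfCtx Θ Γ) {BB : Bdry S ν c m 0} {e : Arg S ν c m 0}
    (hJ : T.Derives Ξ Ctx.nil (.judg BB e)) :
    T.Derives Θ Γ (.judg (BB.actC I) (e.actC I)) := by
  rw [Bdry.actC_eq_msubst, Arg.actC_eq_msubst]
  exact h.admissible.derives hΓ hJ

theorem RawTheory.DerivableInst.derives_bdry {Γ : Ctx S μ n} {I : Inst S ν μ n}
    (h : T.DerivableInst Ξ Θ Γ I) (hΓ : T.WfCtx Θ Γ) {BB : Bdry S ν c m 0}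
    (hJ : T.Derives Ξ Ctx.nil (.bdry BB)) :
    T.Derives Θ Γ (.bdry (BB.actC I)) := by
  rw [Bdry.actC_eq_msubst]
  exact h.admissible.derives hΓ hJ

theorem Bdry.argTyAux_eqn (BB : Bdry S μ c m n) (e₁ e₂ : Arg S μ c m n) (σ : Fin n → Tm S μ k)
    (ts : Fin m → Tm S μ k) : (BB.eqn e₁ e₂).argTyAux σ ts = BB.argTyAux σ ts := by
  induction BB <;> simp [Bdry.eqn, Bdry.argTyAux, *]

/-- `I` and `I'` are derivable instantiations whose object parts are derivably equal. -/
structure RawTheory.EqInst (T : RawTheory.{u, v} S) (Ξ : MCtx S ν) (Θ : MCtx S μ) (Γ : Ctx S μ n)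
    (I I' : Inst S ν μ n) : Prop where
  left : T.DerivableInst Ξ Θ Γ I
  right : T.DerivableInst Ξ Θ Γ I'
  eq : ∀ (α : MArity) (M : MVar ν α), α.cls.IsObj →
    T.Derives Θ Γ (.eqn ((Ξ.get M).actC I) (I α M) (I' α M))

theorem RawTheory.BdryConv.eqn_left (hc : c.IsObj) {Γ : Ctx S μ n} {B B' : Bdry S μ c 0 n}
    (h : T.BdryConv Θ Γ B B') {e e' : Arg S μ c 0 n} (he : T.Derives Θ Γ (.eqn B' e e')) :
    T.Derives Θ Γ (.eqn B e e') := by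
  cases h with
  | ty => exact he
  | tm h => exact .convEq he h.tySym
  | eqTy => exact absurd hc Cls.not_isObj_eqTy
  | eqTm => exact absurd hc Cls.not_isObj_eqTm

theorem RawTheory.BdryConv.eqn_right (hc : c.IsObj) {Γ : Ctx S μ n} {B B' : Bdry S μ c 0 n}
    (h : T.BdryConv Θ Γ B B') {e e' : Arg S μ c 0 n} (he : T.Derives Θ Γ (.eqn B e e')) :
    T.Derives Θ Γ (.eqn B' e e') := by
  cases h with
  | ty => exact he
  | tm h => exact .convEq he h
  | eqTy => exact absurd hc Cls.not_isObj_eqTy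
  | eqTm => exact absurd hc Cls.not_isObj_eqTm

theorem RawTheory.EqInst.eqn_instAux {Γ₀ : Ctx S μ l} {I₀ I₀' : Inst S ν μ l}
    (h : T.EqInst Ξ Θ Γ₀ I₀ I₀') (hΓ₀ : T.WfCtx Θ Γ₀) {Δ : Ctx S μ k} (hΔ : T.WfCtx Θ Δ)
    {ρ : Fin l → Fin k} (hρ : Γ₀.Ren Δ ρ) (hc : c.IsObj) (M : MVar ν ⟨c, m⟩)
    {ss ts : Fin m → Tm S μ k}
    (hss : T.Fits Θ Δ ((Ξ.get M).actC I₀) (fun i => .var (ρ i)) ss)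
    (hst : ∀ j, T.Derives Θ Δ (.judg (.eqTm (ss j) (ts j)
      (((Ξ.get M).actC I₀).argTyAux (fun i => .var (ρ i)) ss j)) .starTm)) :
    T.Derives Θ Δ (.eqn (((Ξ.get M).actC I₀).instAux (fun i => .var (ρ i)) ss)
      ((I₀ _ M).instAux (fun i => .var (ρ i)) ss)
      ((I₀' _ M).instAux (fun i => .var (ρ i)) ts)) := by
  have hM := h.left _ M
  have hB := hM.presup hΓ₀
  have hts := (RawTheory.Fits.of_eq hB hΔ hρ.wfSubst.refl hss (fun j _ => hst j)).1
  have h₁ := hM.eqn_instAux hc hρ.wfSubst.refl hss hts hst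
  have h₂ := (h.eq _ M hc).judg_instAux hρ.wfSubst (ts := ts)
    (fun j => by rw [Bdry.argTyAux_eqn]; exact hts j)
  rw [Bdry.instAux_eqn, Arg.eq_of_not_isObj c.not_isObj_eqn (Arg.instAux _ _ _)
    (Arg.dummy c 0)] at h₂
  exact h₁.eqn_trans hc ((hB.bdryConv_instAux hρ.wfSubst.refl hss hts hst).eqn_left hc h₂)

theorem RawTheory.EqInst.transports {Γ₀ : Ctx S μ l} {I₀ I₀' : Inst S ν μ l}
    (h : T.EqInst Ξ Θ Γ₀ I₀ I₀') (hΓ₀ : T.WfCtx Θ Γ₀) :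
    T.EqTransports Ξ Θ (fun {_ _} Γ Δ I σ I' σ' => T.WfCtx Θ Δ ∧ T.WfSubst Θ Γ Δ I σ ∧
      T.WfSubst Θ Γ Δ I' σ' ∧ σ = σ' ∧ ∃ ρ, Γ₀.Ren Δ ρ ∧ I = I₀.rename ρ ∧ I' = I₀'.rename ρ) where
  left := by
    rintro n k Γ Δ I I' σ σ' ⟨hΔ, hσ, -, -, ρ, hρ, hI, -⟩ c m J hJ
    exact h.left.admissible.transports.derives hJ ⟨hΔ, hσ, ρ, hρ, hI⟩
  right := by
    rintro n k Γ Δ I I' σ σ' ⟨hΔ, -, hσ, -, ρ, hρ, -, hI⟩ c m J hJ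
    exact h.right.admissible.transports.derives hJ ⟨hΔ, hσ, ρ, hρ, hI⟩
  var := by
    rintro n k Γ Δ I I' σ σ' ⟨-, hσ, -, rfl, -⟩ i
    exact .tmRefl (hσ i)
  lift := by
    rintro n k Γ Δ I I' σ σ' ⟨hΔ, hσ, hσ', rfl, ρ, hρ, rfl, rfl⟩ A - hA
    exact ⟨hΔ.snoc (hA.presup hΔ).bdryEqTy_inv.1, hσ.lift A, hσ'.lift_conv hA, rfl, _, hρ.succ _,
      Inst.rename_wk _ _, Inst.rename_wk _ _⟩
  congr := by
    rintro n k Γ Δ I I' σ σ' ⟨hΔ, -, -, -, ρ, hρ, rfl, rfl⟩ c m hc M ss ts h₁ - h₃ -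
    simp only [Inst.rename_inst, Bdry.instAux_actC_ren, Bdry.argTyAux_actC_ren] at *
    exact h.eqn_instAux hΓ₀ hΔ hρ hc M h₁ h₃

theorem RawTheory.EqInst.bdryConv {Γ : Ctx S μ n} {I I' : Inst S ν μ n} (h : T.EqInst Ξ Θ Γ I I')
    (hΓ : T.WfCtx Θ Γ) {BB : Bdry S ν c m 0} (hJ : T.Derives Ξ Ctx.nil (.bdry BB)) :
    T.BdryConv Θ Γ (BB.actC I) (BB.actC I') := by
  simp only [Bdry.actC_eq_msubst]
  exact (h.transports hΓ).eqInstances hJ ⟨hΓ, fun i => i.elim0, fun i => i.elim0, rfl, _,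
    Ctx.Ren.id Γ, (Inst.rename_id I).symm, (Inst.rename_id I').symm⟩

theorem RawTheory.BdryConv.judg_left {Γ : Ctx S μ n} {BB BB' : Bdry S μ c m n}
    (h : T.BdryConv Θ Γ BB BB') {e : Arg S μ c m n} (he : T.Derives Θ Γ (.judg BB' e))
    (hBB : T.Derives Θ Γ (.bdry BB)) : T.Derives Θ Γ (.judg BB e) := by
  induction h with
  | ty => exact he
  | tm h => exact .convTm he h.tySym
  | eqTy h₁ h₂ =>
    rw [Arg.eq_of_not_isObj (Cls.not_isObj_eqn .ty) e .starTy] at he ⊢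
    exact (h₁.tyTran he).tyTran h₂.tySym
  | eqTm h₁ h₂ h₃ =>
    rw [Arg.eq_of_not_isObj (Cls.not_isObj_eqn .tm) e .starTm] at he ⊢
    exact (h₁.tmTran (he.convEq h₃.tySym)).tmTran h₂.tmSym
  | abs h₁ _ ih =>
    obtain ⟨-, h₄⟩ := he.abs_inv
    obtain ⟨h₅, h₆⟩ := hBB.bdryAbs_inv
    rw [← e.abs_body]
    exact .abs h₅ (ih (h₄.snoc_conv h₁) h₆)

theorem Arg.msubst_mrename (e : Arg S ξ c m n) (ρ : MRen ξ ν)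
    (I : Inst S ν μ k) (σ : Fin n → Tm S μ k) :
    (e.mrename ρ).msubst I σ = e.msubst (fun α M => I α (ρ α M)) σ := by
  rw [Arg.mrename_eq_msubst, Arg.msubst_msubst, Inst.msubst_gen]
  rfl

theorem Bdry.msubst_mrename (BB : Bdry S ξ c m n) (ρ : MRen ξ ν)
    (I : Inst S ν μ k) (σ : Fin n → Tm S μ k) :
    (BB.mrename ρ).msubst I σ = BB.msubst (fun α M => I α (ρ α M)) σ := by
  rw [Bdry.mrename_eq_msubst, Bdry.msubst_msubst, Inst.msubst_gen]
  rfl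

/-- The restriction of an instantiation which forgets the last metavariable. -/
abbrev Inst.tail {α : MArity} (I : Inst S (α :: ν) μ n) : Inst S ν μ n :=
  fun β M => I β M.there

theorem MCtx.get_there_actC {α β : MArity} (BB : Bdry S ν α.cls α.bind 0) (M : MVar ν β)
    (I : Inst S (α :: ν) μ n) :
    ((Ξ.snoc BB).get M.there).actC I = (Ξ.get M).actC I.tail := by
  rw [Bdry.actC_eq_msubst, Bdry.actC_eq_msubst, MCtx.get, Bdry.msubst_mrename]

theorem MCtx.get_here_actC {α : MArity} (BB : Bdry S ν α.cls α.bind 0)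
    (I : Inst S (α :: ν) μ n) :
    ((Ξ.snoc BB).get MVar.here).actC I = BB.actC I.tail := by
  rw [Bdry.actC_eq_msubst, Bdry.actC_eq_msubst, MCtx.get, Bdry.msubst_mrename]

section Snoc

variable {α : MArity} {BB : Bdry S ν α.cls α.bind 0} {Γ : Ctx S μ n} {I I' : Inst S (α :: ν) μ n}

theorem RawTheory.DerivableInst.snoc (h : T.DerivableInst Ξ Θ Γ I.tail)
    (h' : T.Derives Θ Γ (.judg (BB.actC I.tail) (I α .here))) :
    T.DerivableInst (Ξ.snoc BB) Θ Γ I := by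
  rintro β (_ | M)
  · rw [MCtx.get_here_actC]
    exact h'
  · rw [MCtx.get_there_actC]
    exact h β M

theorem RawTheory.DerivableInst.tail (h : T.DerivableInst (Ξ.snoc BB) Θ Γ I) :
    T.DerivableInst Ξ Θ Γ I.tail := by
  intro β M
  rw [← MCtx.get_there_actC BB]
  exact h β M.there

theorem RawTheory.DerivableInst.head (h : T.DerivableInst (Ξ.snoc BB) Θ Γ I) :
    T.Derives Θ Γ (.judg (BB.actC I.tail) (I α .here)) := by
  rw [← MCtx.get_here_actC (Ξ := Ξ)]
  exact h α .here

theorem RawTheory.EqInst.snoc (hΓ : T.WfCtx Θ Γ) (hBB : T.Derives Ξ Ctx.nil (.bdry BB))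
    (h : T.EqInst Ξ Θ Γ I.tail I'.tail)
    (hI : T.Derives Θ Γ (.judg (BB.actC I.tail) (I α .here)))
    (heq : α.cls.IsObj →
      (T.Derives Θ Γ (.judg (BB.actC I'.tail) (I' α .here)) →
        T.Derives Θ Γ (.judg (BB.actC I.tail) (I' α .here))) →
      T.Derives Θ Γ (.eqn (BB.actC I.tail) (I α .here) (I' α .here))) :
    T.EqInst (Ξ.snoc BB) Θ Γ I I' := by
  have hconv := h.bdryConv hΓ hBB
  have hb := h.left.derives_bdry hΓ hBB
  have hb' := h.right.derives_bdry hΓ hBB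
  have h_eqn (hα : α.cls.IsObj) : T.Derives Θ Γ (.eqn (BB.actC I.tail) (I α .here) (I' α .here)) :=
    heq hα fun hI' => hconv.judg_left hI' hb
  have hI' : T.Derives Θ Γ (.judg (BB.actC I'.tail) (I' α .here)) := by
    by_cases hα : α.cls.IsObj
    · exact hconv.judg ((h_eqn hα).eqn_right hα hΓ) hb'
    · rw [Arg.eq_of_not_isObj hα (I' α .here) (I α .here)]
      exact hconv.judg hI hb'
  refine ⟨h.left.snoc hI, h.right.snoc hI', ?_⟩
  rintro β (_ | M) hβ
  · rw [MCtx.get_here_actC]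
    exact h_eqn hβ
  · rw [MCtx.get_there_actC]
    exact h.eq β M hβ

end Snoc

theorem RawTheory.EqInst.of_eq (hΞ : T.WfMCtx Ξ) {Γ : Ctx S μ n} (hΓ : T.WfCtx Θ Γ)
    {I I' : Inst S ν μ n} (hI : T.DerivableInst Ξ Θ Γ I)
    (h : ∀ (α : MArity) (M : MVar ν α), α.cls.IsObj →
      (T.Derives Θ Γ (.judg ((Ξ.get M).actC I') (I' α M)) →
        T.Derives Θ Γ (.judg ((Ξ.get M).actC I) (I' α M))) →
      T.Derives Θ Γ (.eqn ((Ξ.get M).actC I) (I α M) (I' α M))) :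
    T.EqInst Ξ Θ Γ I I' := by
  induction hΞ with
  | nil => exact ⟨hI, fun _ M => (nomatch M), fun _ M => (nomatch M)⟩
  | @snoc ν α Ξ BB _ hBB ih =>
    have h_tail : T.EqInst Ξ Θ Γ I.tail I'.tail := ih hI.tail fun β M hβ => by
      simpa only [MCtx.get_there_actC] using h β M.there hβ
    exact h_tail.snoc hΓ hBB hI.head fun hα => by
      simpa only [MCtx.get_here_actC] using h α .here hα

end Instantiation

/-! ### Inversion of applications -/

section AppInversion

variable {S : Signature.{u}} {T : RawTheory.{u, v} S} {μ : List MArity} {c : Cls}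
  {m n : ℕ} {Θ : MCtx S μ}

/-- If `e` is the application of a symbol or of a metavariable, its arguments are derivable and `B`
is equal to the boundary which the rule of that symbol or metavariable assigns to it. -/
def RawTheory.WfApp (T : RawTheory.{u, v} S) (Θ : MCtx S μ) :
    {c : Cls} → {m n : ℕ} → Ctx S μ n → Bdry S μ c m n → Arg S μ c m n → Prop
  | _, _, _, Γ, B, .sym f es => ∀ (Ξ : MCtx S (S.arity f)) (B₀ : Bdry S (S.arity f) _ 0 0),
      T.IsRuleFor f Ξ B₀ → T.DerivableInst Ξ Θ Γ es ∧ T.BdryConv Θ Γ (B₀.actC es) B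
  | _, _, _, Γ, B, .mvar _ M ts =>
      (∀ j, T.Derives Θ Γ (.judg (.tm ((Θ.get M).argTy ts j)) (ts j))) ∧
        T.BdryConv Θ Γ ((Θ.get M).inst ts) B
  | _, _, _, _, _, .var _ | _, _, _, _, _, .starTy | _, _, _, _, _, .starTm
  | _, _, _, _, _, .abs _ => True

/-- `RawTheory.WfApp` for the head and the boundary of a judgement. -/
def RawTheory.WfAppStmt (T : RawTheory.{u, v} S) (Θ : MCtx S μ) (Γ : Ctx S μ n) :
    Stmt S μ c m n → Prop
  | .judg BB e => T.WfApp Θ Γ BB e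
  | .bdry _ => True

theorem RawTheory.WfApp.of_not_isObj (hc : ¬ c.IsObj) (Γ : Ctx S μ n) (BB : Bdry S μ c m n)
    (e : Arg S μ c m n) : T.WfApp Θ Γ BB e := by
  cases e with
  | var => trivial
  | sym f => exact absurd (S.isObj f) hc
  | mvar h => exact absurd h hc
  | starTy => trivial
  | starTm => trivial
  | abs => trivial

theorem RawTheory.BdryConv.trans_tm {Γ : Ctx S μ n} {B : Bdry S μ .tm 0 n} {A A' : Ty S μ n}
    (h : T.BdryConv Θ Γ B (.tm A)) (h' : T.Derives Θ Γ (.judg (.eqTy A A') .starTy)) :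
    T.BdryConv Θ Γ B (.tm A') := by
  cases h with
  | tm h => exact .tm (h.tyTran h')

theorem sym_genApp_actC (f : S.Sym c) (I : Inst S (S.arity f) μ n) :
    (Arg.sym f (genApp S) : Arg S (S.arity f) c 0 0).actC I = .sym f I := by
  rw [Arg.actC_eq_msubst]
  simp only [Arg.msubst, msubst_genApp]

theorem RawTheory.IsStandard.isRuleFor_unique (hT : T.IsStandard) {f : S.Sym c}
    {Ξ Ξ' : MCtx S (S.arity f)} {B B' : Bdry S (S.arity f) c 0 0} (h : T.IsRuleFor f Ξ B)
    (h' : T.IsRuleFor f Ξ' B') : Ξ' = Ξ ∧ B' = B := by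
  obtain ⟨i, hi⟩ := h
  obtain ⟨j, hj⟩ := h'
  have : i = j := (hT.existsUnique c f).unique ⟨Ξ, B, hi⟩ ⟨Ξ', B', hj⟩
  subst this
  rw [hi] at hj
  simp only [symbolRule, RawRule.mk.injEq, heq_eq_eq, true_and, and_true] at hj
  exact ⟨hj.1.symm, hj.2.symm⟩

theorem RawTheory.IsRuleFor.wfApp (hT : T.IsStandard) {f : S.Sym c} {Ξ : MCtx S (S.arity f)}
    {B : Bdry S (S.arity f) c 0 0} (hf : T.IsRuleFor f Ξ B) {Γ : Ctx S μ n}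
    {I : Inst S (S.arity f) μ n} (hI : T.DerivableInst Ξ Θ Γ I)
    (hB : T.Derives Θ Γ (.bdry (B.actC I))) :
    T.WfApp Θ Γ (B.actC I) ((symbolRule f Ξ B).head.actC I) := by
  change T.WfApp Θ Γ (B.actC I) (Arg.actC I (.sym f (genApp S)))
  rw [sym_genApp_actC]
  intro Ξ' B' hf'
  obtain ⟨rfl, rfl⟩ := hT.isRuleFor_unique hf hf'
  exact ⟨hI, .refl hB⟩

theorem RawTheory.Derives.wfAppStmt (hT : T.IsStandard) {Γ : Ctx S μ n} {J : Stmt S μ c m n}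
    (h : T.Derives Θ Γ J) : T.WfAppStmt Θ Γ J := by
  induction h with
  | @mvar n Γ c k M ts h₁ h₂ =>
    cases c with
    | ty => exact ⟨h₁, .refl h₂⟩
    | tm => exact ⟨h₁, .refl h₂⟩
    | eqTy => trivial
    | eqTm => trivial
  | @convTm n Γ t A B _ h ih =>
    cases t with
    | var => trivial
    | sym f es => exact fun Ξ B₀ hf => ⟨(ih Ξ B₀ hf).1, (ih Ξ B₀ hf).2.trans_tm h⟩
    | mvar hc M ts => exact ⟨ih.1, ih.2.trans_tm h⟩
  | @rule n Γ c i I h₁ h₂ =>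
    by_cases hc : c.IsObj
    · obtain ⟨f, Ξ, B, hi⟩ := hT.isSymbolRule c i hc
      have hf : T.IsRuleFor f Ξ B := ⟨i, hi⟩
      generalize T.rule i = R at *
      subst hi
      exact hf.wfApp hT h₁ h₂
    · exact RawTheory.WfApp.of_not_isObj hc _ _ _
  | _ => trivial

theorem RawTheory.Derives.wfApp (hT : T.IsStandard) {Γ : Ctx S μ n} {BB : Bdry S μ c m n}
    {e : Arg S μ c m n} (h : T.Derives Θ Γ (.judg BB e)) : T.WfApp Θ Γ BB e :=
  h.wfAppStmt hT

theorem RawTheory.IsRuleFor.finitary (hT : T.IsStandard) {f : S.Sym c}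
    {Ξ : MCtx S (S.arity f)} {B : Bdry S (S.arity f) c 0 0} (h : T.IsRuleFor f Ξ B) :
    T.WfMCtx Ξ ∧ T.Derives Ξ Ctx.nil (.bdry B) := by
  obtain ⟨i, hi⟩ := h
  have := hT.finitary c i
  rw [hi] at this
  exact this

theorem RawTheory.IsRuleFor.congr (hT : T.IsStandard) {f : S.Sym c}
    {Ξ : MCtx S (S.arity f)} {B : Bdry S (S.arity f) c 0 0} (h : T.IsRuleFor f Ξ B)
    {Γ : Ctx S μ n} (hΓ : T.WfCtx Θ Γ) {es ds : Inst S (S.arity f) μ n}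
    (he : T.EqInst Ξ Θ Γ es ds) : T.Derives Θ Γ (.eqn (B.actC es) (.sym f es) (.sym f ds)) := by
  have hB := he.bdryConv hΓ (h.finitary hT).2
  obtain ⟨i, hi⟩ := h
  rcases S.isObj f with rfl | rfl
  · rw [Stmt.eqn_ty]
    have congr := RawTheory.Derives.congrTy (T := T) (Θ := Θ) (Γ := Γ) i
    rw [hi] at congr
    rw [← sym_genApp_actC f es, ← sym_genApp_actC f ds]
    exact congr es ds he.left he.right he.eq
  · rw [Stmt.eqn_tm]
    have congr := RawTheory.Derives.congrTm (T := T) (Θ := Θ) (Γ := Γ) i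
    rw [hi] at congr
    rw [← sym_genApp_actC f es, ← sym_genApp_actC f ds]
    exact congr es ds he.left he.right he.eq hB.type

end AppInversion

/-! ### Promotion of variables to metavariables -/

section Promotion

variable {S : Signature.{u}} {T : RawTheory.{u, v} S} {μ ν ξ : List MArity} {c : Cls}
  {m n k : ℕ} {Θ : MCtx S μ}

theorem RawTheory.WfCtx.wfMCtx {Γ : Ctx S μ n} (h : T.WfCtx Θ Γ) : T.WfMCtx Θ := by
  induction h with
  | nil h => exact h
  | snoc _ _ ih => exact ih

theorem Bdry.mrename_mrename (BB : Bdry S ξ c m n) (ρ : MRen ξ ν)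
    (θ : MRen ν μ) :
    (BB.mrename ρ).mrename θ = BB.mrename (fun α M => θ α (ρ α M)) := by
  rw [Bdry.mrename_eq_msubst, Bdry.msubst_mrename, Bdry.mrename_eq_msubst]
  rfl

theorem MCtx.Ren.there {α : MArity} (Θ : MCtx S μ) (BB : Bdry S μ α.cls α.bind 0) :
    Θ.Ren (Θ.snoc BB) (fun _ => MVar.there) := fun _ _ => rfl

theorem MCtx.Ren.comp {Ξ : MCtx S ξ} {Φ : MCtx S ν} {ρ : MRen ξ ν}
    {θ : MRen ν μ} (h : Ξ.Ren Φ ρ) (h' : Φ.Ren Θ θ) :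
    Ξ.Ren Θ (fun α M => θ α (ρ α M)) := by
  intro α M
  rw [h', h, Bdry.mrename_mrename]

theorem RawTheory.Derives.mrename {Ξ : MCtx S ν} {ρ : MRen ν μ}
    (hρ : Ξ.Ren Θ ρ) {BB : Bdry S ν c m 0} {e : Arg S ν c m 0}
    (h : T.Derives Ξ Ctx.nil (.judg BB e)) :
    T.Derives Θ Ctx.nil (.judg (BB.mrename ρ) (e.mrename ρ)) := by
  rw [Bdry.mrename_eq_msubst, Arg.mrename_eq_msubst]
  exact h.msubst_gen hρ fun i => i.elim0

theorem RawTheory.Derives.mrename_bdry {Ξ : MCtx S ν} {ρ : MRen ν μ}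
    (hρ : Ξ.Ren Θ ρ) {BB : Bdry S ν c m 0} (h : T.Derives Ξ Ctx.nil (.bdry BB)) :
    T.Derives Θ Ctx.nil (.bdry (BB.mrename ρ)) := by
  rw [Bdry.mrename_eq_msubst]
  exact h.msubst_gen hρ fun i => i.elim0

theorem RawTheory.WfMCtx.get (h : T.WfMCtx Θ) {α : MArity} (M : MVar μ α) :
    T.Derives Θ Ctx.nil (.bdry (Θ.get M)) := by
  induction h with
  | nil => exact nomatch M
  | snoc _ h ih =>
    cases M with
    | here => exact h.mrename_bdry (MCtx.Ren.there _ _)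
    | there M => exact (ih M).mrename_bdry (MCtx.Ren.there _ _)

theorem Arg.msubst_closed (e : Arg S μ c m 0) (σ : Fin 0 → Tm S μ 0) : e.msubst Inst.idn σ = e := by
  rw [Subsingleton.elim σ Arg.var, Arg.msubst_idn_var]

theorem Arg.mrename_msubst (e : Arg S ξ c m n) (I : Inst S ξ ν 0) (σ : Fin n → Tm S ν 0)
    (ρ : MRen ν μ) :
    (e.msubst I σ).mrename ρ =
      e.msubst (fun α M => (I α M).mrename ρ) (fun i => (σ i).mrename ρ) := by
  simp only [Arg.mrename_eq_msubst, Arg.msubst_msubst]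
  rfl

theorem mrename_genApp {α : MArity} (M : MVar ν α) (ρ : MRen ν μ) :
    (genApp S α M : Arg S ν _ _ n).mrename ρ = genApp S α (ρ α M) := by
  rw [Arg.mrename_eq_msubst, msubst_genApp]
  rfl

theorem derivableInst_idn (h : T.WfMCtx Θ) : T.DerivableInst Θ Θ Ctx.nil Inst.idn := by
  intro α M
  have h' : (Θ.get M).actC Inst.idn = Θ.get M := by
    rw [Bdry.actC_eq_msubst, Subsingleton.elim Fin.elim0 Arg.var, Bdry.msubst_idn_var]
  rw [h']
  refine RawTheory.Derives.judg_of_instances (.nil h) (h.get M) fun k Δ ρ ts _ _ hts hb => ?_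
  rw [Subsingleton.elim (fun i => Arg.var (ρ i)) Fin.elim0] at hts hb ⊢
  have h₀ : (Inst.idn α M : Arg S μ _ _ 0).instAux Fin.elim0 ts = Arg.mapp M ts :=
    instAux_genApp _ _ _
  rw [h₀]
  exact .mvar M ts hts hb

/-- `Θ'` extends `Θ` by metavariables which stand for the variables of `Γ`: the inclusion of `Θ` in
`Θ'` is `ρ`, the substitution `τ` replaces variables by the new metavariables, and `D` turns the
latter back into variables. -/
structure RawTheory.IsPromotion (T : RawTheory.{u, v} S) (Θ : MCtx S μ) (Γ : Ctx S μ k)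
    (Θ' : MCtx S ν) (ρ : MRen μ ν) (τ : Fin k → Tm S ν 0)
    (D : Inst S ν μ k) : Prop where
  wf : T.WfMCtx Θ'
  ren : Θ.Ren Θ' ρ
  wfSubst : T.WfSubst Θ' Γ Ctx.nil (Inst.gen ρ) τ
  derivable : T.DerivableInst Θ' Θ Γ D
  incl : ∀ (α : MArity) (M : MVar μ α), D α (ρ α M) = genApp S α M
  vars : ∀ i, (τ i).msubst D Fin.elim0 = .var i

theorem RawTheory.IsPromotion.msubst_msubst {Γ : Ctx S μ k} {Θ' : MCtx S ν}
    {ρ : MRen μ ν} {τ : Fin k → Tm S ν 0} {D : Inst S ν μ k}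
    (h : T.IsPromotion Θ Γ Θ' ρ τ D) (e : Arg S μ c m k) :
    (e.msubst (Inst.gen ρ) τ).msubst D Fin.elim0 = e := by
  rw [Arg.msubst_msubst, Inst.msubst_gen, funext h.vars, funext fun α => funext (h.incl α)]
  exact e.msubst_idn_var

theorem rename_succ_msubst_gen_there {β : MArity} (e : Arg S μ c m k) (ρ : MRen μ ν)
    (τ : Fin k → Tm S ν 0) (t : Tm S (β :: ν) 0) :
    (e.rename Fin.succ).msubst (Inst.gen fun α M => (ρ α M).there)
        (Fin.cases t fun i => (τ i).mrename fun _ => MVar.there) =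
      (e.msubst (Inst.gen ρ) τ).mrename (fun _ => MVar.there) := by
  rw [rename_succ_msubst_finCases, Arg.mrename_msubst]
  congr 1
  funext α M
  exact (mrename_genApp (ρ α M) fun _ => MVar.there).symm

theorem Arg.msubst_wk (e : Arg S ν c m 0) (I : Inst S ν μ k) :
    e.msubst I.wk Fin.elim0 = (e.msubst I Fin.elim0).rename Fin.succ := by
  rw [Arg.rename_msubst]
  exact congrArg (fun σ => e.msubst I.wk σ) (Subsingleton.elim _ _)

theorem RawTheory.Derives.mapp_here {A : Ty S μ 0} (hA : T.Derives Θ Ctx.nil (.judg .ty A)) :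
    T.Derives (Θ.snoc (α := ⟨.tm, 0⟩) (.tm A)) Ctx.nil
      (.judg (.tm (A.mrename fun _ => MVar.there)) (Arg.mapp .here Fin.elim0)) := by
  have hB : ((Θ.snoc (α := ⟨.tm, 0⟩) (.tm A)).get MVar.here).inst
      (Fin.elim0 : Fin 0 → Tm S _ 0) = .tm (A.mrename fun _ => MVar.there) := by
    rw [Bdry.inst, Bdry.instAux_zero]
    exact congrArg Bdry.tm (Arg.msubst_closed _ _)
  rw [← hB]
  refine .mvar _ _ (fun j => j.elim0) ?_
  rw [hB]
  exact .bdryTm (hA.mrename (MCtx.Ren.there _ _))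

theorem RawTheory.DerivableInst.wk {Ξ : MCtx S ν} {Γ : Ctx S μ k} {I : Inst S ν μ k}
    (h : T.DerivableInst Ξ Θ Γ I) (A : Ty S μ k) : T.DerivableInst Ξ Θ (Γ.snoc A) I.wk := by
  intro α M
  have := (h α M).weaken A
  rw [Bdry.rename_eq_msubst, Bdry.msubst_actC] at this
  convert this using 3
  · funext β N
    exact (Arg.rename_eq_subst _ _).trans (Arg.subst_eq_msubst _ _)
  · rfl

theorem RawTheory.IsPromotion.snoc {Γ : Ctx S μ k} {Θ' : MCtx S ν}
    {ρ : MRen μ ν} {τ : Fin k → Tm S ν 0} {D : Inst S ν μ k}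
    (h : T.IsPromotion Θ Γ Θ' ρ τ D) {A : Ty S μ k} (hA : T.Derives Θ Γ (.judg .ty A)) :
    T.IsPromotion Θ (Γ.snoc A) (Θ'.snoc (α := ⟨.tm, 0⟩) (.tm (A.msubst (Inst.gen ρ) τ)))
      (fun α M => (ρ α M).there)
      (Fin.cases (Arg.mapp .here Fin.elim0) (fun i => (τ i).mrename (fun _ => MVar.there)))
      (D.wk.cons (.var 0)) where
  wf := .snoc h.wf (.bdryTm (hA.msubst_gen h.ren h.wfSubst))
  ren := h.ren.comp (MCtx.Ren.there _ _)
  wfSubst i := by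
    cases i using Fin.cases with
    | zero =>
      rw [Ctx.get_zero, rename_succ_msubst_gen_there]
      exact .mapp_here (hA.msubst_gen h.ren h.wfSubst)
    | succ i =>
      rw [Ctx.get_succ, rename_succ_msubst_gen_there]
      exact (h.wfSubst i).mrename (MCtx.Ren.there _ _)
  derivable := by
    have h_var : T.Derives Θ (Γ.snoc A)
        (.judg (.tm ((A.msubst (Inst.gen ρ) τ).actC D.wk)) (.var 0)) := by
      rw [Arg.actC_eq_msubst, Arg.msubst_wk, h.msubst_msubst]
      exact .var 0
    exact (h.derivable.wk A).snoc h_var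
  incl α M := by
    change (D α (ρ α M)).rename Fin.succ = _
    rw [h.incl, Arg.rename_eq_subst, subst_genApp]
  vars i := by
    cases i using Fin.cases with
    | zero =>
      simp only [Fin.cases_zero, Arg.msubst_mapp]
      rfl
    | succ i =>
      simp only [Fin.cases_succ, Arg.msubst_mrename]
      exact (Arg.msubst_wk _ _).trans (congrArg (Arg.rename Fin.succ) (h.vars i))

theorem RawTheory.WfCtx.exists_promotion {Γ : Ctx S μ k} (hΓ : T.WfCtx Θ Γ) :
    ∃ (ν : List MArity) (Θ' : MCtx S ν) (ρ : MRen μ ν)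
      (τ : Fin k → Tm S ν 0) (D : Inst S ν μ k), T.IsPromotion Θ Γ Θ' ρ τ D := by
  induction hΓ with
  | nil h =>
    exact ⟨μ, Θ, fun _ M => M, Fin.elim0, Inst.idn, h, MCtx.Ren.id Θ, fun i => i.elim0,
      derivableInst_idn h, fun _ _ => rfl, fun i => i.elim0⟩
  | snoc _ hA ih =>
    obtain ⟨ν, Θ', ρ, τ, D, h⟩ := ih
    exact ⟨_, _, _, _, _, h.snoc hA⟩

end Promotion

/-! ### The equational residue -/

section Residue

variable {S : Signature.{u}} {μ ν ξ : List MArity} {k : ℕ}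

/-- Extension of an instantiation of the metavariables in `μ` to those of the residue `resAr μ ν`,
by dummy arguments for the equational metavariables in `ν`. -/
def Inst.extendResidue (K : Inst S μ ξ k) : (ν : List MArity) → Inst S (resAr μ ν) ξ k
  | [], α, M => K α M
  | ⟨.ty, _⟩ :: ν, α, M => K.extendResidue ν α M
  | ⟨.tm, _⟩ :: ν, α, M => K.extendResidue ν α M
  | ⟨.eqTy, m⟩ :: _, _, .here => Arg.dummy .ty m
  | ⟨.eqTy, _⟩ :: ν, α, .there M => K.extendResidue ν α M
  | ⟨.eqTm, m⟩ :: _, _, .here => Arg.dummy .tm m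
  | ⟨.eqTm, _⟩ :: ν, α, .there M => K.extendResidue ν α M

theorem Inst.extendResidue_resIncl (K : Inst S μ ξ k) (ν : List MArity) {α : MArity}
    (M : MVar μ α) : K.extendResidue ν α (resIncl ν α M) = K α M := by
  induction ν with
  | nil => rfl
  | cons β ν ih =>
    obtain ⟨_ | _, k⟩ := β <;> exact ih

theorem Inst.extendResidue_comp_resIncl (K : Inst S μ ξ k) (ν : List MArity) :
    (fun α M => K.extendResidue ν α (resIncl ν α M)) = K := by
  funext α M
  exact K.extendResidue_resIncl ν M

theorem residue_get_cases (Θ : MCtx S μ) {ν : List MArity} (Ξ : MCtx S ν) (I : Inst S ν μ 0)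
    {α : MArity} (M : MVar (resAr μ ν) α) :
    (∃ N : MVar μ α, M = resIncl ν α N ∧
      (residue Θ Ξ I).get M = (Θ.get N).mrename (resIncl ν)) ∨
    (∃ N : MVar ν α, ¬ α.cls.IsObj ∧
      (residue Θ Ξ I).get M = ((Ξ.get N).actC I).mrename (resIncl ν)) := by
  induction Ξ with
  | nil => exact .inl ⟨M, rfl, MCtx.Ren.id Θ α M⟩
  | @snoc ν β Ξ BB ih =>
    obtain ⟨d, k⟩ := β
    cases d with
    | ty | tm =>
      refine (ih I.tail M).imp_right fun ⟨N, hα, hN⟩ => ⟨N.there, hα, ?_⟩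
      rw [MCtx.get_there_actC]
      exact hN
    | eqTy | eqTm =>
      cases M with
      | here =>
        refine .inr ⟨.here, (by rintro (h | h) <;> cases h), ?_⟩
        rw [MCtx.get_here_actC]
        exact Bdry.mrename_mrename _ _ _
      | there M =>
        rcases ih I.tail M with ⟨N, rfl, hN⟩ | ⟨N, hα, hN⟩
        · exact .inl ⟨N, rfl, (congrArg (Bdry.mrename fun _ => MVar.there) hN).trans
            (Bdry.mrename_mrename _ _ _)⟩
        · refine .inr ⟨N.there, hα, ?_⟩
          rw [MCtx.get_there_actC]
          exact (congrArg (Bdry.mrename fun _ => MVar.there) hN).trans (Bdry.mrename_mrename _ _ _)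

end Residue

/-! ### Use of object-invertible rules -/

section ObjectInvertible

variable {S : Signature.{u}} {T : RawTheory.{u, v} S} {μ ν ξ : List MArity} {c : Cls}
  {m n k l : ℕ} {Θ : MCtx S μ}

/-- Every instance of an equational premise of `Ξ`, instantiated by `I`, is derivable as soon as its
boundary is. The instances are over arbitrary variable contexts, not only the ambient one of `I`, so
that the property is stable under substitution. -/
def RawTheory.EqPremisesHold (T : RawTheory.{u, v} S) (Ξ : MCtx S ν) (Θ : MCtx S μ)
    (I : Inst S ν μ n) : Prop :=
  ∀ (α : MArity) (N : MVar ν α), ¬ α.cls.IsObj → ∀ (l : ℕ) (Δ : Ctx S μ l) (τ : Fin n → Tm S μ l)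
    (ts : Fin α.bind → Tm S μ l) (e : Arg S μ α.cls 0 l), T.WfCtx Θ Δ →
    T.Derives Θ Δ (.bdry (((Ξ.get N).actC I).instAux τ ts)) →
    T.Derives Θ Δ (.judg (((Ξ.get N).actC I).instAux τ ts) e)

theorem Inst.subst_subst (I : Inst S ν μ n) (σ : Fin n → Tm S μ k) (τ : Fin k → Tm S μ l) :
    (I.subst σ).subst τ = I.subst (fun i => (σ i).subst τ) := by
  funext α M
  exact Arg.subst_subst _ _ _

theorem Bdry.instAux_actC_subst (BB : Bdry S ν c m 0) (I : Inst S ν μ n) (σ : Fin n → Tm S μ k)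
    (τ : Fin k → Tm S μ l) (ts : Fin m → Tm S μ l) :
    (BB.actC (I.subst σ)).instAux τ ts =
      (BB.actC I).instAux (fun i => (σ i).subst τ) ts := by
  rw [Bdry.instAux_actC, Bdry.instAux_actC, Inst.subst_subst]

theorem RawTheory.EqPremisesHold.subst {Ξ : MCtx S ν} {I : Inst S ν μ n}
    (h : T.EqPremisesHold Ξ Θ I) (σ : Fin n → Tm S μ k) : T.EqPremisesHold Ξ Θ (I.subst σ) := by
  intro α N hα l Δ τ ts e hΔ
  rw [Bdry.instAux_actC_subst]
  exact h α N hα l Δ _ ts e hΔ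

theorem Bdry.actC_mrename (BB : Bdry S ξ c m 0) (ρ : MRen ξ ν)
    (I : Inst S ν μ n) : (BB.mrename ρ).actC I = BB.actC (fun α M => I α (ρ α M)) := by
  rw [Bdry.actC_eq_msubst, Bdry.actC_eq_msubst, Bdry.msubst_mrename]

theorem Arg.actC_mrename (e : Arg S ξ c m 0) (ρ : MRen ξ ν)
    (I : Inst S ν μ n) : (e.mrename ρ).actC I = e.actC (fun α M => I α (ρ α M)) := by
  rw [Arg.actC_eq_msubst, Arg.actC_eq_msubst, Arg.msubst_mrename]

theorem Bdry.actC_actC (BB : Bdry S ξ c m 0) (J : Inst S ξ ν 0) (I : Inst S ν μ n) :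
    (BB.actC J).actC I = BB.actC (J.msubst I Fin.elim0) := by
  rw [Bdry.actC_eq_msubst (BB.actC J), Bdry.msubst_actC]

theorem RawTheory.Admissible.extendResidue {Θ' : MCtx S ξ} {Γ : Ctx S μ n} {K : Inst S ξ μ n}
    (hK : T.Admissible Θ' Θ Γ K) (Ξ : MCtx S ν) (J : Inst S ν ξ 0)
    (hE : T.EqPremisesHold Ξ Θ (J.msubst K Fin.elim0)) :
    T.Admissible (residue Θ' Ξ J) Θ Γ (K.extendResidue ν) := by
  intro k Δ ρ hΔ hρ
  obtain ⟨h_inst, h_eqTy, h_eqTm⟩ := hK k Δ ρ hΔ hρ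
  simp only [Inst.rename_inst, Bdry.instAux_actC_ren, Bdry.argTyAux_actC_ren]
    at h_inst h_eqTy h_eqTm
  constructor
  · intro c m M ts
    simp only [Inst.rename_inst, Bdry.instAux_actC_ren, Bdry.argTyAux_actC_ren]
    rcases residue_get_cases Θ' Ξ J M with ⟨N, rfl, hN⟩ | ⟨N, hα, hN⟩
    · rw [hN, Bdry.actC_mrename, K.extendResidue_comp_resIncl, K.extendResidue_resIncl]
      exact h_inst N ts
    · rw [hN, Bdry.actC_mrename, K.extendResidue_comp_resIncl, Bdry.actC_actC]
      exact fun _ hb => hE _ N hα k Δ _ ts _ hΔ hb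
  · intro m M ss ts
    simp only [Inst.rename_inst, Bdry.argTyAux_actC_ren]
    rcases residue_get_cases Θ' Ξ J M with ⟨N, rfl, hN⟩ | ⟨_, hα, _⟩
    · rw [hN, Bdry.actC_mrename, K.extendResidue_comp_resIncl, K.extendResidue_resIncl]
      exact h_eqTy N ss ts
    · exact absurd (Or.inl rfl) hα
  · intro m M ss ts
    simp only [Inst.rename_inst, Bdry.instAux_actC_ren, Bdry.argTyAux_actC_ren]
    rcases residue_get_cases Θ' Ξ J M with ⟨N, rfl, hN⟩ | ⟨_, hα, _⟩
    · rw [hN, Bdry.actC_mrename, K.extendResidue_comp_resIncl, K.extendResidue_resIncl]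
      exact h_eqTm N ss ts
    · exact absurd (Or.inr rfl) hα

theorem residualInst_msubst_extendResidue (J : Inst S ν ξ 0) (K : Inst S ξ μ n) :
    (residualInst J).msubst (K.extendResidue ν) Fin.elim0 = J.msubst K Fin.elim0 := by
  have h_obj (α : MArity) (M : MVar ν α) :
      ((J α M).mrename (resIncl ν)).msubst (K.extendResidue ν) Fin.elim0 =
        (J α M).msubst K Fin.elim0 := by
    rw [Arg.msubst_mrename, K.extendResidue_comp_resIncl]
  funext α M
  obtain ⟨d, k⟩ := α
  cases d with
  | ty | tm => exact h_obj _ M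
  | eqTy => exact Arg.eq_of_not_isObj Cls.not_isObj_eqTy _ _
  | eqTm => exact Arg.eq_of_not_isObj Cls.not_isObj_eqTm _ _

/-- Object-invertibility only speaks of the empty variable context, so the variables in `Γ` are
first promoted to metavariables, and the resulting derivations are then instantiated back. -/
theorem RawTheory.ObjectInvertible.derivableInst {R : RawRule S c} (hR : T.ObjectInvertible R)
    {Γ : Ctx S μ n} (hΓ : T.WfCtx Θ Γ) {I : Inst S R.ar μ n}
    (h : T.Derives Θ Γ (.judg (R.bdry.actC I) (R.head.actC I)))
    (hE : T.EqPremisesHold R.prem Θ I) : T.DerivableInst R.prem Θ Γ I := by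
  obtain ⟨ξ, Θ', ρ, τ, K, hp⟩ := hΓ.exists_promotion
  set J : Inst S R.ar ξ 0 := I.msubst (Inst.gen ρ) τ
  have hJK : J.msubst K Fin.elim0 = I := by
    funext α M
    exact hp.msubst_msubst (I α M)
  have h_promoted : T.Derives Θ' Ctx.nil (.judg (R.bdry.actC J) (R.head.actC J)) := by
    have h' := h.msubst_gen hp.ren hp.wfSubst
    rwa [Stmt.msubst, Bdry.msubst_actC, Arg.msubst_actC] at h'
  have h_residual := hR.2 ξ Θ' J hp.wf h_promoted
  have h_adm := hp.derivable.admissible.extendResidue R.prem J (by rwa [hJK])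
  have h_res : (residualInst J).msubst (K.extendResidue R.ar) Fin.elim0 = I :=
    (residualInst_msubst_extendResidue J K).trans hJK
  intro α M
  have h_arg := h_adm.derives hΓ (h_residual α M)
  rw [Stmt.msubst, Bdry.msubst_actC, h_res] at h_arg
  rwa [← congrFun (congrFun h_res α) M]

end ObjectInvertible

/-! ### Computation rules and extensionality rules are sound -/

section Rules

variable {S : Signature.{u}} {T : RawTheory.{u, v} S} {μ ν ξ : List MArity} {c : Cls}
  {m n k : ℕ} {Θ : MCtx S μ}

theorem Bdry.actC_eqn (BB : Bdry S ν c m 0) (e₁ e₂ : Arg S ν c m 0) (I : Inst S ν μ n) :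
    (BB.eqn e₁ e₂).actC I = (BB.actC I).eqn (e₁.actC I) (e₂.actC I) := by
  simp only [Bdry.actC_eq_msubst, Arg.actC_eq_msubst, Bdry.msubst_eqn]

theorem RawTheory.DerivableInst.derives_eqn {Ξ : MCtx S ν} {Γ : Ctx S μ n} {I : Inst S ν μ n}
    (h : T.DerivableInst Ξ Θ Γ I) (hΓ : T.WfCtx Θ Γ) {BB : Bdry S ν c m 0}
    {e₁ e₂ : Arg S ν c m 0} (hJ : T.Derives Ξ Ctx.nil (.eqn BB e₁ e₂)) :
    T.Derives Θ Γ (.eqn (BB.actC I) (e₁.actC I) (e₂.actC I)) := by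
  have := h.derives_judg hΓ hJ
  rwa [Bdry.actC_eqn, Arg.eq_of_not_isObj c.not_isObj_eqn (Arg.actC _ _) (Arg.dummy c m)] at this

theorem Arg.actC_sym (f : S.Sym c) (es : Inst S (S.arity f) ν 0) (I : Inst S ν μ n) :
    (Arg.sym f es).actC I = .sym f (es.msubst I Fin.elim0) := by
  rw [Arg.actC_eq_msubst]
  rfl

theorem RawTheory.IsComputationRule.derives_eqn_ty {R : Rewrite S .ty}
    (hR : T.IsComputationRule R) {Γ : Ctx S μ n} (hΓ : T.WfCtx Θ Γ) {I : Inst S R.ar μ n}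
    (hE : T.EqPremisesHold R.prem Θ I) {B : Bdry S μ .ty 0 n}
    (h : T.Derives Θ Γ (.judg B (R.lhs.actC I))) :
    T.Derives Θ Γ (.eqn B (R.lhs.actC I) (R.rhs.actC I)) := by
  obtain ⟨h_rule, -, -, h_inv⟩ := hR
  rw [Bdry.eq_ty B] at h ⊢
  have h_eqn := (h_inv.derivableInst hΓ h hE).derives_eqn hΓ (BB := R.bdry) h_rule
  rwa [Bdry.eq_ty (R.bdry.actC I)] at h_eqn

/-- Inversion gives an instance of the left-hand side its natural type, at which
object-invertibility applies; that type is convertible both to the given type and to the type of the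
rule. -/
theorem RawTheory.IsComputationRule.derives_eqn_tm (hT : T.IsStandard) {R : Rewrite S .tm}
    (hR : T.IsComputationRule R) {Γ : Ctx S μ n} (hΓ : T.WfCtx Θ Γ) {I : Inst S R.ar μ n}
    (hE : T.EqPremisesHold R.prem Θ I) {B : Bdry S μ .tm 0 n}
    (h : T.Derives Θ Γ (.judg B (R.lhs.actC I))) :
    T.Derives Θ Γ (.eqn B (R.lhs.actC I) (R.rhs.actC I)) := by
  obtain ⟨h_rule, ⟨hprem, -⟩, ⟨f, es, hlhs⟩, A, hA, -, h_inv⟩ := hR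
  rw [hlhs] at hA
  cases hA with
  | sym f es Ξ B₀ hf =>
  have h_tm : (B₀.actC es).actC I = (Bdry.tm (B₀.actC es).type).actC I := by
    conv_lhs => rw [Bdry.eq_tm (B₀.actC es)]
  have h_conv : T.BdryConv Θ Γ ((B₀.actC es).actC I) B := by
    rw [hlhs, Arg.actC_sym] at h
    rw [Bdry.actC_actC]
    exact (h.wfApp hT Ξ B₀ hf).2
  have h_bdry : T.Derives Θ Γ (.bdry ((B₀.actC es).actC I)) := by
    rw [Bdry.eq_tm ((B₀.actC es).actC I)]
    exact .bdryTm (h_conv.type.presup hΓ).bdryEqTy_inv.1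
  have h_natural := h_conv.judg_left h h_bdry
  rw [h_tm] at h_natural
  have hI := h_inv.derivableInst hΓ h_natural hE
  have h_ruleType : T.BdryConv Θ Γ ((B₀.actC es).actC I) (R.bdry.actC I) := by
    have h_lhs := RawTheory.Derives.eqn_left (Or.inr rfl) (BB := R.bdry) h_rule (.nil hprem)
    rw [hlhs] at h_lhs
    rw [h_tm, Bdry.eq_tm R.bdry]
    exact .tm (hI.derives_judg hΓ (h_lhs.wfApp hT Ξ B₀ hf).2.type)
  exact h_conv.eqn_right (Or.inr rfl) (h_ruleType.eqn_left (Or.inr rfl)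
    (hI.derives_eqn hΓ (BB := R.bdry) h_rule))

theorem RawTheory.IsComputationRule.derives_eqn (hT : T.IsStandard) (hc : c.IsObj)
    {R : Rewrite S c} (hR : T.IsComputationRule R) {Γ : Ctx S μ n} (hΓ : T.WfCtx Θ Γ)
    {I : Inst S R.ar μ n} (hE : T.EqPremisesHold R.prem Θ I) {B : Bdry S μ c 0 n}
    (h : T.Derives Θ Γ (.judg B (R.lhs.actC I))) :
    T.Derives Θ Γ (.eqn B (R.lhs.actC I) (R.rhs.actC I)) := by
  rcases hc with rfl | rfl
  · exact hR.derives_eqn_ty hΓ hE h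
  · exact hR.derives_eqn_tm hT hΓ hE h

theorem EqPrem.extend_incl (Φ : EqPrem S ν ξ) (I : Inst S ν μ n) {α : MArity} (M : MVar ν α) :
    Φ.extend I α (Φ.incl α M) = I α M := by
  induction Φ with
  | nil => rfl
  | snoc _ _ _ ih => exact ih

theorem EqPrem.extend_comp_incl (Φ : EqPrem S ν ξ) (I : Inst S ν μ n) :
    (fun α M => Φ.extend I α (Φ.incl α M)) = I := by
  funext α M
  exact Φ.extend_incl I M

theorem EqPrem.subst_extend (Φ : EqPrem S ν ξ) (I : Inst S ν μ n) (σ : Fin n → Tm S μ k) :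
    (Φ.extend I).subst σ = Φ.extend (I.subst σ) := by
  induction Φ with
  | nil => rfl
  | snoc Φ hα _ ih =>
    funext β M
    cases M with
    | here => exact Arg.eq_of_not_isObj hα _ _
    | there M => exact congrFun (congrFun ih β) M

theorem Inst.subst_cons (I : Inst S ν μ n) (t : Tm S μ n) (σ : Fin n → Tm S μ k) :
    (I.cons t).subst σ = (I.subst σ).cons (t.subst σ) := by
  funext β M
  cases M <;> rfl

theorem RawTheory.EqPremisesHold.tail {α : MArity} {Ξ : MCtx S ν} {BB : Bdry S ν α.cls α.bind 0}
    {I : Inst S (α :: ν) μ n} (h : T.EqPremisesHold (Ξ.snoc BB) Θ I) :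
    T.EqPremisesHold Ξ Θ I.tail := by
  intro β N hβ l Δ τ ts e hΔ
  rw [← MCtx.get_there_actC BB]
  exact h β N.there hβ l Δ τ ts e hΔ

theorem RawTheory.EqPremisesHold.of_extend {Ξ : MCtx S ν} (Φ : EqPrem S ν ξ) {I : Inst S ν μ n}
    (h : T.EqPremisesHold (Φ.append Ξ) Θ (Φ.extend I)) : T.EqPremisesHold Ξ Θ I := by
  induction Φ with
  | nil => exact h
  | snoc Φ _ _ ih => exact ih h.tail

theorem RawTheory.DerivableInst.extend (Φ : EqPrem S ν ξ) {Ξ : MCtx S ν}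
    (hΞ : T.WfMCtx (Φ.append Ξ)) {Γ : Ctx S μ n} (hΓ : T.WfCtx Θ Γ) {I : Inst S ν μ n}
    (hI : T.DerivableInst Ξ Θ Γ I) (hE : T.EqPremisesHold (Φ.append Ξ) Θ (Φ.extend I)) :
    T.DerivableInst (Φ.append Ξ) Θ Γ (Φ.extend I) := by
  induction Φ with
  | nil => exact hI
  | @snoc ξ α Φ hα BB ih =>
    cases hΞ with
    | snoc hΞ hBB =>
    have h_tail := ih hΞ hE.tail
    refine h_tail.snoc (RawTheory.Derives.judg_of_instances hΓ (h_tail.derives_bdry hΓ hBB)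
      fun k Δ ρ ts hΔ _ _ hb => ?_)
    have h_here := fun e => hE α .here hα k Δ (fun i => .var (ρ i)) ts e hΔ
    simp only [EqPrem.append, MCtx.get_here_actC] at h_here
    exact h_here _ hb

theorem Arg.actC_mapp_elim0 (M : MVar ν ⟨c, 0⟩) (I : Inst S ν μ n) :
    (Arg.mapp M Fin.elim0 : Arg S ν c 0 0).actC I = I _ M := by
  rw [Arg.actC_eq_msubst, Arg.msubst_mapp]
  exact Arg.subst_var _

theorem ExtRule.bdry_actC_extend (R : ExtRule S) (I : Inst S R.ar μ n) (s t : Tm S μ n) :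
    R.rule.bdry.actC (R.eqs.extend ((I.cons s).cons t)) = .eqTm s t (R.type.actC I) := by
  have h_mapp (M : MVar _ ⟨.tm, 0⟩) :
      (Arg.mapp (R.eqs.incl ⟨.tm, 0⟩ M) Fin.elim0).actC (R.eqs.extend ((I.cons s).cons t)) =
        ((I.cons s).cons t) _ M :=
    (Arg.actC_mapp_elim0 _ _).trans (R.eqs.extend_incl _ _)
  have h_type : (R.type.mrename (fun α M => R.eqs.incl α (.there (.there M)))).actC
      (R.eqs.extend ((I.cons s).cons t)) = R.type.actC I := by
    rw [Arg.actC_mrename]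
    exact congrArg (fun J => R.type.actC fun α M => J α (.there (.there M)))
      (R.eqs.extend_comp_incl ((I.cons s).cons t))
  change Bdry.eqTm (Arg.actC _ _) (Arg.actC _ _) (Arg.actC _ _) = _
  rw [h_mapp, h_mapp, h_type]
  rfl

theorem RawTheory.IsExtensionalityRule.derives_eqTm {R : ExtRule S}
    (hR : T.IsExtensionalityRule R) {Γ : Ctx S μ n} (hΓ : T.WfCtx Θ Γ) {I : Inst S R.ar μ n}
    {s t : Tm S μ n} (hE : T.EqPremisesHold R.premAll Θ (R.eqs.extend ((I.cons s).cons t)))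
    (hs : T.Derives Θ Γ (.judg (.tm (R.type.actC I)) s))
    (ht : T.Derives Θ Γ (.judg (.tm (R.type.actC I)) t)) :
    T.Derives Θ Γ (.judg (.eqTm s t (R.type.actC I)) .starTm) := by
  obtain ⟨h_rule, ⟨hprem, -⟩, -, h_inv⟩ := hR
  have hI : T.DerivableInst R.prem Θ Γ I :=
    h_inv.derivableInst hΓ (hs.presup hΓ).bdryTm_inv (hE.of_extend R.eqs).tail.tail
  have ht' :
      T.Derives Θ Γ (.judg (.tm ((R.type.mrename fun _ => MVar.there).actC (I.cons s))) t) := by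
    rw [Arg.actC_mrename]
    exact ht
  have h_all := ((hI.snoc hs).snoc ht').extend R.eqs hprem hΓ hE
  have h_eqn := h_all.derives_judg hΓ h_rule
  rw [R.bdry_actC_extend] at h_eqn
  exact h_eqn

end Rules

/-! ### Soundness of the algorithm -/

section Soundness

variable {S : Signature.{u}} {T : RawTheory.{u, v} S} {μ ν : List MArity} {c : Cls}
  {m n k l : ℕ} {Θ : MCtx S μ}

/-- The phases which compare two expressions presupposed to be derivable. -/
def Phase.IsCheck : Phase → Prop
  | .norm => False
  | .normP => False
  | .normC => False
  | .check => True
  | .checkE => True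
  | .checkN => True

/-- All instances of `BB[e₁ ≡ e₂]` are derivable whenever those of `BB[e₁]` (and of `BB[e₂]`, if `b`
holds) are. -/
def RawTheory.SoundAt (T : RawTheory.{u, v} S) (Θ : MCtx S μ) (b : Prop) (BB : Bdry S μ c m n)
    (e₁ e₂ : Arg S μ c m n) : Prop :=
  c.IsObj → ∀ (k : ℕ) (Δ : Ctx S μ k) (σ : Fin n → Tm S μ k) (ts : Fin m → Tm S μ k),
    T.WfCtx Θ Δ → T.Derives Θ Δ (.judg (BB.instAux σ ts) (e₁.instAux σ ts)) →
    (b → T.Derives Θ Δ (.judg (BB.instAux σ ts) (e₂.instAux σ ts))) →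
    T.Derives Θ Δ (.eqn (BB.instAux σ ts) (e₁.instAux σ ts) (e₂.instAux σ ts))

theorem RawTheory.SoundAt.actC_eqn {b : Prop} {BB : Bdry S ν c m 0} {I : Inst S ν μ n}
    {e₁ e₂ : Arg S μ c m n} (h : T.SoundAt Θ b (BB.actC I) e₁ e₂) (hc : c.IsObj)
    {Δ : Ctx S μ k} (hΔ : T.WfCtx Θ Δ) (σ : Fin n → Tm S μ k)
    (h₁ : T.Derives Θ Δ (.judg (BB.actC (I.subst σ)) (e₁.subst σ)))
    (h₂ : b → T.Derives Θ Δ (.judg (BB.actC (I.subst σ)) (e₂.subst σ))) :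
    T.Derives Θ Δ (.eqn (BB.actC (I.subst σ)) (e₁.subst σ) (e₂.subst σ)) := by
  refine RawTheory.Derives.eqn_of_instances hc hΔ b h₁ h₂ fun l Δ' τ ts hΔ' => ?_
  simp only [Bdry.instAux_actC_subst, Arg.instAux_subst]
  exact h hc l Δ' _ ts hΔ'

theorem Bdry.exists_eqn {d : Cls} (hd : d.IsObj) (B : Bdry S ν d.eqn m n) :
    ∃ (BB : Bdry S ν d m n) (e₁ e₂ : Arg S ν d m n), B = BB.eqn e₁ e₂ := by
  rcases hd with rfl | rfl
  · induction m generalizing n with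
    | zero =>
      cases B with
      | eqTy A A' => exact ⟨.ty, A, A', rfl⟩
    | succ m ih =>
      cases B with
      | abs A B =>
        obtain ⟨BB, e₁, e₂, rfl⟩ := ih B
        exact ⟨.abs A BB, .abs e₁, .abs e₂, rfl⟩
  · induction m generalizing n with
    | zero =>
      cases B with
      | eqTm s t A => exact ⟨.tm A, s, t, rfl⟩
    | succ m ih =>
      cases B with
      | abs A B =>
        obtain ⟨BB, e₁, e₂, rfl⟩ := ih B
        exact ⟨.abs A BB, .abs e₁, .abs e₂, rfl⟩

theorem eqPremisesHold_of_soundAt {Ξ : MCtx S ν} {I : Inst S ν μ n}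
    (h : ∀ (d : Cls) (m : ℕ) (M : MVar ν ⟨d.eqn, m⟩) (BB : Bdry S ν d m 0) (e₁ e₂ : Arg S ν d m 0),
      d.IsObj → Ξ.get M = BB.eqn e₁ e₂ →
      T.SoundAt Θ True (BB.actC I) (e₁.actC I) (e₂.actC I)) : T.EqPremisesHold Ξ Θ I := by
  have h_eqn : ∀ (d : Cls) (m : ℕ) (M : MVar ν ⟨d.eqn, m⟩), d.IsObj → ∀ (l : ℕ) (Δ : Ctx S μ l)
      (τ : Fin n → Tm S μ l) (ts : Fin m → Tm S μ l) (e : Arg S μ d.eqn 0 l), T.WfCtx Θ Δ →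
      T.Derives Θ Δ (.bdry (((Ξ.get M).actC I).instAux τ ts)) →
      T.Derives Θ Δ (.judg (((Ξ.get M).actC I).instAux τ ts) e) := by
    intro d m M hd l Δ τ ts e hΔ hb
    obtain ⟨BB, e₁, e₂, hM⟩ := (Ξ.get M).exists_eqn hd
    rw [hM, Bdry.actC_eqn, Bdry.instAux_eqn] at hb ⊢
    obtain ⟨h₁, h₂⟩ := hb.eqn_bdry_inv hd
    rw [Arg.eq_of_not_isObj d.not_isObj_eqn e (Arg.dummy d 0)]
    exact h d m M BB e₁ e₂ hd hM hd l Δ τ ts hΔ h₁ fun _ => h₂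
  rintro ⟨_ | _, m⟩ N hα
  · exact absurd (Or.inl rfl) hα
  · exact absurd (Or.inr rfl) hα
  · exact h_eqn .ty m N (Or.inl rfl)
  · exact h_eqn .tm m N (Or.inr rfl)

theorem Arg.subst_actC (e : Arg S ν c m 0) (I : Inst S ν μ n) (σ : Fin n → Tm S μ k) :
    (e.actC I).subst σ = e.actC (I.subst σ) := by
  rw [Arg.actC_eq_msubst, Arg.subst_msubst, Arg.actC_eq_msubst]
  congr 1
  exact Subsingleton.elim _ _

theorem Bdry.subst_argTyAux (BB : Bdry S μ c m n) (σ : Fin n → Tm S μ k) (ts : Fin m → Tm S μ k)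
    (τ : Fin k → Tm S μ l) (j : Fin m) :
    (BB.argTyAux σ ts j).subst τ =
      BB.argTyAux (fun i => (σ i).subst τ) (fun j => (ts j).subst τ) j := by
  induction BB with
  | abs A BB ih =>
    cases j using Fin.cases <;>
      simp [Bdry.argTyAux, Arg.subst_subst, comp_finCases (Arg.subst τ), ih]
  | _ => exact j.elim0

theorem Bdry.subst_argTy (BB : Bdry S μ c m 0) (ts : Fin m → Tm S μ k) (τ : Fin k → Tm S μ l)
    (j : Fin m) : (BB.argTy ts j).subst τ = BB.argTy (fun j => (ts j).subst τ) j := by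
  rw [Bdry.argTy, Bdry.subst_argTyAux, Subsingleton.elim (fun i => _) Fin.elim0]
  rfl

theorem RawTheory.Derives.eqn_mvar (hΘ : T.WfMCtx Θ) {Γ : Ctx S μ n} (hΓ : T.WfCtx Θ Γ)
    (hc : c.IsObj) (M : MVar μ ⟨c, m⟩) {ss ts : Fin m → Tm S μ n}
    (hss : ∀ j, T.Derives Θ Γ (.judg (.tm ((Θ.get M).argTy ss j)) (ss j)))
    (hst : ∀ j, (T.Derives Θ Γ (.judg (.tm ((Θ.get M).argTy ts j)) (ts j)) →
        T.Derives Θ Γ (.judg (.tm ((Θ.get M).argTy ss j)) (ts j))) →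
      T.Derives Θ Γ (.judg (.eqTm (ss j) (ts j) ((Θ.get M).argTy ss j)) .starTm)) :
    T.Derives Θ Γ (.eqn ((Θ.get M).inst ss) (.mvar hc M ss) (.mvar hc M ts)) := by
  have hσ : T.EqSubst Θ Ctx.nil Γ Fin.elim0 Fin.elim0 :=
    ⟨fun i => i.elim0, fun i => i.elim0, fun i => i.elim0⟩
  obtain ⟨hts, heq⟩ := RawTheory.Fits.of_eq (hΘ.get M) hΓ hσ hss hst
  rcases hc with rfl | rfl
  · rw [Stmt.eqn_ty]
    exact .mvarCongrTy M ss ts hss hts heq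
  · rw [Stmt.eqn_tm]
    exact .mvarCongrTm M ss ts hss hts heq ((hΘ.get M).bdryConv_instAux hσ hss hts heq).type

namespace RawTheory.SoundAt

variable {b : Prop} {B : Bdry S μ c 0 n} {BB : Bdry S μ c m n} {e₁ e₂ e₃ : Arg S μ c m n}

theorem refl (b : Prop) (BB : Bdry S μ c m n) (e : Arg S μ c m n) : T.SoundAt Θ b BB e e :=
  fun hc _ _ _ _ _ h _ => h.eqn_refl hc

theorem abs {A : Ty S μ n} {BB : Bdry S μ c m (n + 1)} {e₁ e₂ : Arg S μ c m (n + 1)}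
    (h : T.SoundAt Θ b BB e₁ e₂) : T.SoundAt Θ b (.abs A BB) (.abs e₁) (.abs e₂) :=
  fun hc k Δ _ _ => h hc k Δ _ _

theorem trans (h₁ : T.SoundAt Θ False BB e₁ e₂) (h₂ : T.SoundAt Θ False BB e₂ e₃) :
    T.SoundAt Θ False BB e₁ e₃ := by
  intro hc k Δ σ ts hΔ he₁ _
  have h_eqn := h₁ hc k Δ σ ts hΔ he₁ False.elim
  exact h_eqn.eqn_trans hc (h₂ hc k Δ σ ts hΔ (h_eqn.eqn_right hc hΔ) False.elim)

theorem of_norm {d₁ d₂ : Arg S μ c m n} (h₁ : T.SoundAt Θ False BB e₁ d₁)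
    (h₂ : T.SoundAt Θ False BB e₂ d₂) (h : T.SoundAt Θ True BB d₁ d₂) :
    T.SoundAt Θ True BB e₁ e₂ := by
  intro hc k Δ σ ts hΔ he₁ he₂
  have h_eqn₁ := h₁ hc k Δ σ ts hΔ he₁ False.elim
  have h_eqn₂ := h₂ hc k Δ σ ts hΔ (he₂ trivial) False.elim
  have h_eqn := h hc k Δ σ ts hΔ (h_eqn₁.eqn_right hc hΔ) fun _ => h_eqn₂.eqn_right hc hΔ
  exact (h_eqn₁.eqn_trans hc h_eqn).eqn_trans hc (h_eqn₂.eqn_symm hc)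

theorem conv {A A' : Ty S μ n} {s t : Tm S μ n} (hA : T.SoundAt Θ False .ty A A')
    (h : T.SoundAt Θ True (.tm A') s t) : T.SoundAt Θ True (.tm A) s t := by
  intro hc k Δ σ ts hΔ hs ht
  have h_ty : T.Derives Θ Δ (.judg (.eqTy (A.subst σ) (A'.subst σ)) .starTy) :=
    hA (Or.inl rfl) k Δ σ ts hΔ (hs.presup hΔ).bdryTm_inv False.elim
  exact .convEq (h hc k Δ σ ts hΔ (.convTm hs h_ty) fun _ => .convTm (ht trivial) h_ty) h_ty.tySym

theorem sym (hT : T.IsStandard) {f : S.Sym c} {Ξ : MCtx S (S.arity f)}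
    {B₀ : Bdry S (S.arity f) c 0 0} (hf : T.IsRuleFor f Ξ B₀) {es ds : Inst S (S.arity f) μ n}
    (h : ∀ (α : MArity) (M : MVar (S.arity f) α), α.cls.IsObj →
      T.SoundAt Θ b ((Ξ.get M).actC es) (es α M) (ds α M)) :
    T.SoundAt Θ b B (.sym f es) (.sym f ds) := by
  intro hc k Δ σ ts hΔ h_es h_ds
  obtain ⟨hes, h_conv⟩ := h_es.wfApp hT Ξ B₀ hf
  refine h_conv.eqn_right hc (hf.congr hT hΔ (.of_eq (hf.finitary hT).1 hΔ hes ?_))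
  intro α M hα h_transport
  exact (h α M hα).actC_eqn hα hΔ σ (hes α M) fun hb =>
    h_transport (((h_ds hb).wfApp hT Ξ B₀ hf).1 α M)

theorem mvar (hT : T.IsStandard) (hc : c.IsObj) {M : MVar μ ⟨c, l⟩} {ss ts : Fin l → Tm S μ n}
    (h : ∀ j, T.SoundAt Θ b (.tm ((Θ.get M).argTy ss j)) (ss j) (ts j)) :
    T.SoundAt Θ b B (.mvar hc M ss) (.mvar hc M ts) := by
  intro _ k Δ σ us hΔ h_ss h_ts
  obtain ⟨hss, h_conv⟩ := h_ss.wfApp hT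
  refine h_conv.eqn_right hc (.eqn_mvar hΔ.wfMCtx hΔ hc M hss fun j h_transport => ?_)
  have hj := h j (Or.inr rfl) k Δ σ Fin.elim0 hΔ
  simp only [Bdry.instAux, Arg.instAux, Bdry.subst_argTy] at hj
  exact hj (hss j) fun hb => h_transport (((h_ts hb).wfApp hT).1 j)

theorem of_computationRule (hT : T.IsStandard) {R : Rewrite S c} (hR : T.IsComputationRule R)
    {I : Inst S R.ar μ n} (hE : T.EqPremisesHold R.prem Θ I) :
    T.SoundAt Θ b B (R.lhs.actC I) (R.rhs.actC I) := by
  intro hc k Δ σ ts hΔ h_lhs _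
  simp only [Arg.instAux, Arg.subst_actC] at h_lhs ⊢
  exact hR.derives_eqn hT hc hΔ (hE.subst σ) h_lhs

theorem of_extensionalityRule {R : ExtRule S} (hR : T.IsExtensionalityRule R)
    {I : Inst S R.ar μ n} {s t : Tm S μ n}
    (hE : T.EqPremisesHold R.premAll Θ (R.eqs.extend ((I.cons s).cons t))) :
    T.SoundAt Θ True (.tm (R.type.actC I)) s t := by
  intro _ k Δ σ ts hΔ hs ht
  have hE' := hE.subst σ
  rw [EqPrem.subst_extend, Inst.subst_cons, Inst.subst_cons] at hE'
  simp only [Bdry.instAux, Arg.instAux, Arg.subst_actC] at hs ht ⊢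
  exact hR.derives_eqTm hΔ hE' hs (ht trivial)

end RawTheory.SoundAt

theorem RawTheory.Algo.soundAt (hT : T.IsStandard) {ι : Cls → Type w}
    {C : ∀ c : Cls, ι c → Rewrite S c} (hC : ∀ (c : Cls) (i : ι c), T.IsComputationRule (C c i))
    {κ : Type x} {E : κ → ExtRule S} (hE : ∀ i : κ, T.IsExtensionalityRule (E i))
    {P : Principal S μ} {ph : Phase} {Γ : Ctx S μ n} {BB : Bdry S μ c m n}
    {e₁ e₂ : Arg S μ c m n} (h : T.Algo C E P Θ ph Γ BB e₁ e₂) :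
    T.SoundAt Θ ph.IsCheck BB e₁ e₂ := by
  induction h with
  | compute _ i _ _ h_lhs _ ih =>
    exact h_lhs ▸ .of_computationRule hT (hC _ i) (eqPremisesHold_of_soundAt ih)
  | principalSym _ f _ _ _ _ hf _ h_eq ih =>
    refine .sym hT hf fun α M _ => ?_
    by_cases hP : P.sym f α M
    · exact ih α M hP
    · exact h_eq α M hP ▸ .refl _ _ _
  | principalMVar _ hc M _ _ _ h_eq ih =>
    refine .mvar hT hc fun j => ?_
    by_cases hP : P.mvar M j
    · exact ih j hP
    · exact h_eq j hP ▸ .refl _ _ _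
  | normStep _ _ _ _ _ _ _ _ ih₁ ih₂ ih₃ => exact (ih₁.trans ih₂).trans ih₃
  | normDone _ _ _ _ _ ih => exact ih
  | normAbs _ _ _ _ _ ih => exact ih.abs
  | normVar => exact .refl _ _ _
  | normStarTy => exact .refl _ _ _
  | normStarTm => exact .refl _ _ _
  | checkTm _ _ _ _ _ _ ih₁ ih₂ => exact ih₁.conv ih₂
  | checkTy _ _ _ _ _ _ _ ih₁ ih₂ ih₃ => exact .of_norm ih₁ ih₂ ih₃
  | checkAbs _ _ _ _ _ ih => exact ih.abs
  | extApply i _ _ _ _ h_type _ ih =>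
    exact h_type ▸ .of_extensionalityRule (hE i) (eqPremisesHold_of_soundAt ih)
  | extNone _ _ _ _ _ _ _ _ _ ih₁ ih₂ ih₃ => exact .of_norm ih₁ ih₂ ih₃
  | neutVar => exact .refl _ _ _
  | neutSym _ f _ _ _ _ hf _ _ ih_principal ih_other =>
    refine .sym hT hf fun α M hα => ?_
    by_cases hP : P.sym f α M
    · exact ih_principal α M hα hP
    · exact ih_other α M hα hP
  | neutMVar _ hc M _ _ _ _ ih_principal ih_other =>
    refine .mvar hT hc fun j => ?_
    by_cases hP : P.mvar M j
    · exact ih_principal j hP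
    · exact ih_other j hP
  | neutAbs _ _ _ _ _ ih => exact ih.abs

theorem RawTheory.SoundAt.derives {b : Prop} {BB : Bdry S μ c m n} {e₁ e₂ : Arg S μ c m n}
    (h : T.SoundAt Θ b BB e₁ e₂) (hb : ¬ b) (hc : c.IsObj) {Γ : Ctx S μ n} (hΓ : T.WfCtx Θ Γ)
    (h₁ : T.Derives Θ Γ (.judg BB e₁)) :
    T.Derives Θ Γ (.eqn BB e₁ e₂) ∧ T.Derives Θ Γ (.judg BB e₂) := by
  have := RawTheory.Derives.eqn_of_instances hc hΓ b h₁ (fun h => absurd h hb) (h hc)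
  exact ⟨this, this.eqn_right hc hΓ⟩

end Soundness

end FTT

theorem mainTheorem1 {S : FTT.Signature.{u}} (T : FTT.RawTheory.{u, v} S) (hT : T.IsStandard)
    {ι : FTT.Cls → Type w} (C : ∀ c : FTT.Cls, ι c → FTT.Rewrite S c)
    (hC : ∀ (c : FTT.Cls) (i : ι c), T.IsComputationRule (C c i))
    {κ : Type x} (E : κ → FTT.ExtRule S) (hE : ∀ i : κ, T.IsExtensionalityRule (E i))
    {μ : List FTT.MArity} (P : FTT.Principal S μ) (Θ : FTT.MCtx S μ)
    {n : ℕ} (Γ : FTT.Ctx S μ n) (hΓ : T.WfCtx Θ Γ) {c : FTT.Cls} (hc : c.IsObj) :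
    (∀ (m : ℕ) (BB : FTT.Bdry S μ c m n) (e₁ e₂ : FTT.Arg S μ c m n),
      T.Derives Θ Γ (.judg BB e₁) → T.Algo C E P Θ .norm Γ BB e₁ e₂ →
      T.Derives Θ Γ (.eqn BB e₁ e₂) ∧ T.Derives Θ Γ (.judg BB e₂)) ∧
    (∀ (B : FTT.Bdry S μ c 0 n) (e₁ e₂ : FTT.Arg S μ c 0 n),
      T.Derives Θ Γ (.judg B e₁) → T.Algo C E P Θ .normP Γ B e₁ e₂ →
      T.Derives Θ Γ (.eqn B e₁ e₂) ∧ T.Derives Θ Γ (.judg B e₂)) ∧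
    (∀ (B : FTT.Bdry S μ c 0 n) (e₁ e₂ : FTT.Arg S μ c 0 n),
      T.Derives Θ Γ (.judg B e₁) → T.Algo C E P Θ .normC Γ B e₁ e₂ →
      T.Derives Θ Γ (.eqn B e₁ e₂) ∧ T.Derives Θ Γ (.judg B e₂)) :=
  ⟨fun _ _ _ _ h₁ h₂ => (h₂.soundAt hT hC hE).derives (fun h => h) hc hΓ h₁,
    fun _ _ _ h₁ h₂ => (h₂.soundAt hT hC hE).derives (fun h => h) hc hΓ h₁,
    fun _ _ _ h₁ h₂ => (h₂.soundAt hT hC hE).derives (fun h => h) hc hΓ h₁⟩
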